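/- **Setting.** Let $B\subset\mathbb R^3$ be the open unit ball, $\mathbb S^2=\partial B$ with surface measure $\sin\theta\,d\varphi\,d\theta$, polar angle $\theta$ measured from the $x_3$-axis and $e_\varphi=(-\sin\varphi,\cos\varphi,0)$. Let $\Delta_{\mathbb S^2}$ be the Laplace–Beltrami operator, understood weakly in $L^2(\mathbb S^2)$, and let $\Lambda$ be the Dirichlet-to-Neumann operator of $B$, acting componentwise on vector fields: $\Lambda g=\partial_s f|_{s=1}$, where $s=|x|$, $\Delta f=0$ in $B$ and $f=g$ on $\partial B$ (boundary values of $f$ and $\partial_s f$ taken as $L^2(\mathbb S^2)$-limits along the spheres of radius $s\nearrow1$). For $\mu\in\mathbb R$ put $$\mathcal A(\mu)\eta=\sin\theta\,e_\varphi\cdot(2\,\mathrm{Id}-\Lambda)(\sin\theta\,\eta\,e_\varphi)-\mu(\Delta_{\mathbb S^2}+2\,\mathrm{Id})\eta .$$ Let $Y_l^0(\theta)=\sqrt{\tfrac{2l+1}{4\pi}}\,P_l(\cos\theta)$, with $P_l$ the Legendre polynomials, and for $\alpha\ge0$ let $\mathrm h^\alpha$ be the space of real sequences $v=(v_k)_{k\ge1}$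 with $\|v\|_{\mathrm h^\alpha}^2=\sum_{k\ge1}k^{2\alpha}v_k^2<\infty$. A sequence $v$ is identified with the function $\sum_{k\ge1}v_kY_{2k}^0$, the series converging in $L^2(\mathbb S^2)$; values of $\mathcal A(\mu)$ are regarded modulo constants, i.e. modulo multiples of $Y_0^0$, when $\mathcal A(\mu)$ is read as an operator on sequences. **Lemma.** Let $\alpha\ge0$ and $\mu\in\mathbb R$. For every $v\in\mathrm h^{\alpha+2}$ the function $\mathcal A(\mu)\big(\sum_k v_kY_{2k}^0\big)\in L^2(\mathbb S^2)$ is well defined, and $$\mathcal A(\mu)\Big(\sum_{k=1}^\infty v_kY_{2k}^0\Big)=\sum_{k=2}^\infty\big(A_k(\mu)v_k+B_kv_{k-1}+C_kv_{k+1}\big)Y_{2k}^0+\big(A_1(\mu)v_1+C_1v_2\big)Y_2^0+C_0v_1Y_0^0$$ with convergence in $L^2(\mathbb S^2)$, where $$A_k(\mu)=\mu(2k-1)(2k+2)-\frac{2k(2k-3)(2k-1)}{(4k+1)(4k-1)}-\frac{(2k-1)(2k+1)(2k+2)}{(4k+1)(4k+3)},$$ $$B_k=\frac{2k(2k-3)(2k-1)}{(4k-3)(4k-1)}\sqrt{\frac{4k-3}{4k+1}},\qquad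 C_k=\frac{(2k-1)(2k+1)(2k+2)}{(4k+3)(4k+5)}\sqrt{\frac{4k+5}{4k+1}} .$$ Modulo constants, $\mathcal A(\mu)$ thus acts as a bounded linear operator $\mathrm h^{\alpha+2}\to\mathrm h^\alpha$, given by a tridiagonal matrix with $B_{k+1}=C_k$ for $k\ge1$, and it is symmetric: $\sum_k(\mathcal A(\mu)v)_kw_k=\sum_kv_k(\mathcal A(\mu)w)_k$ for all $v,w\in\mathrm h^{\alpha+2}$, both series being convergent. -/

import Mathlib

open MeasureTheory Filter Topology
open scoped ContDiff

noncomputable section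

/-- Euclidean three-space. -/
abbrev Space3 : Type := EuclideanSpace ℝ (Fin 3)

/-- The unit sphere `𝕊²` in three-space. -/
abbrev Sphere2 : Type := Metric.sphere (0 : Space3) 1

/-- The surface measure on `𝕊²` (total mass `4π`), in spherical coordinates
`sin θ dφ dθ`. -/
abbrev sphereMeasure : Measure Sphere2 := (volume : Measure Space3).toSphere

/-- The Hilbert space `L²(𝕊²)` of real functions. -/
abbrev L2Sphere : Type := Lp ℝ 2 sphereMeasure

/-! ### Zonal spherical harmonics -/

/-- The Legendre polynomial `P_l = P_l^0`, by the Rodrigues formula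
`P_l(t) = 1 / (2^l l!) (d/dt)^l (t^2 - 1)^l`. -/
def legendrePoly (l : ℕ) : Polynomial ℝ :=
  Polynomial.C (1 / ((2 : ℝ) ^ l * (l.factorial : ℝ))) *
    (Polynomial.derivative^[l]) ((Polynomial.X ^ 2 - 1) ^ l)

/-- The zonal spherical harmonic `Y_l^0(θ) = √((2l+1)/(4π)) P_l(cos θ)` as a continuous function
on the sphere; the polar angle is measured from the `x₃`-axis, so that `cos θ = x₃`. -/
def zonalHarmonic (l : ℕ) : C(Sphere2, ℝ) where
  toFun x := Real.sqrt ((2 * (l : ℝ) + 1) / (4 * Real.pi)) * (legendrePoly l).eval ((x : Space3) 2)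
  continuous_toFun := by
    have h : Continuous fun x : Sphere2 => (x : Space3) 2 := by fun_prop
    exact continuous_const.mul ((legendrePoly l).continuous.comp h)

/-- `Y_l^0` as an element of `L²(𝕊²)`. -/
def zonalL2 (l : ℕ) : L2Sphere := ContinuousMap.toLp 2 sphereMeasure ℝ (zonalHarmonic l)

/-! ### The azimuthal field -/

/-- The vector field `sin θ e_φ = (-x₂, x₁, 0)`. -/
def sinAzimuth (x : Space3) : Space3 := !₂[-x 1, x 0, 0]

/-- In spherical coordinates `sinAzimuth` is `sin θ` times the unit vector
`e_φ = (-sin φ, cos φ, 0)`. -/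
theorem sinAzimuth_spherical (θ φ : ℝ) :
    sinAzimuth !₂[Real.sin θ * Real.cos φ, Real.sin θ * Real.sin φ, Real.cos θ] =
      Real.sin θ • (!₂[-Real.sin φ, Real.cos φ, 0] : Space3) := by
  ext i
  fin_cases i <;> simp [sinAzimuth]

/-! ### The Laplace-Beltrami operator on the sphere -/

/-- The Laplace-Beltrami operator applied to (the restriction to `𝕊²` of) a smooth function `f`:
the Euclidean Laplacian of the extension `y ↦ f (y / |y|)`, homogeneous of degree zero,
evaluated on the sphere. -/
def sphereLaplacian (f : Space3 → ℝ) (x : Sphere2) : ℝ :=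
  Laplacian.laplacian (fun y : Space3 => f (‖y‖⁻¹ • y)) (x : Space3)

/-- `w = Δ_{𝕊²} u` weakly in `L²(𝕊²)`. -/
def IsLaplaceBeltrami (u w : Sphere2 → ℝ) : Prop :=
  MemLp u 2 sphereMeasure ∧ MemLp w 2 sphereMeasure ∧
    ∀ f : Space3 → ℝ, ContDiff ℝ ∞ f →
      ∫ x, u x * sphereLaplacian f x ∂sphereMeasure =
        ∫ x : Sphere2, w x * f (x : Space3) ∂sphereMeasure

/-! ### The Dirichlet-to-Neumann operator of the unit ball -/

/-- `w = Λ g` for vector fields on the sphere: `w` is the normal derivative `∂_s f` on `∂B` of the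
harmonic extension `f` of `g` to the unit ball `B`. The boundary values of `f` and of its radial
derivative are attained in `L²(𝕊²)`, along the spheres of radius `s ↗ 1`. -/
def IsDirichletToNeumann (g w : Sphere2 → Space3) : Prop :=
  MemLp g 2 sphereMeasure ∧ MemLp w 2 sphereMeasure ∧
    ∃ f : Space3 → Space3,
      InnerProductSpace.HarmonicOnNhd f (Metric.ball 0 1) ∧
      Tendsto (fun s : ℝ =>
          eLpNorm (fun x : Sphere2 => f (s • (x : Space3)) - g x) 2 sphereMeasure)
        (𝓝[<] 1) (𝓝 0) ∧
      Tendsto (fun s : ℝ =>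
          eLpNorm (fun x : Sphere2 => deriv (fun r : ℝ => f (r • (x : Space3))) s - w x)
            2 sphereMeasure)
        (𝓝[<] 1) (𝓝 0)

/-! ### The linearized operator -/

/-- The graph of the linearized operator: `w = 𝒜(μ) u`, where
`𝒜(μ) u = sin θ e_φ · (2 Id - Λ)(sin θ u e_φ) - μ (Δ_{𝕊²} + 2 Id) u`. -/
def IsLinearizedOperator (μ : ℝ) (u w : L2Sphere) : Prop :=
  ∃ (G : Sphere2 → Space3) (L : Sphere2 → ℝ),
    IsDirichletToNeumann (fun x => u x • sinAzimuth x) G ∧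
    IsLaplaceBeltrami u L ∧
    ∀ᵐ x ∂sphereMeasure,
      w x = inner ℝ (sinAzimuth x) ((2 : ℝ) • (u x • sinAzimuth x) - G x) - μ * (L x + 2 * u x)

/-! ### Sequence spaces -/

/-- The sequence space `h^α` of all real `(v_k)_{k ≥ 1}` with `∑ k^{2α} v_k^2 < ∞`. -/
def SeqSpace (α : ℝ) : Submodule ℝ (ℕ+ → ℝ) where
  carrier := {v | Summable fun k : ℕ+ => (k : ℝ) ^ (2 * α) * v k ^ 2}
  zero_mem' := by simp
  add_mem' := by
    intro v w hv hw
    refine Summable.of_nonneg_of_le (fun k => by positivity) (fun k => ?_)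
      ((hv.mul_left 2).add (hw.mul_left 2))
    have h : (0 : ℝ) ≤ (k : ℝ) ^ (2 * α) := by positivity
    have h2 := mul_nonneg h (sq_nonneg (v k - w k))
    simp only [Pi.add_apply]
    nlinarith
  smul_mem' := by
    intro c v hv
    refine (Summable.mul_left (c ^ 2) hv).congr (fun k => ?_)
    simp only [Pi.smul_apply, smul_eq_mul]
    ring

/-- The norm `‖v‖_{h^α} = (∑ k^{2α} v_k^2)^{1/2}`. -/
def seqNorm (α : ℝ) (v : SeqSpace α) : ℝ :=
  Real.sqrt (∑' k : ℕ+, (k : ℝ) ^ (2 * α) * v.1 k ^ 2)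

/-! ### The matrix coefficients -/

/-- The diagonal coefficient `A_k(μ)`. -/
def coeffA (μ : ℝ) (n : ℕ) : ℝ :=
  let k : ℝ := n
  μ * (2 * k - 1) * (2 * k + 2)
    - 2 * k * (2 * k - 3) * (2 * k - 1) / ((4 * k + 1) * (4 * k - 1))
    - (2 * k - 1) * (2 * k + 1) * (2 * k + 2) / ((4 * k + 1) * (4 * k + 3))

/-- The lower off-diagonal coefficient `B_k`. -/
def coeffB (n : ℕ) : ℝ :=
  let k : ℝ := n
  2 * k * (2 * k - 3) * (2 * k - 1) / ((4 * k - 3) * (4 * k - 1))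
    * Real.sqrt ((4 * k - 3) / (4 * k + 1))

/-- The upper off-diagonal coefficient `C_k`. -/
def coeffC (n : ℕ) : ℝ :=
  let k : ℝ := n
  (2 * k - 1) * (2 * k + 1) * (2 * k + 2) / ((4 * k + 3) * (4 * k + 5))
    * Real.sqrt ((4 * k + 5) / (4 * k + 1))

end

/-! ### Legendre polynomials: differential identities and the bound by one. -/

section LegendrePolynomials

open Polynomial

/-! The field sin θ e_φ is x ↦ (-x₂, x₁, 0), and |x|^n P_{n+1}'(x₃/|x|) (-x₂, x₁, 0) is a harmonic
polynomial field, homogeneous of degree n+1. Hence the azimuthal harmonics Z_n = P_{n+1}'(cos θ) sin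
θ e_φ are eigenfields of the Dirichlet-to-Neumann operator: Λ Z_n = (n+1) Z_n.

Two Legendre identities then give the matrix. Since (2l+1) P_l = P_{l+1}' - P_{l-1}', multiplication
by sin θ e_φ sends (2l+1) P_l to Z_l - Z_{l-2}. Since (2n+3)(1-t²) P_{n+1}' = (n+1)(n+2)(P_n -
P_{n+2}), the inner product of Z_n with sin θ e_φ combines only Y_n and Y_{n+2}. So Y_l is mapped
into the span of Y_{l-2}, Y_l, Y_{l+2}, while the Laplace-Beltrami part is diagonal with factor 2 -
l(l+1). Taking l = 2(j+1) gives `linearizedZonal_even`.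

The operator is given as a relation, so it has to be shown total and single-valued. Totality on
h^{α+2} is `isLinearizedOperator_of_series`: the harmonic extension is an explicit series of solid
zonal polynomials, harmonic by `laplacian_coord_mul_solidSeries`, and Abel summation gives its
boundary values and its radial derivative in L². Single-valuedness is `IsLinearizedOperator.unique`.
For Λ it rests on an energy monotonicity argument (`integral_sq_fderiv_radial_eq_zero`), for the
weak Laplacian on testing against all smooth functions. Both use integration by parts along
infinitesimal rotations, which preserve the surface measure.

Boundedness holds because all entries are O(k²) and only neighbouring indices interact. Symmetry is
B_{k+1} = C_k together with an index shift. -/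

theorem derivative_X_sq_sub_one_pow_succ (l : ℕ) :
    derivative ((X ^ 2 - 1 : ℝ[X]) ^ (l + 1)) = C (2 * ((l : ℝ) + 1)) * (X * (X ^ 2 - 1) ^ l) := by
  rw [derivative_pow_succ]
  simp only [derivative_sub, derivative_X_pow, derivative_one, C_mul, C_add]
  simp
  ring

theorem legendrePoly_zero : legendrePoly 0 = 1 := by
  simp [legendrePoly]

theorem legendrePoly_succ (l : ℕ) :
    legendrePoly (l + 1) = C (1 / ((2 : ℝ) ^ l * (l.factorial : ℝ))) *
      derivative^[l] (X * (X ^ 2 - 1) ^ l) := by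
  rw [legendrePoly, Function.iterate_succ_apply, derivative_X_sq_sub_one_pow_succ,
    iterate_derivative_C_mul, ← mul_assoc, ← C_mul]
  congr 2
  rw [Nat.factorial_succ]
  push_cast
  field_simp
  ring

/-- `P_{l+1}' = X P_l' + (l+1) P_l`. -/
theorem derivative_legendrePoly_succ (l : ℕ) :
    derivative (legendrePoly (l + 1)) =
      X * derivative (legendrePoly l) + C ((l : ℝ) + 1) * legendrePoly l := by
  rw [legendrePoly_succ, derivative_C_mul, ← Function.iterate_succ_apply' (⇑derivative), mul_comm X,
    iterate_derivative_mul_X, legendrePoly, derivative_C_mul, ← Function.iterate_succ_apply' (⇑derivative)]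
  simp only [Nat.succ_eq_add_one, Nat.add_sub_cancel, nsmul_eq_mul]
  push_cast
  simp only [C_add, C_1, map_natCast]
  ring

/-- `P_{l+2}' = P_l' + (2l+3) P_{l+1}`. -/
theorem derivative_legendrePoly_add_two (l : ℕ) :
    derivative (legendrePoly (l + 2)) =
      derivative (legendrePoly l) + C (2 * (l : ℝ) + 3) * legendrePoly (l + 1) := by
  have h1 : derivative (X * (X ^ 2 - 1 : ℝ[X]) ^ (l + 1)) =
      C (2 * (l : ℝ) + 3) * (X ^ 2 - 1) ^ (l + 1) + C (2 * ((l : ℝ) + 1)) * (X ^ 2 - 1) ^ l := by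
    rw [derivative_mul, derivative_X_sq_sub_one_pow_succ]
    simp only [derivative_X, C_mul, C_add]
    have : (C (3 : ℝ) : ℝ[X]) = 2 + 1 := by rw [← map_ofNat C 2, ← C_1, ← C_add]; norm_num
    rw [this]
    simp only [C_1, map_ofNat]
    ring
  rw [legendrePoly_succ, derivative_C_mul, ← Function.iterate_succ_apply' (⇑derivative),
    Function.iterate_succ_apply, h1, iterate_map_add, iterate_derivative_C_mul,
    iterate_derivative_C_mul, legendrePoly, legendrePoly, derivative_C_mul,
    ← Function.iterate_succ_apply' (⇑derivative)]
  have h2 : C (1 / ((2 : ℝ) ^ (l + 1) * ((l + 1).factorial : ℝ))) * C (2 * ((l : ℝ) + 1)) =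
      C (1 / ((2 : ℝ) ^ l * (l.factorial : ℝ))) := by
    rw [← C_mul, Nat.factorial_succ]
    congr 1
    push_cast
    field_simp
    ring
  linear_combination derivative^[l + 1] ((X ^ 2 - 1) ^ l) * h2

/-- `(1 - X^2) P_{l+1}' = (l+1) (P_l - X P_{l+1})`. -/
theorem one_sub_X_sq_mul_derivative_legendrePoly_succ (l : ℕ) :
    (1 - X ^ 2) * derivative (legendrePoly (l + 1)) =
      C ((l : ℝ) + 1) * (legendrePoly l - X * legendrePoly (l + 1)) := by
  have h1 := derivative_legendrePoly_succ l
  have h2 := derivative_legendrePoly_succ (l + 1)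
  have h3 := derivative_legendrePoly_add_two l
  have h4 : (C (2 * (l : ℝ) + 3) : ℝ[X]) = C ((l : ℝ) + 1) + C (((l + 1 : ℕ) : ℝ) + 1) := by
    rw [← C_add]; congr 1; push_cast; ring
  rw [h4] at h3
  linear_combination h1 + X * (h2 - h3)

/-- `(1 - X^2) P_l' = (l+1) (X P_l - P_{l+1})`. -/
theorem one_sub_X_sq_mul_derivative_legendrePoly (l : ℕ) :
    (1 - X ^ 2) * derivative (legendrePoly l) =
      C ((l : ℝ) + 1) * (X * legendrePoly l - legendrePoly (l + 1)) := by
  have h1 := derivative_legendrePoly_succ l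
  have h2 := one_sub_X_sq_mul_derivative_legendrePoly_succ l
  have h3 := derivative_legendrePoly_succ (l + 1)
  have h4 := derivative_legendrePoly_add_two l
  have h5 : (C (2 * (l : ℝ) + 3) : ℝ[X]) = C ((l : ℝ) + 1) + C (((l + 1 : ℕ) : ℝ) + 1) := by
    rw [← C_add]; congr 1; push_cast; ring
  rw [h5] at h4
  linear_combination h3 - h4 + X * h1

/-- The three-term recurrence. -/
theorem legendrePoly_add_two (l : ℕ) :
    C ((l : ℝ) + 2) * legendrePoly (l + 2) =
      C (2 * (l : ℝ) + 3) * (X * legendrePoly (l + 1)) - C ((l : ℝ) + 1) * legendrePoly l := by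
  have h1 := one_sub_X_sq_mul_derivative_legendrePoly (l + 1)
  have h2 := one_sub_X_sq_mul_derivative_legendrePoly_succ l
  have h3 : (C (2 * (l : ℝ) + 3) : ℝ[X]) = C ((l : ℝ) + 1) + C ((l : ℝ) + 2) := by
    rw [← C_add]; congr 1; ring
  have h4 : (C (((l + 1 : ℕ) : ℝ) + 1) : ℝ[X]) = C ((l : ℝ) + 2) := by
    congr 1; push_cast; ring
  rw [h4] at h1
  rw [h3]
  linear_combination h1 - h2

theorem legendrePoly_one : legendrePoly 1 = X := by
  rw [legendrePoly_succ]
  simp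

/-- The Legendre differential equation. -/
theorem derivative_one_sub_X_sq_mul_derivative_legendrePoly (l : ℕ) :
    derivative ((1 - X ^ 2) * derivative (legendrePoly l)) =
      -(C ((l : ℝ) * ((l : ℝ) + 1)) * legendrePoly l) := by
  rw [one_sub_X_sq_mul_derivative_legendrePoly, derivative_C_mul, derivative_sub,
    derivative_legendrePoly_succ, derivative_mul, derivative_X, C_mul, C_add]
  simp only [C_1]
  ring

/-- `(2l+3) (1 - X^2) P_{l+1}' = (l+1)(l+2) (P_l - P_{l+2})`. -/
theorem one_sub_X_sq_mul_derivative_legendrePoly_eq_sub (l : ℕ) :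
    C (2 * (l : ℝ) + 3) * ((1 - X ^ 2) * derivative (legendrePoly (l + 1))) =
      C (((l : ℝ) + 1) * ((l : ℝ) + 2)) * (legendrePoly l - legendrePoly (l + 2)) := by
  have h1 := one_sub_X_sq_mul_derivative_legendrePoly_succ l
  have h2 := legendrePoly_add_two l
  have h3 : (C (2 * (l : ℝ) + 3) : ℝ[X]) = C ((l : ℝ) + 1) + C ((l : ℝ) + 2) := by
    rw [← C_add]; congr 1; ring
  rw [h3] at h2 ⊢
  rw [C_mul]
  linear_combination (C ((l : ℝ) + 1) + C ((l : ℝ) + 2)) * h1 + C ((l : ℝ) + 1) * h2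

theorem eval_one_legendrePoly (l : ℕ) : (legendrePoly l).eval 1 = 1 := by
  induction l with
  | zero => simp [legendrePoly_zero]
  | succ l ih =>
    have h := congrArg (eval 1) (one_sub_X_sq_mul_derivative_legendrePoly_succ l)
    simp only [eval_mul, eval_sub, eval_one, eval_pow, eval_X, eval_C, ih] at h
    have : (l : ℝ) + 1 ≠ 0 := by positivity
    have h' : ((l : ℝ) + 1) * (1 - (legendrePoly (l + 1)).eval 1) = 0 := by linarith
    rcases mul_eq_zero.1 h' with h' | h'
    · exact absurd h' this
    · linarith

theorem eval_neg_legendrePoly (l : ℕ) (t : ℝ) :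
    (legendrePoly l).eval (-t) = (-1) ^ l * (legendrePoly l).eval t := by
  induction l using Nat.strong_induction_on with
  | _ l ih =>
    match l with
    | 0 => simp [legendrePoly_zero]
    | 1 => simp [legendrePoly_one]
    | l + 2 =>
      have h1 := congrArg (eval (-t)) (legendrePoly_add_two l)
      have h2 := congrArg (eval t) (legendrePoly_add_two l)
      simp only [eval_mul, eval_sub, eval_X, eval_C, ih l (by omega), ih (l + 1) (by omega)] at h1 h2
      have : (l : ℝ) + 2 ≠ 0 := by positivity
      apply mul_left_cancel₀ this
      rw [h1]
      linear_combination -(-1 : ℝ) ^ (l + 2) * h2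

/-- Sonin's argument: F = l(l+1) P² + (1-x²) P'² satisfies F' = 2x P'² by the Legendre equation, so
F increases on [0,1] up to F(1) = l(l+1), which bounds l(l+1) P². Parity covers [-1,0]. -/
theorem abs_eval_legendrePoly_le_one (l : ℕ) {t : ℝ} (ht : t ∈ Set.Icc (-1 : ℝ) 1) :
    |(legendrePoly l).eval t| ≤ 1 := by
  have key : ∀ t ∈ Set.Icc (0 : ℝ) 1, |(legendrePoly l).eval t| ≤ 1 := by
    intro t ht
    rcases Nat.eq_zero_or_pos l with rfl | hl
    · simp [legendrePoly_zero]
    set P := legendrePoly l with hP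
    set c : ℝ := (l : ℝ) * ((l : ℝ) + 1) with hc
    have hc0 : 0 < c := by positivity
    set F : ℝ[X] := C c * P ^ 2 + (1 - X ^ 2) * derivative P ^ 2 with hF
    have hF' : derivative F = 2 * X * derivative P ^ 2 := by
      have h := derivative_one_sub_X_sq_mul_derivative_legendrePoly l
      rw [← hP, ← hc] at h
      have e : F = C c * P ^ 2 + ((1 - X ^ 2) * derivative P) * derivative P := by rw [hF]; ring
      have h6 : derivative ((1 - X ^ 2 : ℝ[X])) = -(2 * X) := by
        simp
        norm_num
      have h7 := h
      rw [derivative_mul, h6] at h7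
      rw [e, derivative_add, derivative_C_mul, derivative_mul (f := (1 - X ^ 2) * derivative P), h,
        derivative_pow]
      simp only [Nat.cast_ofNat, Nat.reduceSub, pow_one, map_ofNat]
      linear_combination derivative P * h7
    have hmono : MonotoneOn (fun x => F.eval x) (Set.Icc (0 : ℝ) 1) := by
      apply monotoneOn_of_deriv_nonneg (convex_Icc 0 1) F.continuous.continuousOn
        F.differentiable.differentiableOn
      intro x hx
      rw [interior_Icc] at hx
      rw [Polynomial.deriv, hF']
      simp only [eval_mul, eval_pow, eval_X, eval_ofNat]
      have := hx.1.le
      positivity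
    have h1 := hmono ht (Set.right_mem_Icc.2 zero_le_one) ht.2
    simp only [hF, eval_add, eval_mul, eval_C, eval_pow, eval_sub, eval_one, eval_X] at h1
    rw [hP, eval_one_legendrePoly, ← hP] at h1
    have h2 : 0 ≤ (1 - t ^ 2) * (eval t (derivative P)) ^ 2 := by
      have : 0 ≤ 1 - t ^ 2 := by nlinarith [ht.1, ht.2]
      positivity
    rw [abs_le_one_iff_mul_self_le_one]
    have h3 : c * (eval t P ^ 2) ≤ c * 1 := by nlinarith
    have := le_of_mul_le_mul_left h3 hc0
    nlinarith
  rcases le_total 0 t with h | h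
  · exact key t ⟨h, ht.2⟩
  · have := key (-t) ⟨by linarith, by linarith [ht.1]⟩
    rwa [eval_neg_legendrePoly, abs_mul, abs_pow, abs_neg, abs_one, one_pow, one_mul] at this

end LegendrePolynomials

/-! ### Solid zonal polynomials, their growth, gradients and power series. -/

section SolidGegenbauer

/-- The constants `(2j-1)!!`. -/
noncomputable def gegenbauerConst : ℕ → ℝ
  | 0 => 1
  | j + 1 => (2 * (j : ℝ) + 1) * gegenbauerConst j

/-- The solid zonal polynomial `|x|^n P_{n+j}^{(j)}(x₃/|x|)`, defined by the three-term recurrence of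
the Gegenbauer polynomials. -/
noncomputable def solidGegenbauer (j : ℕ) : ℕ → Space3 → ℝ
  | 0, _ => gegenbauerConst j
  | 1, x => (2 * (j : ℝ) + 1) * gegenbauerConst j * x 2
  | n + 2, x => ((2 * (n : ℝ) + 2 * j + 3) * (x 2 * solidGegenbauer j (n + 1) x) -
      ((n : ℝ) + 2 * j + 1) * (‖x‖ ^ 2 * solidGegenbauer j n x)) / ((n : ℝ) + 2)

theorem solidGegenbauer_zero (j : ℕ) (x : Space3) : solidGegenbauer j 0 x = gegenbauerConst j := by
  rw [solidGegenbauer]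

theorem solidGegenbauer_one (j : ℕ) (x : Space3) :
    solidGegenbauer j 1 x = (2 * (j : ℝ) + 1) * gegenbauerConst j * x 2 := by
  rw [solidGegenbauer]

theorem solidGegenbauer_add_two (j n : ℕ) (x : Space3) :
    ((n : ℝ) + 2) * solidGegenbauer j (n + 2) x =
      (2 * (n : ℝ) + 2 * j + 3) * (x 2 * solidGegenbauer j (n + 1) x) -
        ((n : ℝ) + 2 * j + 1) * (‖x‖ ^ 2 * solidGegenbauer j n x) := by
  rw [solidGegenbauer]
  field_simp

theorem gegenbauerConst_succ (j : ℕ) :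
    gegenbauerConst (j + 1) = (2 * (j : ℝ) + 1) * gegenbauerConst j := by
  rw [gegenbauerConst]

theorem gegenbauerConst_pos (j : ℕ) : 0 < gegenbauerConst j := by
  induction j with
  | zero => simp [gegenbauerConst]
  | succ j ih => rw [gegenbauerConst_succ]; positivity

/-- These are the homogeneous forms of P_{l+1}' = t P_l' + (l+1) P_l and P_{l-1}' = t P_l' - l P_l,
differentiated j times. They are proved together because the induction step for each uses the other.
-/
theorem solidGegenbauer_ladder (j n : ℕ) (x : Space3) :
    solidGegenbauer (j + 1) (n + 1) x = x 2 * solidGegenbauer (j + 1) n x +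
        ((n : ℝ) + 2 * j + 2) * solidGegenbauer j (n + 1) x ∧
      ‖x‖ ^ 2 * solidGegenbauer (j + 1) n x = x 2 * solidGegenbauer (j + 1) (n + 1) x -
        ((n : ℝ) + 2) * solidGegenbauer j (n + 2) x := by
  induction n with
  | zero =>
    have h := solidGegenbauer_add_two j 0 x
    simp only [zero_add, solidGegenbauer_one, solidGegenbauer_zero, gegenbauerConst_succ] at h ⊢
    push_cast at h ⊢
    constructor
    · ring
    · linear_combination h
  | succ n ih =>
    obtain ⟨h1, h2⟩ := ih
    have r1 := solidGegenbauer_add_two (j + 1) n x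
    have r2 := solidGegenbauer_add_two j (n + 1) x
    push_cast at r1 r2 ⊢
    have hn : (n : ℝ) + 2 ≠ 0 := by positivity
    have h3 : solidGegenbauer (j + 1) (n + 1 + 1) x = x 2 * solidGegenbauer (j + 1) (n + 1) x +
        ((n : ℝ) + 1 + 2 * j + 2) * solidGegenbauer j (n + 1 + 1) x := by
      apply mul_left_cancel₀ hn
      linear_combination r1 - ((n : ℝ) + 2 * j + 3) * h2
    refine ⟨h3, ?_⟩
    linear_combination ‖x‖ ^ 2 * h1 + x 2 * h2 - x 2 * h3 + r2

theorem solidGegenbauer_succ_add_two (j n : ℕ) (x : Space3) :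
    solidGegenbauer (j + 1) (n + 2) x = ‖x‖ ^ 2 * solidGegenbauer (j + 1) n x +
      (2 * (n : ℝ) + 2 * j + 5) * solidGegenbauer j (n + 2) x := by
  have h1 := (solidGegenbauer_ladder j n x).2
  have h2 := (solidGegenbauer_ladder j (n + 1) x).1
  push_cast at h2
  linear_combination h2 - h1

/-- The generating function in t of the family j is (2j-1)!! (1 - 2x₃t + |x|²t²)^{-(j+1/2)};
multiplying that of j+1 by the quadratic gives 2j+1 times that of j. This is the relation that later
makes the Laplacian vanish. -/
theorem solidGegenbauer_generating (j n : ℕ) (x : Space3) :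
    solidGegenbauer (j + 1) (n + 2) x - 2 * x 2 * solidGegenbauer (j + 1) (n + 1) x +
      ‖x‖ ^ 2 * solidGegenbauer (j + 1) n x = (2 * (j : ℝ) + 1) * solidGegenbauer j (n + 2) x := by
  have h1 := (solidGegenbauer_ladder j n x).2
  have h2 := (solidGegenbauer_ladder j (n + 1) x).1
  push_cast at h2
  linear_combination h2 + h1

theorem solidGegenbauer_smul (j n : ℕ) (s : ℝ) (x : Space3) :
    solidGegenbauer j n (s • x) = s ^ n * solidGegenbauer j n x := by
  induction n using Nat.strong_induction_on with
  | _ n ih =>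
    match n with
    | 0 => simp [solidGegenbauer_zero]
    | 1 => simp only [solidGegenbauer_one, PiLp.smul_apply, smul_eq_mul]; ring
    | n + 2 =>
      have hn : (n : ℝ) + 2 ≠ 0 := by positivity
      apply mul_left_cancel₀ hn
      rw [solidGegenbauer_add_two, ih n (by omega), ih (n + 1) (by omega), norm_smul, mul_pow,
        Real.norm_eq_abs, sq_abs, PiLp.smul_apply, smul_eq_mul]
      linear_combination -s ^ (n + 2) * solidGegenbauer_add_two j n x

open Polynomial in
theorem solidGegenbauer_zero_eq_legendre (n : ℕ) {x : Space3} (hx : ‖x‖ = 1) :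
    solidGegenbauer 0 n x = (legendrePoly n).eval (x 2) := by
  induction n using Nat.strong_induction_on with
  | _ n ih =>
    match n with
    | 0 => simp [solidGegenbauer_zero, legendrePoly_zero, gegenbauerConst]
    | 1 => simp [solidGegenbauer_one, legendrePoly_one, gegenbauerConst]
    | n + 2 =>
      have hn : (n : ℝ) + 2 ≠ 0 := by positivity
      have h := congrArg (eval (x 2)) (legendrePoly_add_two n)
      simp only [eval_mul, eval_sub, eval_X, eval_C] at h
      apply mul_left_cancel₀ hn
      rw [solidGegenbauer_add_two, ih n (by omega), ih (n + 1) (by omega), hx, h]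
      push_cast
      ring

open Polynomial in
theorem solidGegenbauer_one_eq_derivative_legendre (n : ℕ) {x : Space3} (hx : ‖x‖ = 1) :
    solidGegenbauer 1 n x = (derivative (legendrePoly (n + 1))).eval (x 2) := by
  induction n with
  | zero => simp [solidGegenbauer_zero, legendrePoly_one, gegenbauerConst]
  | succ n ih =>
    have h := congrArg (eval (x 2)) (derivative_legendrePoly_succ (n + 1))
    simp only [eval_mul, eval_add, eval_X, eval_C] at h
    rw [h, (solidGegenbauer_ladder 0 n x).1, zero_add, ih, solidGegenbauer_zero_eq_legendre _ hx]
    push_cast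
    ring

theorem abs_coord_le_norm (x : Space3) (i : Fin 3) : |x i| ≤ ‖x‖ := by
  simpa using PiLp.norm_apply_le x i

theorem abs_solidGegenbauer_zero_le (n : ℕ) (x : Space3) : |solidGegenbauer 0 n x| ≤ ‖x‖ ^ n := by
  have key : ∀ e : Space3, ‖e‖ = 1 → |solidGegenbauer 0 n e| ≤ 1 := by
    intro e he
    rw [solidGegenbauer_zero_eq_legendre n he]
    apply abs_eval_legendrePoly_le_one
    rw [Set.mem_Icc, ← abs_le, ← he]
    exact abs_coord_le_norm e 2
  obtain ⟨e, he, hx⟩ : ∃ e : Space3, ‖e‖ = 1 ∧ x = ‖x‖ • e := by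
    by_cases h : x = 0
    · exact ⟨EuclideanSpace.single 0 1, by simp, by simp [h]⟩
    · refine ⟨‖x‖⁻¹ • x, ?_, ?_⟩
      · rw [norm_smul, norm_inv, norm_norm, inv_mul_cancel₀ (norm_ne_zero_iff.2 h)]
      · rw [smul_smul, mul_inv_cancel₀ (norm_ne_zero_iff.2 h), one_smul]
  have h1 := solidGegenbauer_smul 0 n ‖x‖ e
  rw [← hx] at h1
  rw [h1, abs_mul, abs_of_nonneg (by positivity)]
  exact mul_le_of_le_one_right (by positivity) (key e he)

/-- Raising j costs only a factor polynomial in n, so series with coefficients of polynomial growth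
may be differentiated termwise any number of times inside the ball. The induction steps down by two
in n through `solidGegenbauer_succ_add_two`. -/
theorem abs_solidGegenbauer_le (j n : ℕ) (x : Space3) :
    |solidGegenbauer j n x| ≤ gegenbauerConst j * ((n : ℝ) + 1) ^ (2 * j) * ‖x‖ ^ n := by
  induction j generalizing n with
  | zero => simpa [gegenbauerConst] using abs_solidGegenbauer_zero_le n x
  | succ j ihj =>
    have hκ := gegenbauerConst_pos j
    induction n using Nat.strong_induction_on with
    | _ n ih =>
      match n with
      | 0 => simp [solidGegenbauer_zero, abs_of_pos (gegenbauerConst_pos (j + 1))]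
      | 1 =>
        have h4 : (2 * (j : ℝ) + 3) ≤ 2 ^ (2 * (j + 1)) := by
          have := one_add_mul_le_pow (show (-2 : ℝ) ≤ 3 by norm_num) (j + 1)
          rw [pow_mul]
          norm_num at this ⊢
          linarith [(Nat.cast_nonneg j : (0 : ℝ) ≤ j)]
        have hκ' := gegenbauerConst_pos (j + 1)
        rw [solidGegenbauer_one, abs_mul, abs_of_nonneg (by positivity), pow_one]
        have h5 := abs_coord_le_norm x 2
        push_cast
        rw [one_add_one_eq_two, mul_comm (gegenbauerConst (j + 1))]
        gcongr
        linarith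
      | n + 2 =>
        rw [solidGegenbauer_succ_add_two, gegenbauerConst_succ]
        refine (abs_add_le _ _).trans ?_
        rw [abs_mul, abs_mul, abs_of_nonneg (by positivity : (0 : ℝ) ≤ ‖x‖ ^ 2),
          abs_of_nonneg (by positivity : (0 : ℝ) ≤ 2 * (n : ℝ) + 2 * j + 5)]
        have h1 := ih n (by omega)
        have h2 := ihj (n + 2)
        rw [gegenbauerConst_succ] at h1
        push_cast at h2 ⊢
        have h3 : ((n : ℝ) + 1) ^ (2 * (j + 1)) ≤ ((n : ℝ) + 3) ^ (2 * j) * ((n : ℝ) + 1) ^ 2 := by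
          rw [mul_add, pow_add, mul_one]
          gcongr
          linarith
        have e3 : (n : ℝ) + 2 + 1 = n + 3 := by ring
        rw [e3] at h2 ⊢
        -- The induction closes because 2n+2j+5 ≤ (2j+1)(4n+8) and (n+1)² + (4n+8) = (n+3)².
        calc ‖x‖ ^ 2 * |solidGegenbauer (j + 1) n x| +
              (2 * (n : ℝ) + 2 * j + 5) * |solidGegenbauer j (n + 2) x|
            ≤ ‖x‖ ^ 2 * ((2 * (j : ℝ) + 1) * gegenbauerConst j *
                (((n : ℝ) + 3) ^ (2 * j) * ((n : ℝ) + 1) ^ 2) * ‖x‖ ^ n) +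
              ((2 * (j : ℝ) + 1) * (4 * n + 8)) *
                (gegenbauerConst j * ((n : ℝ) + 3) ^ (2 * j) * ‖x‖ ^ (n + 2)) := by
              gcongr
              · exact h1.trans (by gcongr)
              · have : (0 : ℝ) ≤ (j : ℝ) * n := by positivity
                nlinarith [(Nat.cast_nonneg j : (0 : ℝ) ≤ j), (Nat.cast_nonneg n : (0 : ℝ) ≤ n)]
          _ = _ := by ring

/-! ### Derivatives -/

/-- A coordinate functional on three-space. -/
noncomputable abbrev coordCLM (i : Fin 3) : Space3 →L[ℝ] ℝ := EuclideanSpace.proj i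

theorem hasFDerivAt_coord (i : Fin 3) (x : Space3) :
    HasFDerivAt (fun y : Space3 => y i) (coordCLM i) x :=
  (coordCLM i).hasFDerivAt

theorem hasFDerivAt_norm_sq' (x : Space3) :
    HasFDerivAt (fun y : Space3 => ‖y‖ ^ 2) ((2 : ℝ) • innerSL ℝ x) x := by
  exact (hasStrictFDerivAt_norm_sq x).hasFDerivAt.congr_fderiv (by ext; simp [two_mul])

theorem hasFDerivAt_solidGegenbauer_one (j : ℕ) (x : Space3) :
    HasFDerivAt (solidGegenbauer j 1) (solidGegenbauer (j + 1) 0 x • coordCLM 2) x := by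
  have h : solidGegenbauer j 1 = fun y => (2 * (j : ℝ) + 1) * gegenbauerConst j * y 2 :=
    funext (solidGegenbauer_one j)
  rw [h, solidGegenbauer_zero, gegenbauerConst_succ]
  exact (hasFDerivAt_coord 2 x).const_mul _

/-- The gradient of (1 - 2x₃t + |x|²t²)^{-(j+1/2)} is (2j+1)(t e₃ - t² x) times the same base to the
power -(j+3/2); this is its coefficient of t^{n+2}. Differentiation thus stays within the family,
raising j by one. -/
theorem hasFDerivAt_solidGegenbauer_add_two (j n : ℕ) (x : Space3) :
    HasFDerivAt (solidGegenbauer j (n + 2))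
      (solidGegenbauer (j + 1) (n + 1) x • coordCLM 2 -
        solidGegenbauer (j + 1) n x • innerSL ℝ x) x := by
  have step : ∀ (n : ℕ) (D0 D1 : Space3 →L[ℝ] ℝ), HasFDerivAt (solidGegenbauer j n) D0 x →
      HasFDerivAt (solidGegenbauer j (n + 1)) D1 x →
      HasFDerivAt (solidGegenbauer j (n + 2)) (((n : ℝ) + 2)⁻¹ •
        ((2 * (n : ℝ) + 2 * j + 3) • (x 2 • D1 + solidGegenbauer j (n + 1) x • coordCLM 2) -
        ((n : ℝ) + 2 * j + 1) • (‖x‖ ^ 2 • D0 +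
          solidGegenbauer j n x • ((2 : ℝ) • innerSL ℝ x)))) x := by
    intro n D0 D1 h0 h1
    have e : solidGegenbauer j (n + 2) = fun y => ((n : ℝ) + 2)⁻¹ *
        ((2 * (n : ℝ) + 2 * j + 3) * (y 2 * solidGegenbauer j (n + 1) y) -
        ((n : ℝ) + 2 * j + 1) * (‖y‖ ^ 2 * solidGegenbauer j n y)) := by
      funext y
      rw [← solidGegenbauer_add_two, inv_mul_cancel_left₀ (by positivity)]
    rw [e]
    exact (((((hasFDerivAt_coord 2 x).mul h1).const_mul _).sub
      (((hasFDerivAt_norm_sq' x).mul h0).const_mul _)).const_mul _)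
  have h0 : HasFDerivAt (solidGegenbauer j 0) (0 : Space3 →L[ℝ] ℝ) x := by
    have h : solidGegenbauer j 0 = fun _ => gegenbauerConst j := funext (solidGegenbauer_zero j)
    rw [h]
    exact hasFDerivAt_const _ _
  induction n using Nat.strong_induction_on with
  | _ n ih =>
    match n with
    | 0 =>
      refine (step 0 _ _ h0 (hasFDerivAt_solidGegenbauer_one j x)).congr_fderiv ?_
      ext h
      have r1 := (solidGegenbauer_ladder j 0 x).1
      simp only [solidGegenbauer_one, solidGegenbauer_zero, gegenbauerConst_succ, zero_add] at r1 ⊢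
      simp
      ring
    | 1 =>
      refine (step 1 _ _ (hasFDerivAt_solidGegenbauer_one j x) (ih 0 (by omega))).congr_fderiv ?_
      ext h
      have r1 := (solidGegenbauer_ladder j 0 x).1
      have r2 := (solidGegenbauer_ladder j 0 x).2
      have r3 := (solidGegenbauer_ladder j 1 x).1
      simp only [_root_.smul_apply, _root_.sub_apply,
        _root_.add_apply, smul_eq_mul]
      push_cast at r1 r2 r3 ⊢
      simp only [zero_add] at r1 r2 r3 ⊢
      rw [inv_mul_eq_iff_eq_mul₀ (by norm_num)]
      have r4 := solidGegenbauer_one (j + 1) x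
      rw [← solidGegenbauer_zero (j + 1) x] at r4
      push_cast at r4
      linear_combination coordCLM 2 h * (-3 * r3 - (2 * j + 2) * r2) +
        innerSL ℝ x h * (2 * r1 + r4)
    | n + 2 =>
      refine (step (n + 2) _ _ (ih n (by omega)) (ih (n + 1) (by omega))).congr_fderiv ?_
      ext h
      have r1 := (solidGegenbauer_ladder j (n + 1) x).1
      have r2 := (solidGegenbauer_ladder j (n + 1) x).2
      have r3 := (solidGegenbauer_ladder j (n + 2) x).1
      have r4 := solidGegenbauer_add_two (j + 1) n x
      simp only [_root_.smul_apply, _root_.sub_apply,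
        _root_.add_apply, smul_eq_mul]
      push_cast at r1 r2 r3 r4 ⊢
      rw [inv_mul_eq_iff_eq_mul₀ (by positivity)]
      linear_combination coordCLM 2 h * (-(n + 4) * r3 - (n + 2 * j + 3) * r2) +
        innerSL ℝ x h * (2 * r1 + r4)


theorem hasFDerivAt_solidGegenbauer_zero (j : ℕ) (x : Space3) :
    HasFDerivAt (solidGegenbauer j 0) (0 : Space3 →L[ℝ] ℝ) x := by
  have h : solidGegenbauer j 0 = fun _ => gegenbauerConst j := funext (solidGegenbauer_zero j)
  rw [h]
  exact hasFDerivAt_const _ _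

/-! ### Series of solid zonal polynomials -/

/-- Sequences of at most polynomial growth. -/
def PolyGrowth (β : ℕ → ℝ) : Prop := ∃ (c : ℝ) (p : ℕ), ∀ n, |β n| ≤ c * ((n : ℝ) + 1) ^ p

theorem PolyGrowth.shift {β : ℕ → ℝ} (h : PolyGrowth β) (m : ℕ) :
    PolyGrowth fun n => β (n + m) := by
  obtain ⟨c, p, h⟩ := h
  have hc : 0 ≤ c := by simpa using (abs_nonneg _).trans (h 0)
  refine ⟨c * ((m : ℝ) + 1) ^ p, p, fun n => (h (n + m)).trans ?_⟩
  rw [mul_assoc, ← mul_pow]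
  have : (0 : ℝ) ≤ (n : ℝ) * m := by positivity
  gcongr
  push_cast
  nlinarith

theorem summable_succ_pow_mul_geometric {s : ℝ} (hs0 : 0 ≤ s) (hs : s < 1) (p : ℕ) :
    Summable fun n : ℕ => ((n : ℝ) + 1) ^ p * s ^ n := by
  have h0 : Summable fun n : ℕ => (n : ℝ) ^ p * s ^ n :=
    summable_pow_mul_geometric_of_norm_lt_one p (by rwa [Real.norm_of_nonneg hs0])
  have h1 := summable_geometric_of_lt_one hs0 hs
  refine Summable.of_nonneg_of_le (fun n => by positivity) (fun n => ?_)
    ((h0.add h1).mul_left (2 ^ p))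
  rw [← add_one_mul, ← mul_assoc]
  gcongr
  rcases Nat.eq_zero_or_pos n with rfl | hn
  · simp only [Nat.cast_zero, zero_add, one_pow]
    have : (1 : ℝ) ≤ 2 ^ p := one_le_pow₀ (by norm_num)
    have h3 : (0 : ℝ) ≤ 0 ^ p := by positivity
    nlinarith
  · have : (1 : ℝ) ≤ n := by exact_mod_cast hn
    calc ((n : ℝ) + 1) ^ p ≤ (2 * n) ^ p := by gcongr; linarith
      _ = 2 ^ p * (n : ℝ) ^ p := mul_pow _ _ _
      _ ≤ _ := by gcongr; linarith

theorem PolyGrowth.summable {β : ℕ → ℝ} (h : PolyGrowth β) (q : ℕ) {s : ℝ} (hs0 : 0 ≤ s)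
    (hs : s < 1) : Summable fun n => |β n| * (((n : ℝ) + 1) ^ q * s ^ n) := by
  obtain ⟨c, p, h⟩ := h
  refine Summable.of_nonneg_of_le (fun n => by positivity) (fun n => ?_)
    ((summable_succ_pow_mul_geometric hs0 hs (p + q)).mul_left c)
  rw [pow_add, mul_assoc, ← mul_assoc c]
  gcongr
  exact h n

/-- The series `∑ β_n |x|^n P_{n+j}^{(j)}(x₃/|x|)`. -/
noncomputable def solidSeries (j : ℕ) (β : ℕ → ℝ) (x : Space3) : ℝ :=
  ∑' n, β n * solidGegenbauer j n x

theorem abs_mul_solidGegenbauer_le (j : ℕ) (β : ℝ) (n : ℕ) {x : Space3} {s : ℝ} (hx : ‖x‖ ≤ s) :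
    |β * solidGegenbauer j n x| ≤
      gegenbauerConst j * (|β| * (((n : ℝ) + 1) ^ (2 * j) * s ^ n)) := by
  have := (gegenbauerConst_pos j).le
  rw [abs_mul]
  calc |β| * |solidGegenbauer j n x|
      ≤ |β| * (gegenbauerConst j * ((n : ℝ) + 1) ^ (2 * j) * s ^ n) := by
        gcongr
        exact (abs_solidGegenbauer_le j n x).trans (by gcongr)
    _ = _ := by ring

theorem summable_solidSeries (j : ℕ) {β : ℕ → ℝ} (h : PolyGrowth β) {x : Space3} (hx : ‖x‖ < 1) :
    Summable fun n => β n * solidGegenbauer j n x :=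
  Summable.of_norm_bounded ((h.summable (2 * j) (norm_nonneg x) hx).mul_left _)
    fun n => abs_mul_solidGegenbauer_le j (β n) n le_rfl

theorem norm_coordCLM_le (i : Fin 3) : ‖coordCLM i‖ ≤ 1 :=
  ContinuousLinearMap.opNorm_le_bound _ zero_le_one fun y => by
    simpa using abs_coord_le_norm y i

/-- The derivative of the general term of the series `solidSeries j β`, with index shifted by two. -/
noncomputable def solidSeriesTermDeriv (j : ℕ) (β : ℕ → ℝ) (n : ℕ) (y : Space3) :
    Space3 →L[ℝ] ℝ :=
  (β (n + 2) * solidGegenbauer (j + 1) (n + 1) y) • coordCLM 2 -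
    (β (n + 2) * solidGegenbauer (j + 1) n y) • innerSL ℝ y

theorem norm_solidSeriesTermDeriv_le (j : ℕ) (β : ℕ → ℝ) (n : ℕ) {y : Space3} {s : ℝ}
    (hy : ‖y‖ ≤ s) (hs : s ≤ 1) :
    ‖solidSeriesTermDeriv j β n y‖ ≤ gegenbauerConst (j + 1) * (|β (n + 2)| *
        (((n + 1 : ℕ) + 1 : ℝ) ^ (2 * (j + 1)) * s ^ (n + 1))) +
        gegenbauerConst (j + 1) * (|β (n + 2)| * (((n : ℝ) + 1) ^ (2 * (j + 1)) * s ^ n)) := by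
  refine (norm_sub_le _ _).trans (add_le_add ?_ ?_)
  · rw [norm_smul]
    exact (mul_le_of_le_one_right (norm_nonneg _) (norm_coordCLM_le 2)).trans
      (abs_mul_solidGegenbauer_le (j + 1) _ (n + 1) hy)
  · rw [norm_smul, innerSL_apply_norm]
    exact (mul_le_of_le_one_right (norm_nonneg _) (hy.trans hs)).trans
      (abs_mul_solidGegenbauer_le (j + 1) _ n hy)

/-- Termwise differentiation on a ball of radius s with ‖x‖ < s < 1, where the derivative bounds are
uniform. Degrees 0 and 1 are split off because the two-term gradient formula starts at degree 2. -/
theorem hasFDerivAt_solidSeries_tail (j : ℕ) {β : ℕ → ℝ} (h : PolyGrowth β) {x : Space3}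
    (hx : ‖x‖ < 1) :
    HasFDerivAt (fun y => ∑' n, β (n + 2) * solidGegenbauer j (n + 2) y)
      (∑' n, solidSeriesTermDeriv j β n x) x := by
  obtain ⟨s, hxs, hs⟩ := exists_between hx
  have hs0 : 0 ≤ s := (norm_nonneg x).trans hxs.le
  have hu1 : Summable fun n => gegenbauerConst (j + 1) * (|β (n + 2)| *
      (((n + 1 : ℕ) + 1 : ℝ) ^ (2 * (j + 1)) * s ^ (n + 1))) :=
    ((summable_nat_add_iff (f := fun n => |β (n + 1)| *
      (((n : ℝ) + 1) ^ (2 * (j + 1)) * s ^ n)) 1).2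
      ((h.shift 1).summable (2 * (j + 1)) hs0 hs)).mul_left _
  have hu := hu1.add (((h.shift 2).summable (2 * (j + 1)) hs0 hs).mul_left (gegenbauerConst (j + 1)))
  have hxs' : x ∈ Metric.ball (0 : Space3) s := mem_ball_zero_iff.2 hxs
  refine hasFDerivAt_tsum_of_isPreconnected (f := fun n y => β (n + 2) *
    solidGegenbauer j (n + 2) y) (f' := solidSeriesTermDeriv j β) hu Metric.isOpen_ball
    (convex_ball (0 : Space3) s).isPreconnected ?_ ?_ hxs' ?_ hxs'
  · intro n y _
    refine ((hasFDerivAt_solidGegenbauer_add_two j n y).const_mul (β (n + 2))).congr_fderiv ?_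
    simp only [solidSeriesTermDeriv, smul_sub, smul_smul]
  · intro n y hy
    exact norm_solidSeriesTermDeriv_le j β n (mem_ball_zero_iff.1 hy).le hs.le
  · exact (summable_nat_add_iff (f := fun n => β n * solidGegenbauer j n x) 2).2
      (summable_solidSeries j h hx)

/-- The derivative involves series of the same type, with j raised and the coefficients only
shifted. This closure drives the smoothness induction. -/
theorem hasFDerivAt_solidSeries (j : ℕ) {β : ℕ → ℝ} (h : PolyGrowth β) {x : Space3}
    (hx : ‖x‖ < 1) :
    HasFDerivAt (solidSeries j β)
      (solidSeries (j + 1) (fun n => β (n + 1)) x • coordCLM 2 -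
        solidSeries (j + 1) (fun n => β (n + 2)) x • innerSL ℝ x) x := by
  have h0 := (hasFDerivAt_solidGegenbauer_zero j x).const_mul (β 0)
  have h1 := (hasFDerivAt_solidGegenbauer_one j x).const_mul (β 1)
  have hS1 := summable_solidSeries (j + 1) (h.shift 1) hx
  have hS2 := summable_solidSeries (j + 1) (h.shift 2) hx
  have hS3 : Summable fun n => β (n + 2) * solidGegenbauer (j + 1) (n + 1) x :=
    (summable_nat_add_iff (f := fun n => β (n + 1) * solidGegenbauer (j + 1) n x) 1).2 hS1
  refine (((h0.add h1).add (hasFDerivAt_solidSeries_tail j h hx)).congr_of_eventuallyEq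
    ?_).congr_fderiv ?_
  · filter_upwards [Metric.isOpen_ball.mem_nhds (mem_ball_zero_iff.2 hx)] with y hy
    rw [solidSeries, ← (summable_solidSeries j h (mem_ball_zero_iff.1 hy)).sum_add_tsum_nat_add 2]
    simp [Finset.sum_range_succ]
  · have e1 : ∑' n, solidSeriesTermDeriv j β n x =
        (∑' n, β (n + 2) * solidGegenbauer (j + 1) (n + 1) x) • coordCLM 2 -
          (∑' n, β (n + 2) * solidGegenbauer (j + 1) n x) • innerSL ℝ x := by
      rw [← hS3.tsum_smul_const, ← hS2.tsum_smul_const,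
        ← (hS3.smul_const _).tsum_sub (hS2.smul_const _)]
      rfl
    rw [e1, solidSeries, solidSeries, hS1.tsum_eq_zero_add, add_smul, smul_zero, zero_add,
      smul_smul, zero_add]
    abel

theorem contDiffOn_solidSeries (m : ℕ) (j : ℕ) {β : ℕ → ℝ} (h : PolyGrowth β) :
    ContDiffOn ℝ m (solidSeries j β) (Metric.ball 0 1) := by
  induction m generalizing j β with
  | zero =>
    refine contDiffOn_zero.2 fun x hx => ?_
    exact (hasFDerivAt_solidSeries j h (mem_ball_zero_iff.1 hx)).continuousAt.continuousWithinAt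
  | succ m ih =>
    push_cast
    rw [contDiffOn_succ_iff_fderiv_of_isOpen Metric.isOpen_ball]
    refine ⟨fun x hx => ((hasFDerivAt_solidSeries j h
      (mem_ball_zero_iff.1 hx)).differentiableAt).differentiableWithinAt, by simp, ?_⟩
    refine ContDiffOn.congr (f := fun x => solidSeries (j + 1) (fun n => β (n + 1)) x • coordCLM 2 -
        solidSeries (j + 1) (fun n => β (n + 2)) x • innerSL ℝ x) ?_
      fun x hx => (hasFDerivAt_solidSeries j h (mem_ball_zero_iff.1 hx)).fderiv
    exact ((ih (j + 1) (h.shift 1)).smul contDiffOn_const).sub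
      ((ih (j + 1) (h.shift 2)).smul (innerSL ℝ).contDiff.contDiffOn)

theorem solidSeries_generating (j : ℕ) {β : ℕ → ℝ} (h : PolyGrowth β) {x : Space3}
    (hx : ‖x‖ < 1) :
    solidSeries (j + 1) β x - 2 * x 2 * solidSeries (j + 1) (fun n => β (n + 1)) x +
      ‖x‖ ^ 2 * solidSeries (j + 1) (fun n => β (n + 2)) x =
        (2 * (j : ℝ) + 1) * solidSeries j β x := by
  have s0 := summable_solidSeries (j + 1) h hx
  have s1 := summable_solidSeries (j + 1) (h.shift 1) hx
  have s2 := summable_solidSeries (j + 1) (h.shift 2) hx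
  have s3 := summable_solidSeries j h hx
  have s0' := (summable_nat_add_iff 2).2 s0
  have s1' := (summable_nat_add_iff 1).2 s1
  have s3' := (summable_nat_add_iff 2).2 s3
  have key : ∑' n, β (n + 2) * solidGegenbauer (j + 1) (n + 2) x -
      2 * x 2 * ∑' n, β (n + 1 + 1) * solidGegenbauer (j + 1) (n + 1) x +
      ‖x‖ ^ 2 * ∑' n, β (n + 2) * solidGegenbauer (j + 1) n x =
      (2 * (j : ℝ) + 1) * ∑' n, β (n + 2) * solidGegenbauer j (n + 2) x := by
    rw [← tsum_mul_left, ← tsum_mul_left, ← tsum_mul_left,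
      ← s0'.tsum_sub (s1'.mul_left _), ← (s0'.sub (s1'.mul_left _)).tsum_add (s2.mul_left _)]
    refine tsum_congr fun n => ?_
    linear_combination β (n + 2) * solidGegenbauer_generating j n x
  -- The three series start at different shifts, so their low-degree terms are split off and cancel
  -- by the explicit values in degrees 0 and 1.
  unfold solidSeries
  rw [← s0.sum_add_tsum_nat_add 2, ← s3.sum_add_tsum_nat_add 2, s1.tsum_eq_zero_add]
  simp only [Finset.sum_range_succ, Finset.sum_range_zero, zero_add, solidGegenbauer_zero,
    solidGegenbauer_one, gegenbauerConst_succ]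
  push_cast
  linear_combination key

end SolidGegenbauer

/-! ### Harmonicity of the azimuthal series and its radial derivative. -/

section HarmonicExtension

/-- The standard basis vectors of three-space. -/
noncomputable abbrev stdVec (i : Fin 3) : Space3 := EuclideanSpace.single i 1

theorem laplacian_eq_sum_fderiv_fderiv (f : Space3 → ℝ) (x : Space3) :
    Laplacian.laplacian f x = ∑ i, fderiv ℝ (fderiv ℝ f) x (stdVec i) (stdVec i) := by
  rw [InnerProductSpace.laplacian_eq_iteratedFDeriv_orthonormalBasis f
    (EuclideanSpace.basisFun (Fin 3) ℝ)]
  simp [iteratedFDeriv_two_apply]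

theorem fderiv_fderiv_apply {f : Space3 → ℝ} {x : Space3} (hf : ContDiffAt ℝ 2 f x)
    (h k : Space3) :
    fderiv ℝ (fderiv ℝ f) x h k = fderiv ℝ (fun y => fderiv ℝ f y k) x h := by
  have h1 : DifferentiableAt ℝ (fderiv ℝ f) x :=
    (hf.fderiv_right (m := 1) (by norm_num)).differentiableAt (by norm_num)
  have := (h1.hasFDerivAt.clm_apply (hasFDerivAt_const k x)).fderiv
  rw [this]
  simp

/-- Write S for the series and ∇S = A e₃ - B x. Then ΔS = a - 2x₃b + |x|²c - 3B, which is 5B - 3B =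
2B by `solidSeries_generating` with j = 2. For a coordinate other than x₃, ∂_i S = -x_i B, so Δ(x_i
S) = x_i ΔS + 2 ∂_i S = 0. -/
theorem laplacian_coord_mul_solidSeries {β : ℕ → ℝ} (h : PolyGrowth β) {i : Fin 3} (hi : i ≠ 2)
    {x : Space3} (hx : ‖x‖ < 1) :
    Laplacian.laplacian (fun y : Space3 => y i * solidSeries 1 β y) x = 0 := by
  have hball : Metric.ball (0 : Space3) 1 ∈ 𝓝 x :=
    Metric.isOpen_ball.mem_nhds (mem_ball_zero_iff.2 hx)
  have hcd : ContDiffAt ℝ 2 (fun y : Space3 => y i * solidSeries 1 β y) x :=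
    (coordCLM i).contDiff.contDiffAt.mul ((contDiffOn_solidSeries 2 1 h).contDiffAt hball)
  set A := solidSeries 2 (fun n => β (n + 1)) with hA
  set B := solidSeries 2 (fun n => β (n + 2)) with hB
  have hD : ∀ k : Space3, (fun y => fderiv ℝ (fun y : Space3 => y i * solidSeries 1 β y) y k) =ᶠ[𝓝 x]
      fun y => y i * (A y * k 2 - B y * innerSL ℝ k y) + solidSeries 1 β y * k i := by
    intro k
    filter_upwards [hball] with y hy
    have hd : HasFDerivAt (fun y : Space3 => y i * solidSeries 1 β y) _ y :=
      (hasFDerivAt_coord i y).mul (hasFDerivAt_solidSeries 1 h (mem_ball_zero_iff.1 hy))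
    rw [hd.fderiv]
    simp [hA, hB, real_inner_comm]
  have hA' := hasFDerivAt_solidSeries 2 (h.shift 1) hx
  have hB' := hasFDerivAt_solidSeries 2 (h.shift 2) hx
  have hP' := hasFDerivAt_solidSeries 1 h hx
  set a := solidSeries 3 (fun n => β (n + 2)) x
  set b := solidSeries 3 (fun n => β (n + 1 + 2)) x
  set c := solidSeries 3 (fun n => β (n + 2 + 2)) x
  have hterm : ∀ k : Space3, fderiv ℝ (fderiv ℝ (fun y : Space3 => y i * solidSeries 1 β y)) x k k =
      x i * ((a * k 2 - b * inner ℝ x k) * k 2 - (B x * inner ℝ k k +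
        inner ℝ k x * (b * k 2 - c * inner ℝ x k))) + k i * (A x * k 2 - B x * inner ℝ k x) +
        k i * (A x * k 2 - B x * inner ℝ x k) := fun k => by
    rw [fderiv_fderiv_apply hcd, (hD k).fderiv_eq]
    have hd : HasFDerivAt (fun y : Space3 => y i * (A y * k 2 - B y * innerSL ℝ k y) +
        solidSeries 1 β y * k i) (x i • (k 2 • (a • coordCLM 2 - b • innerSL ℝ x) -
          (B x • innerSL ℝ k + innerSL ℝ k x • (b • coordCLM 2 - c • innerSL ℝ x))) +
          (A x * k 2 - B x * innerSL ℝ k x) • coordCLM i +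
          k i • (A x • coordCLM 2 - B x • innerSL ℝ x)) x :=
      ((hasFDerivAt_coord i x).mul ((hA'.mul_const (k 2)).sub
        (hB'.mul (innerSL ℝ k).hasFDerivAt))).add (hP'.mul_const (k i))
    rw [hd.fderiv]
    simp only [_root_.add_apply, _root_.sub_apply, _root_.smul_apply, smul_eq_mul,
      innerSL_apply_apply, PiLp.proj_apply]
    ring
  have hgen := solidSeries_generating 2 (h.shift 2) hx
  rw [EuclideanSpace.real_norm_sq_eq, Fin.sum_univ_three] at hgen
  change a - 2 * x 2 * b + _ * c = _ * B x at hgen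
  rw [laplacian_eq_sum_fderiv_fderiv]
  simp only [hterm, Fin.sum_univ_three, EuclideanSpace.inner_single_left,
    EuclideanSpace.inner_single_right]
  push_cast at hgen
  fin_cases i
  · simp
    linear_combination x 0 * hgen
  · simp
    linear_combination x 1 * hgen
  · exact absurd rfl hi

theorem harmonicOnNhd_coord_mul_solidSeries {β : ℕ → ℝ} (h : PolyGrowth β) {i : Fin 3}
    (hi : i ≠ 2) :
    InnerProductSpace.HarmonicOnNhd (fun y : Space3 => y i * solidSeries 1 β y)
      (Metric.ball 0 1) := by
  intro x hx
  have hball : Metric.ball (0 : Space3) 1 ∈ 𝓝 x := Metric.isOpen_ball.mem_nhds hx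
  refine ⟨(coordCLM i).contDiff.contDiffAt.mul ((contDiffOn_solidSeries 2 1 h).contDiffAt hball),
    ?_⟩
  filter_upwards [hball] with y hy
  exact laplacian_coord_mul_solidSeries h hi (mem_ball_zero_iff.1 hy)

theorem harmonicOnNhd_solidSeries_smul_sinAzimuth {β : ℕ → ℝ} (h : PolyGrowth β) :
    InnerProductSpace.HarmonicOnNhd (fun y : Space3 => solidSeries 1 β y • sinAzimuth y)
      (Metric.ball 0 1) := by
  have h0 := (harmonicOnNhd_coord_mul_solidSeries h (i := 0) (by decide)).comp_CLM
    (ContinuousLinearMap.toSpanSingleton ℝ (stdVec 1))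
  have h1 := (harmonicOnNhd_coord_mul_solidSeries h (i := 1) (by decide)).comp_CLM
    (ContinuousLinearMap.toSpanSingleton ℝ (stdVec 0))
  have e : (fun y : Space3 => solidSeries 1 β y • sinAzimuth y) =
      (ContinuousLinearMap.toSpanSingleton ℝ (stdVec 1) ∘ fun y => y 0 * solidSeries 1 β y) -
        (ContinuousLinearMap.toSpanSingleton ℝ (stdVec 0) ∘ fun y => y 1 * solidSeries 1 β y) := by
    funext y
    ext i
    fin_cases i <;> simp [sinAzimuth] <;> ring
  rw [e]
  exact h0.sub h1

theorem solidSeries_smul (j : ℕ) (β : ℕ → ℝ) (s : ℝ) (x : Space3) :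
    solidSeries j β (s • x) = ∑' n, β n * (s ^ n * solidGegenbauer j n x) := by
  simp only [solidSeries, solidGegenbauer_smul]

theorem sinAzimuth_smul (s : ℝ) (x : Space3) : sinAzimuth (s • x) = s • sinAzimuth x := by
  ext i
  fin_cases i <;> simp [sinAzimuth]

theorem mul_solidSeries_smul (β : ℕ → ℝ) (s : ℝ) (x : Space3) :
    s * solidSeries 1 β (s • x) = ∑' n, β n * (s ^ (n + 1) * solidGegenbauer 1 n x) := by
  rw [solidSeries_smul, ← tsum_mul_left]
  exact tsum_congr fun n => by ring

/-- The extra factor r comes from the linear field `sinAzimuth`. It raises the radial degree of the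
n-th term to n+1, and this exponent becomes the eigenvalue of Λ. -/
theorem hasDerivAt_mul_solidSeries_smul {β : ℕ → ℝ} (h : PolyGrowth β) {s : ℝ} (hs0 : 0 ≤ s)
    (hs : s < 1) {x : Space3} (hx : ‖x‖ = 1) :
    HasDerivAt (fun r : ℝ => r * solidSeries 1 β (r • x))
      (∑' n : ℕ, ((n : ℝ) + 1) * β n * (s ^ n * solidGegenbauer 1 n x)) s := by
  obtain ⟨t, hst, ht⟩ := exists_between hs
  have ht0 : 0 ≤ t := hs0.trans hst.le
  simp only [mul_solidSeries_smul]
  have hu : Summable fun n : ℕ => gegenbauerConst 1 * (|β n| * (((n : ℝ) + 1) ^ 3 * t ^ n)) :=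
    (h.summable 3 ht0 ht).mul_left _
  have hst' : s ∈ Set.Ioo (-t) t := ⟨by linarith [ht0, hs0], hst⟩
  have hb : ∀ n, |solidGegenbauer 1 n x| ≤ gegenbauerConst 1 * ((n : ℝ) + 1) ^ 2 := fun n => by
    simpa [hx] using abs_solidGegenbauer_le 1 n x
  have hκ := (gegenbauerConst_pos 1).le
  refine hasDerivAt_tsum_of_isPreconnected
    (g := fun (n : ℕ) (r : ℝ) => β n * (r ^ (n + 1) * solidGegenbauer 1 n x))
    (g' := fun (n : ℕ) (r : ℝ) => ((n : ℝ) + 1) * β n * (r ^ n * solidGegenbauer 1 n x))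
    hu isOpen_Ioo isPreconnected_Ioo ?_ ?_ hst' ?_ hst'
  · intro n r _
    have := (((hasDerivAt_pow (n + 1) r).mul_const (solidGegenbauer 1 n x)).const_mul (β n))
    refine this.congr_deriv ?_
    push_cast
    ring
  · intro n r hr
    have hr' : |r| ≤ t := (abs_lt.2 hr).le
    rw [Real.norm_eq_abs, abs_mul, abs_mul, abs_mul, abs_pow,
      abs_of_nonneg (by positivity : (0 : ℝ) ≤ (n : ℝ) + 1)]
    calc ((n : ℝ) + 1) * |β n| * (|r| ^ n * |solidGegenbauer 1 n x|)
        ≤ ((n : ℝ) + 1) * |β n| * (t ^ n * (gegenbauerConst 1 * ((n : ℝ) + 1) ^ 2)) := by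
          gcongr
          exact hb n
      _ = _ := by ring
  · have hsx : ‖s • x‖ < 1 := by rwa [norm_smul, hx, mul_one, Real.norm_of_nonneg hs0]
    refine ((summable_solidSeries 1 h hsx).mul_left s).congr fun n => ?_
    rw [solidGegenbauer_smul]
    ring

end HarmonicExtension

/-! ### Rotation invariance and integration by parts on the sphere. -/

section SphereIntegration

open scoped Pointwise in
/-- The surface measure is invariant under linear isometries. -/
theorem measurePreserving_sphere (e : Space3 ≃ₗᵢ[ℝ] Space3) {φ : Sphere2 → Sphere2}
    (hφ : ∀ x, (φ x : Space3) = e x) :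
    MeasurePreserving φ sphereMeasure sphereMeasure := by
  have hφc : Continuous φ := by
    refine Continuous.subtype_mk (f := fun x => (φ x : Space3)) ?_ fun x => (φ x).2
    simp only [hφ]
    fun_prop
  refine ⟨hφc.measurable, Measure.ext fun s hs => ?_⟩
  rw [Measure.map_apply hφc.measurable hs, Measure.toSphere_apply' _ hs,
    Measure.toSphere_apply' _ (hφc.measurable hs)]
  congr 1
  -- The surface measure is a multiple of the volume of the cone over a set, and the cone over the
  -- preimage of `s` is the preimage under the isometry of the cone over `s`.
  have h1 : Set.Ioo (0 : ℝ) 1 • ((↑) '' (φ ⁻¹' s) : Set Space3) =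
      e ⁻¹' (Set.Ioo (0 : ℝ) 1 • ((↑) '' s : Set Space3)) := by
    ext y
    simp only [Set.mem_smul, Set.mem_preimage, Set.mem_image]
    constructor
    · rintro ⟨r, hr, _, ⟨x, hx, rfl⟩, rfl⟩
      exact ⟨r, hr, _, ⟨φ x, hx, rfl⟩, by rw [hφ, map_smul]⟩
    · rintro ⟨r, hr, _, ⟨x, hx, rfl⟩, h⟩
      have hx' : e.symm x ∈ Metric.sphere (0 : Space3) 1 := by simp
      refine ⟨r, hr, _, ⟨⟨e.symm x, hx'⟩, ?_, rfl⟩, ?_⟩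
      · have : φ ⟨e.symm x, hx'⟩ = x := Subtype.ext (by simp [hφ])
        simpa [this] using hx
      · apply e.injective
        rw [← h, map_smul, LinearIsometryEquiv.apply_symm_apply]
  rw [h1]
  exact e.measurePreserving.measure_preimage_equiv (f := e.toMeasurableEquiv) _

/-- Differentiation of an integral over a compact space depending on a real parameter. -/
theorem hasDerivAt_integral_of_compact {X : Type*} [TopologicalSpace X] [CompactSpace X]
    [MeasurableSpace X] [OpensMeasurableSpace X] {μ : Measure X} [IsFiniteMeasure μ]
    {F F' : ℝ → X → ℝ} {U : Set ℝ} (hU : IsOpen U) (hF : ∀ t ∈ U, Continuous (F t))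
    (hd : ∀ t ∈ U, ∀ x, HasDerivAt (F · x) (F' t x) t)
    (hc : ContinuousOn (Function.uncurry F') (U ×ˢ Set.univ)) {t : ℝ} (ht : t ∈ U) :
    HasDerivAt (fun t => ∫ x, F t x ∂μ) (∫ x, F' t x ∂μ) t := by
  obtain ⟨ε, hε, hεU⟩ := Metric.nhds_basis_closedBall.mem_iff.1 (hU.mem_nhds ht)
  obtain ⟨C, hC⟩ := ((isCompact_closedBall t ε).prod isCompact_univ).exists_bound_of_continuousOn
    (hc.mono (Set.prod_mono hεU Set.Subset.rfl))
  have hF't : Continuous (F' t) := by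
    rw [← continuousOn_univ]
    exact hc.comp (f := fun x : X => (t, x)) (by fun_prop) fun x _ => ⟨ht, trivial⟩
  refine (hasDerivAt_integral_of_dominated_loc_of_deriv_le (F := F) (F' := F') (bound := fun _ => C)
    (Metric.closedBall_mem_nhds t hε) ?_ ?_ hF't.aestronglyMeasurable ?_ (integrable_const C) ?_).2
  · filter_upwards [hU.mem_nhds ht] with s hs using (hF s hs).aestronglyMeasurable
  · exact (hF t ht).integrable_of_hasCompactSupport (HasCompactSupport.of_compactSpace _)
  · exact ae_of_all _ fun x s hs => hC (s, x) ⟨hs, trivial⟩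
  · exact ae_of_all _ fun x s hs => hd s (hεU hs) x

/-- The infinitesimal rotation in the `(x_i, x_j)`-plane. -/
noncomputable def rotGen (i j : Fin 3) : Space3 →L[ℝ] Space3 :=
  (coordCLM i).smulRight (stdVec j) - (coordCLM j).smulRight (stdVec i)

theorem rotGen_apply (i j : Fin 3) (x : Space3) :
    rotGen i j x = x i • stdVec j - x j • stdVec i := by
  simp [rotGen]

/-- The rotation by the angle `t` in the `(x_i, x_j)`-plane. -/
noncomputable def planeRot (i j : Fin 3) (t : ℝ) : Space3 →ₗ[ℝ] Space3 :=
  LinearMap.id + (Real.sin t) • (rotGen i j).toLinearMap +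
    (1 - Real.cos t) • ((rotGen i j).toLinearMap ∘ₗ (rotGen i j).toLinearMap)

theorem planeRot_apply (i j : Fin 3) (t : ℝ) (x : Space3) :
    planeRot i j t x =
      x + Real.sin t • rotGen i j x + (1 - Real.cos t) • rotGen i j (rotGen i j x) := by
  simp [planeRot]

theorem norm_planeRot {i j : Fin 3} (hij : i ≠ j) (t : ℝ) (x : Space3) :
    ‖planeRot i j t x‖ = ‖x‖ := by
  rw [← sq_eq_sq₀ (norm_nonneg _) (norm_nonneg _), planeRot_apply]
  simp only [EuclideanSpace.real_norm_sq_eq, Fin.sum_univ_three, rotGen_apply]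
  have h := Real.sin_sq_add_cos_sq t
  fin_cases i <;> fin_cases j <;> simp at hij ⊢
  · linear_combination (x 0 ^ 2 + x 1 ^ 2) * h
  · linear_combination (x 0 ^ 2 + x 2 ^ 2) * h
  · linear_combination (x 0 ^ 2 + x 1 ^ 2) * h
  · linear_combination (x 1 ^ 2 + x 2 ^ 2) * h
  · linear_combination (x 0 ^ 2 + x 2 ^ 2) * h
  · linear_combination (x 1 ^ 2 + x 2 ^ 2) * h

/-- The relation J³ = -J makes I + sin t · J + (1 - cos t) J² equal to exp(tJ), the flow of the
generator. -/
theorem rotGen_rotGen_rotGen {i j : Fin 3} (hij : i ≠ j) (x : Space3) :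
    rotGen i j (rotGen i j (rotGen i j x)) = -rotGen i j x := by
  simp only [rotGen_apply]
  simp [hij, hij.symm]
  abel

theorem hasDerivAt_planeRot {i j : Fin 3} (hij : i ≠ j) (x : Space3) (t : ℝ) :
    HasDerivAt (fun t => planeRot i j t x) (rotGen i j (planeRot i j t x)) t := by
  simp only [planeRot_apply]
  have h := (((hasDerivAt_const t x).add ((Real.hasDerivAt_sin t).smul_const (rotGen i j x))).add
    (((hasDerivAt_const t (1 : ℝ)).sub (Real.hasDerivAt_cos t)).smul_const
      (rotGen i j (rotGen i j x))))
  refine h.congr_deriv ?_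
  simp only [map_add, map_smul, rotGen_rotGen_rotGen hij]
  module

/-- The derivative along an infinitesimal rotation. -/
noncomputable def rotDeriv (i j : Fin 3) (h : Space3 → ℝ) (x : Space3) : ℝ :=
  fderiv ℝ h x (rotGen i j x)

theorem contDiffAt_rotDeriv (i j : Fin 3) {n : WithTop ℕ∞} {h : Space3 → ℝ} {x : Space3}
    (hh : ContDiffAt ℝ (n + 1) h x) : ContDiffAt ℝ n (rotDeriv i j h) x :=
  (hh.fderiv_right le_rfl).clm_apply (rotGen i j).contDiff.contDiffAt

/-- The rotations in a coordinate plane act on the sphere and preserve the surface measure. -/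
theorem exists_sphereRot {i j : Fin 3} (hij : i ≠ j) :
    ∃ φ : ℝ → Sphere2 → Sphere2, (∀ t x, (φ t x : Space3) = planeRot i j t x) ∧
      ∀ t, MeasurePreserving (φ t) sphereMeasure sphereMeasure := by
  let e : ℝ → Space3 ≃ₗᵢ[ℝ] Space3 := fun t =>
    (⟨planeRot i j t, norm_planeRot hij t⟩ : Space3 →ₗᵢ[ℝ] Space3).toLinearIsometryEquiv rfl
  exact ⟨fun t x => ⟨e t x, by simp⟩, fun t x => rfl,
    fun t => measurePreserving_sphere (e t) fun x => rfl⟩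

theorem continuous_comp_sphere {h : Space3 → ℝ} (hh : ∀ x : Sphere2, ContDiffAt ℝ 0 h x) :
    Continuous fun x : Sphere2 => h x :=
  continuous_iff_continuousAt.2 fun x => (hh x).continuousAt.comp continuousAt_subtype_val

theorem continuous_rotDeriv_sphere (i j : Fin 3) {h : Space3 → ℝ}
    (hh : ∀ x : Sphere2, ContDiffAt ℝ 1 h x) :
    Continuous fun x : Sphere2 => rotDeriv i j h x :=
  continuous_comp_sphere fun x => contDiffAt_rotDeriv i j (by simpa using hh x)

/-- The integral of h over the rotated sphere does not depend on the angle; its derivative at angle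
zero is the integral of the rotational derivative. -/
theorem integral_rotDeriv_eq_zero {i j : Fin 3} (hij : i ≠ j) {h : Space3 → ℝ}
    (hh : ∀ x : Sphere2, ContDiffAt ℝ 1 h x) :
    ∫ x : Sphere2, rotDeriv i j h x ∂sphereMeasure = 0 := by
  obtain ⟨φ, hφ, hmp⟩ := exists_sphereRot hij
  have hφc : Continuous fun p : ℝ × Sphere2 => φ p.1 p.2 := by
    refine continuous_induced_rng.2 ?_
    simp only [Function.comp_def, hφ, planeRot_apply]
    fun_prop
  have hφt : ∀ t, Continuous (φ t) := fun t => hφc.comp (Continuous.prodMk_right t)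
  have hc0 : Continuous fun x : Sphere2 => h x :=
    continuous_comp_sphere fun x => (hh x).of_le zero_le_one
  have hc1 := continuous_rotDeriv_sphere i j hh
  have hconst : ∀ t, ∫ x, h (φ t x) ∂sphereMeasure = ∫ x : Sphere2, h x ∂sphereMeasure := by
    intro t
    have hs : AEStronglyMeasurable (fun x : Sphere2 => h x) (Measure.map (φ t) sphereMeasure) :=
      hc0.aestronglyMeasurable
    rw [← integral_map (hmp t).measurable.aemeasurable hs, (hmp t).map_eq]
  have hd : ∀ t ∈ Set.univ, ∀ x : Sphere2,
      HasDerivAt (fun t => h (φ t x)) (rotDeriv i j h (φ t x)) t := by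
    intro t _ x
    have h1 := ((hh (φ t x)).differentiableAt one_ne_zero).hasFDerivAt
    have h2 := hasDerivAt_planeRot hij (x : Space3) t
    simp only [← hφ] at h2
    exact h1.comp_hasDerivAt t h2
  have hder := hasDerivAt_integral_of_compact (μ := sphereMeasure) (U := Set.univ)
    (F := fun t x => h (φ t x)) (F' := fun t x => rotDeriv i j h (φ t x)) isOpen_univ
    (fun t _ => hc0.comp (hφt t)) hd (hc1.comp hφc).continuousOn (Set.mem_univ 0)
  have h0 : φ 0 = id := funext fun x => Subtype.ext (by rw [hφ, planeRot_apply]; simp)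
  simp only [hconst, h0, id] at hder
  exact hder.unique (hasDerivAt_const _ _)

theorem rotDeriv_mul (i j : Fin 3) {f g : Space3 → ℝ} {x : Space3} (hf : DifferentiableAt ℝ f x)
    (hg : DifferentiableAt ℝ g x) :
    rotDeriv i j (fun y => f y * g y) x = f x * rotDeriv i j g x + rotDeriv i j f x * g x := by
  have h : HasFDerivAt (fun y => f y * g y) _ x := hf.hasFDerivAt.mul hg.hasFDerivAt
  rw [rotDeriv, h.fderiv]
  simp [rotDeriv]
  ring

/-- Integration by parts on the sphere. -/
theorem integral_mul_rotDeriv {i j : Fin 3} (hij : i ≠ j) {f g : Space3 → ℝ}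
    (hf : ∀ x : Sphere2, ContDiffAt ℝ 1 f x) (hg : ∀ x : Sphere2, ContDiffAt ℝ 1 g x) :
    ∫ x : Sphere2, f x * rotDeriv i j g x ∂sphereMeasure =
      -∫ x : Sphere2, rotDeriv i j f x * g x ∂sphereMeasure := by
  have hc : ∀ {f g : Space3 → ℝ}, (∀ x : Sphere2, ContDiffAt ℝ 1 f x) →
      (∀ x : Sphere2, ContDiffAt ℝ 1 g x) →
      Integrable (fun x : Sphere2 => f x * rotDeriv i j g x) sphereMeasure := by
    intro f g hf hg
    refine Continuous.integrable_of_hasCompactSupport (continuous_iff_continuousAt.2 fun x => ?_)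
      (HasCompactSupport.of_compactSpace _)
    exact ((hf x).continuousAt.comp continuousAt_subtype_val).mul
      ((contDiffAt_rotDeriv i j (n := 0) (by simpa using hg x)).continuousAt.comp
        continuousAt_subtype_val)
  have h := integral_rotDeriv_eq_zero hij (h := fun y => f y * g y) fun x => (hf x).mul (hg x)
  simp only [rotDeriv_mul i j ((hf _).differentiableAt one_ne_zero)
    ((hg _).differentiableAt one_ne_zero)] at h
  rw [integral_add (hc hf hg) ((hc hg hf).congr (ae_of_all _ fun x => mul_comm _ _))] at h
  exact eq_neg_of_add_eq_zero_left h

theorem rotDeriv_rotDeriv (i j : Fin 3) {f : Space3 → ℝ} {x : Space3} (hf : ContDiffAt ℝ 2 f x) :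
    rotDeriv i j (rotDeriv i j f) x =
      fderiv ℝ (fderiv ℝ f) x (rotGen i j x) (rotGen i j x) +
        fderiv ℝ f x (rotGen i j (rotGen i j x)) := by
  have h1 : DifferentiableAt ℝ (fderiv ℝ f) x :=
    (hf.fderiv_right (m := 1) (by norm_num)).differentiableAt (by norm_num)
  have h : HasFDerivAt (rotDeriv i j f) _ x := h1.hasFDerivAt.clm_apply (rotGen i j).hasFDerivAt
  rw [rotDeriv, h.fderiv]
  simp
  ring

/-- The angular part of the Laplacian. -/
noncomputable def angularLaplacian (f : Space3 → ℝ) (x : Space3) : ℝ :=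
  rotDeriv 1 2 (rotDeriv 1 2 f) x + rotDeriv 2 0 (rotDeriv 2 0 f) x + rotDeriv 0 1 (rotDeriv 0 1 f) x

/-- This is r²Δ = r²∂_r² + 2r∂_r + (angular part), with D²f(x,x) = r²∂_r²f and Df(x) = r∂_r f. It
links integration by parts over rotations with the Euclidean Laplacian. -/
theorem angularLaplacian_eq {f : Space3 → ℝ} {x : Space3} (hf : ContDiffAt ℝ 2 f x) :
    angularLaplacian f x = ‖x‖ ^ 2 * Laplacian.laplacian f x -
      fderiv ℝ (fderiv ℝ f) x x x - 2 * fderiv ℝ f x x := by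
  have hx : x = x 0 • stdVec 0 + x 1 • stdVec 1 + x 2 • stdVec 2 := by
    ext i
    fin_cases i <;> simp
  have e2 : fderiv ℝ (fderiv ℝ f) x x x = fderiv ℝ (fderiv ℝ f) x
      (x 0 • stdVec 0 + x 1 • stdVec 1 + x 2 • stdVec 2)
      (x 0 • stdVec 0 + x 1 • stdVec 1 + x 2 • stdVec 2) := by rw [← hx]
  have e1 : fderiv ℝ f x x = fderiv ℝ f x
      (x 0 • stdVec 0 + x 1 • stdVec 1 + x 2 • stdVec 2) := by rw [← hx]
  rw [e2, e1, angularLaplacian, rotDeriv_rotDeriv 1 2 hf, rotDeriv_rotDeriv 2 0 hf,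
    rotDeriv_rotDeriv 0 1 hf, laplacian_eq_sum_fderiv_fderiv, EuclideanSpace.real_norm_sq_eq]
  simp only [Fin.sum_univ_three, rotGen_apply, map_add, map_sub, map_smul, _root_.add_apply,
    _root_.sub_apply, _root_.smul_apply, smul_eq_mul]
  simp
  ring

/-! ### Zonal polynomials -/

open Polynomial

theorem contDiff_zonalPoly (q : ℝ[X]) {n : WithTop ℕ∞} : ContDiff ℝ n fun y : Space3 => q.eval (y 2) :=
  ContDiff.comp (g := fun t : ℝ => q.eval t) (by simpa using q.contDiff_aeval (𝕜 := ℝ) n)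
    (coordCLM 2).contDiff

theorem hasFDerivAt_zonalPoly (q : ℝ[X]) (x : Space3) :
    HasFDerivAt (fun y : Space3 => q.eval (y 2)) ((derivative q).eval (x 2) • coordCLM 2) x :=
  HasDerivAt.comp_hasFDerivAt (h₂ := fun t : ℝ => q.eval t) (f := fun y : Space3 => y 2) x
    (q.hasDerivAt (x 2)) (hasFDerivAt_coord 2 x)

theorem rotDeriv_coord_mul_zonalPoly (i j k : Fin 3) (q : ℝ[X]) (x : Space3) :
    rotDeriv i j (fun y => y k * q.eval (y 2)) x =
      x k * ((derivative q).eval (x 2) * rotGen i j x 2) + q.eval (x 2) * rotGen i j x k := by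
  have h : HasFDerivAt (fun y : Space3 => y k * q.eval (y 2)) _ x :=
    (hasFDerivAt_coord k x).mul (hasFDerivAt_zonalPoly q x)
  rw [rotDeriv, h.fderiv]
  simp

theorem rotDeriv_zonalPoly (i j : Fin 3) (q : ℝ[X]) (x : Space3) :
    rotDeriv i j (fun y => q.eval (y 2)) x = (derivative q).eval (x 2) * rotGen i j x 2 := by
  rw [rotDeriv, (hasFDerivAt_zonalPoly q x).fderiv]
  simp

theorem sphere_sq_add (x : Sphere2) :
    (x : Space3) 0 ^ 2 + (x : Space3) 1 ^ 2 + (x : Space3) 2 ^ 2 = 1 := by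
  have h := EuclideanSpace.real_norm_sq_eq (x : Space3)
  rw [norm_eq_of_mem_sphere, Fin.sum_univ_three] at h
  linarith

theorem integrable_of_continuous_sphere {f : Sphere2 → ℝ} (hf : Continuous f) :
    Integrable f sphereMeasure :=
  hf.integrable_of_hasCompactSupport (HasCompactSupport.of_compactSpace _)

theorem continuous_zonalPoly (q : ℝ[X]) : Continuous fun x : Sphere2 => q.eval ((x : Space3) 2) :=
  (contDiff_zonalPoly q (n := 0)).continuous.comp continuous_subtype_val

/-- On the sphere, the rotational derivative of x₂ q(x₃) in the (x₂,x₃)-plane minus that of x₁ q(x₃)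
in the (x₃,x₁)-plane equals (x₁²+x₂²) q' - 2x₃ q = ((1-t²)q)'. This gives integration by parts in t
= cos θ without introducing spherical coordinates. -/
theorem integral_derivative_one_sub_sq_mul (q : ℝ[X]) :
    ∫ x : Sphere2, (derivative ((1 - X ^ 2) * q)).eval ((x : Space3) 2) ∂sphereMeasure = 0 := by
  have hcd : ∀ (k : Fin 3) (x : Sphere2),
      ContDiffAt ℝ 1 (fun y : Space3 => y k * q.eval (y 2)) x := fun k x =>
    (coordCLM k).contDiff.contDiffAt.mul (contDiff_zonalPoly q).contDiffAt
  have h1 := integral_rotDeriv_eq_zero (i := 1) (j := 2) (by decide) (hcd 1)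
  have h0 := integral_rotDeriv_eq_zero (i := 2) (j := 0) (by decide) (hcd 0)
  simp only [rotDeriv_coord_mul_zonalPoly] at h0 h1
  rw [← sub_eq_zero.2 (h1.trans h0.symm), ← integral_sub]
  · refine integral_congr_ae (ae_of_all _ fun x => ?_)
    have hx := sphere_sq_add x
    simp [rotGen_apply]
    linear_combination -(derivative q).eval ((x : Space3) 2) * hx
  · have := continuous_zonalPoly q
    have := continuous_zonalPoly (derivative q)
    exact integrable_of_continuous_sphere (by fun_prop)
  · have := continuous_zonalPoly q
    have := continuous_zonalPoly (derivative q)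
    exact integrable_of_continuous_sphere (by fun_prop)

end SphereIntegration

/-! ### Uniqueness of the Dirichlet-to-Neumann map by an energy argument. -/

section DirichletToNeumannUniqueness

theorem rotDeriv_comp_smul (i j : Fin 3) (f : Space3 → ℝ) (s : ℝ) :
    rotDeriv i j (fun x => f (s • x)) = fun x => rotDeriv i j f (s • x) := by
  funext x
  rw [rotDeriv, fderiv_comp_smul]
  simp [rotDeriv]

theorem smul_mem_ball {s : ℝ} (hs : s ∈ Set.Ioo (-1 : ℝ) 1) (x : Sphere2) :
    s • (x : Space3) ∈ Metric.ball (0 : Space3) 1 := by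
  rw [mem_ball_zero_iff, norm_smul, norm_eq_of_mem_sphere, mul_one]
  exact abs_lt.2 hs

theorem hasDerivAt_comp_radial {E : Type*} [NormedAddCommGroup E] [NormedSpace ℝ E]
    {f : Space3 → E} {s : ℝ} {x : Space3} (hf : DifferentiableAt ℝ f (s • x)) :
    HasDerivAt (fun r : ℝ => f (r • x)) (fderiv ℝ f (s • x) x) s := by
  have h2 : HasDerivAt (fun r : ℝ => r • x) x s := by
    simpa using (hasDerivAt_id s).smul_const x
  exact hf.hasFDerivAt.comp_hasDerivAt s h2

/-- Each squared rotational derivative contributes minus the integral of a square. -/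
theorem integral_mul_angularLaplacian_nonpos {f : Space3 → ℝ}
    (hf : ∀ x : Sphere2, ContDiffAt ℝ 2 f x) :
    ∫ x : Sphere2, f x * angularLaplacian f x ∂sphereMeasure ≤ 0 := by
  have h1 : ∀ x : Sphere2, ContDiffAt ℝ 1 f x := fun x => (hf x).of_le (by norm_num)
  have key : ∀ i j : Fin 3, i ≠ j →
      Integrable (fun x : Sphere2 => f x * rotDeriv i j (rotDeriv i j f) x) sphereMeasure ∧
      ∫ x : Sphere2, f x * rotDeriv i j (rotDeriv i j f) x ∂sphereMeasure ≤ 0 := by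
    intro i j hij
    have h2 : ∀ x : Sphere2, ContDiffAt ℝ 1 (rotDeriv i j f) x := fun x =>
      contDiffAt_rotDeriv i j (by norm_num; exact hf x)
    refine ⟨integrable_of_continuous_sphere ((continuous_comp_sphere fun x =>
      (h1 x).of_le zero_le_one).mul (continuous_rotDeriv_sphere i j h2)), ?_⟩
    rw [integral_mul_rotDeriv hij h1 h2, neg_nonpos]
    exact integral_nonneg fun x => mul_self_nonneg _
  have e : ∀ x : Sphere2, f x * angularLaplacian f x =
      f x * rotDeriv 1 2 (rotDeriv 1 2 f) x + f x * rotDeriv 2 0 (rotDeriv 2 0 f) x +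
        f x * rotDeriv 0 1 (rotDeriv 0 1 f) x := fun x => by
    rw [angularLaplacian]; ring
  obtain ⟨i1, k1⟩ := key 1 2 (by decide)
  obtain ⟨i2, k2⟩ := key 2 0 (by decide)
  obtain ⟨i3, k3⟩ := key 0 1 (by decide)
  simp only [e]
  have i12 : Integrable (fun x : Sphere2 => f x * rotDeriv 1 2 (rotDeriv 1 2 f) x +
      f x * rotDeriv 2 0 (rotDeriv 2 0 f) x) sphereMeasure := i1.add i2
  rw [integral_add i12 i3, integral_add i1 i2]
  linarith

theorem angularLaplacian_comp_smul (f : Space3 → ℝ) (s : ℝ) (x : Space3) :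
    angularLaplacian (fun y => f (s • y)) x = angularLaplacian f (s • x) := by
  simp only [angularLaplacian, rotDeriv_comp_smul]

theorem hasDerivAt_integral_sq_radial {f : Space3 → ℝ} (hf : ContDiffOn ℝ 2 f (Metric.ball 0 1)) {s : ℝ}
    (hs : s ∈ Set.Ioo (-1 : ℝ) 1) :
    HasDerivAt (fun s : ℝ => ∫ x : Sphere2, f (s • (x : Space3)) ^ 2 ∂sphereMeasure)
      (∫ x : Sphere2, 2 * (f (s • (x : Space3)) * fderiv ℝ f (s • (x : Space3)) x)
        ∂sphereMeasure) s := by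
  have hD : ContinuousOn (fderiv ℝ f) (Metric.ball 0 1) :=
    hf.continuousOn_fderiv_of_isOpen Metric.isOpen_ball (by norm_num)
  have hsm : ContinuousOn (fun p : ℝ × Sphere2 => p.1 • (p.2 : Space3))
    (Set.Ioo (-1 : ℝ) 1 ×ˢ Set.univ) := by fun_prop
  have hmaps : Set.MapsTo (fun p : ℝ × Sphere2 => p.1 • (p.2 : Space3))
    (Set.Ioo (-1 : ℝ) 1 ×ˢ Set.univ) (Metric.ball 0 1) := fun p hp => smul_mem_ball hp.1 p.2
  have hv : ContinuousOn (fun p : ℝ × Sphere2 => (p.2 : Space3))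
    (Set.Ioo (-1 : ℝ) 1 ×ˢ Set.univ) := by fun_prop
  refine hasDerivAt_integral_of_compact (U := Set.Ioo (-1 : ℝ) 1) (μ := sphereMeasure)
    (F := fun s (x : Sphere2) => f (s • (x : Space3)) ^ 2)
    (F' := fun s (x : Sphere2) => 2 * (f (s • (x : Space3)) * fderiv ℝ f (s • (x : Space3)) x))
    isOpen_Ioo ?_ ?_ ?_ hs
  · intro t ht
    exact (hf.continuousOn.comp_continuous (by fun_prop) (smul_mem_ball ht)).pow 2
  · intro t ht x
    have hd : DifferentiableAt ℝ f (t • (x : Space3)) :=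
      (hf.contDiffAt (Metric.isOpen_ball.mem_nhds (smul_mem_ball ht x))).differentiableAt
        (by norm_num)
    refine ((hasDerivAt_comp_radial hd).pow 2).congr_deriv ?_
    simp
    ring
  · exact continuousOn_const.mul ((hf.continuousOn.comp hsm hmaps).mul
      ((hD.comp hsm hmaps).clm_apply hv))

theorem hasDerivAt_sq_mul_integral_radial {f : Space3 → ℝ} (hf : ContDiffOn ℝ 2 f (Metric.ball 0 1)) {s : ℝ}
    (hs : s ∈ Set.Ioo (-1 : ℝ) 1) :
    HasDerivAt (fun s : ℝ => ∫ x : Sphere2,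
        s ^ 2 * (f (s • (x : Space3)) * fderiv ℝ f (s • (x : Space3)) x) ∂sphereMeasure)
      (∫ x : Sphere2, (2 * s * (f (s • (x : Space3)) * fderiv ℝ f (s • (x : Space3)) x) +
        s ^ 2 * (fderiv ℝ f (s • (x : Space3)) x * fderiv ℝ f (s • (x : Space3)) x +
          f (s • (x : Space3)) * fderiv ℝ (fderiv ℝ f) (s • (x : Space3)) x x))
        ∂sphereMeasure) s := by
  have hf1 : ContDiffOn ℝ 1 (fderiv ℝ f) (Metric.ball 0 1) :=
    hf.fderiv_of_isOpen Metric.isOpen_ball (by norm_num)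
  have hD : ContinuousOn (fderiv ℝ f) (Metric.ball 0 1) := hf1.continuousOn
  have hD2 : ContinuousOn (fderiv ℝ (fderiv ℝ f)) (Metric.ball 0 1) :=
    hf1.continuousOn_fderiv_of_isOpen Metric.isOpen_ball le_rfl
  have hsm : ContinuousOn (fun p : ℝ × Sphere2 => p.1 • (p.2 : Space3))
    (Set.Ioo (-1 : ℝ) 1 ×ˢ Set.univ) := by fun_prop
  have hmaps : Set.MapsTo (fun p : ℝ × Sphere2 => p.1 • (p.2 : Space3))
    (Set.Ioo (-1 : ℝ) 1 ×ˢ Set.univ) (Metric.ball 0 1) := fun p hp => smul_mem_ball hp.1 p.2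
  have hv : ContinuousOn (fun p : ℝ × Sphere2 => (p.2 : Space3))
    (Set.Ioo (-1 : ℝ) 1 ×ˢ Set.univ) := by fun_prop
  have hs1 : ContinuousOn (fun p : ℝ × Sphere2 => p.1) (Set.Ioo (-1 : ℝ) 1 ×ˢ Set.univ) := by
    fun_prop
  have c0 := hf.continuousOn.comp hsm hmaps
  have c1 := (hD.comp hsm hmaps).clm_apply hv
  have c2 := ((hD2.comp hsm hmaps).clm_apply hv).clm_apply hv
  refine hasDerivAt_integral_of_compact (U := Set.Ioo (-1 : ℝ) 1) (μ := sphereMeasure)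
    (F := fun s (x : Sphere2) => s ^ 2 * (f (s • (x : Space3)) * fderiv ℝ f (s • (x : Space3)) x))
    (F' := fun s (x : Sphere2) => 2 * s * (f (s • (x : Space3)) * fderiv ℝ f (s • (x : Space3)) x) +
        s ^ 2 * (fderiv ℝ f (s • (x : Space3)) x * fderiv ℝ f (s • (x : Space3)) x +
          f (s • (x : Space3)) * fderiv ℝ (fderiv ℝ f) (s • (x : Space3)) x x))
    isOpen_Ioo ?_ ?_ ?_ hs
  · intro t ht
    exact continuous_const.mul ((hf.continuousOn.comp_continuous (by fun_prop)
      (smul_mem_ball ht)).mul ((hD.comp_continuous (by fun_prop) (smul_mem_ball ht)).clm_apply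
        continuous_subtype_val))
  · intro t ht x
    have hx := Metric.isOpen_ball.mem_nhds (smul_mem_ball ht x)
    have hd : DifferentiableAt ℝ f (t • (x : Space3)) :=
      (hf.contDiffAt hx).differentiableAt (by norm_num)
    have hd1 : DifferentiableAt ℝ (fderiv ℝ f) (t • (x : Space3)) :=
      (hf1.contDiffAt hx).differentiableAt (by norm_num)
    have h2 := (hasDerivAt_comp_radial hd1).clm_apply (hasDerivAt_const t (x : Space3))
    refine ((hasDerivAt_pow 2 t).mul ((hasDerivAt_comp_radial hd).mul h2)).congr_deriv ?_
    simp
  · exact ((continuousOn_const.mul hs1).mul (c0.mul c1)).add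
      ((hs1.pow 2).mul ((c1.mul c1).add (c0.mul c2)))

/-- A harmonic function in the ball with vanishing boundary values, in the `L²` sense, has vanishing
radial derivative. -/
theorem integral_sq_fderiv_radial_eq_zero
    {f : Space3 → ℝ} (hf : InnerProductSpace.HarmonicOnNhd f (Metric.ball 0 1))
    (hlim : Tendsto (fun s : ℝ => ∫ x : Sphere2, f (s • (x : Space3)) ^ 2 ∂sphereMeasure)
      (𝓝[<] 1) (𝓝 0)) {s : ℝ} (hs : s ∈ Set.Ioo (0 : ℝ) 1) :
    ∫ x : Sphere2, fderiv ℝ f (s • (x : Space3)) x ^ 2 ∂sphereMeasure = 0 := by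
  have hcd := hf.contDiffOn
  have hsub : Set.Ioo (0 : ℝ) 1 ⊆ Set.Ioo (-1 : ℝ) 1 := Set.Ioo_subset_Ioo_left (by norm_num)
  have hD : ContinuousOn (fderiv ℝ f) (Metric.ball 0 1) :=
    hcd.continuousOn_fderiv_of_isOpen Metric.isOpen_ball (by norm_num)
  -- Here M' = 2K/s², and harmonicity gives K' = s²∫(∂_r f)² - ∫ f Δ_ang f ≥ s²∫(∂_r f)². Since K(0)
  -- = 0, K ≥ 0 and M is nondecreasing. As M ≥ 0 tends to 0 at s = 1, M vanishes on (0,1); hence so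
  -- do K and K', which leaves ∫(∂_r f)² = 0.
  set M : ℝ → ℝ := fun s => ∫ x : Sphere2, f (s • (x : Space3)) ^ 2 ∂sphereMeasure with hM
  set K : ℝ → ℝ := fun s => ∫ x : Sphere2,
    s ^ 2 * (f (s • (x : Space3)) * fderiv ℝ f (s • (x : Space3)) x) ∂sphereMeasure with hK
  have hMd : ∀ s ∈ Set.Ioo (0 : ℝ) 1, HasDerivAt M (2 * (s ^ 2)⁻¹ * K s) s := by
    intro s hs
    refine (hasDerivAt_integral_sq_radial hcd (hsub hs)).congr_deriv ?_
    simp only [hK]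
    rw [integral_const_mul, integral_const_mul]
    have : s ≠ 0 := hs.1.ne'
    field_simp
  have hKd : ∀ s ∈ Set.Ioo (-1 : ℝ) 1, ∃ K', HasDerivAt K K' s ∧
      s ^ 2 * ∫ x : Sphere2, fderiv ℝ f (s • (x : Space3)) x ^ 2 ∂sphereMeasure ≤ K' := by
    intro s hs
    refine ⟨_, hasDerivAt_sq_mul_integral_radial hcd hs, ?_⟩
    have hcds : ∀ x : Sphere2, ContDiffAt ℝ 2 f (s • (x : Space3)) := fun x =>
      hcd.contDiffAt (Metric.isOpen_ball.mem_nhds (smul_mem_ball hs x))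
    have hcds' : ∀ x : Sphere2, ContDiffAt ℝ 2 (fun y => f (s • y)) (x : Space3) := fun x =>
      (hcds x).comp (x : Space3) (contDiff_const_smul s).contDiffAt
    have hang := integral_mul_angularLaplacian_nonpos hcds'
    simp only [angularLaplacian_comp_smul] at hang
    -- At the point sx the radial terms of s²Δf combine with the two derivatives of s² f ∂_r f, so
    -- Δf = 0 trades them for the angular Laplacian.
    have hpt : ∀ x : Sphere2, 2 * s * (f (s • (x : Space3)) * fderiv ℝ f (s • (x : Space3)) x) +
        s ^ 2 * (fderiv ℝ f (s • (x : Space3)) x * fderiv ℝ f (s • (x : Space3)) x +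
          f (s • (x : Space3)) * fderiv ℝ (fderiv ℝ f) (s • (x : Space3)) x x) =
        s ^ 2 * fderiv ℝ f (s • (x : Space3)) x ^ 2 -
          f (s • (x : Space3)) * angularLaplacian f (s • (x : Space3)) := by
      intro x
      have h0 : Laplacian.laplacian f (s • (x : Space3)) = 0 :=
        (hf _ (smul_mem_ball hs x)).2.self_of_nhds
      rw [angularLaplacian_eq (hcds x), h0]
      simp only [map_smul, _root_.smul_apply, smul_eq_mul]
      ring
    have hc1 : Continuous fun x : Sphere2 => fderiv ℝ f (s • (x : Space3)) x :=
      (hD.comp_continuous (by fun_prop) (smul_mem_ball hs)).clm_apply continuous_subtype_val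
    have hc0 : Continuous fun x : Sphere2 => f (s • (x : Space3)) :=
      hcd.continuousOn.comp_continuous (by fun_prop) (smul_mem_ball hs)
    have hca : Continuous fun x : Sphere2 => angularLaplacian f (s • (x : Space3)) := by
      have h : ∀ i j : Fin 3, Continuous fun x : Sphere2 =>
          rotDeriv i j (rotDeriv i j (fun y => f (s • y))) x := fun i j =>
        continuous_rotDeriv_sphere i j fun x =>
          contDiffAt_rotDeriv i j (by norm_num; exact hcds' x)
      simp only [rotDeriv_comp_smul] at h
      simp only [angularLaplacian]
      exact ((h 1 2).add (h 2 0)).add (h 0 1)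
    simp only [hpt]
    have i1 : Integrable (fun x : Sphere2 => s ^ 2 * fderiv ℝ f (s • (x : Space3)) x ^ 2)
        sphereMeasure := integrable_of_continuous_sphere (by fun_prop)
    have i2 : Integrable (fun x : Sphere2 =>
        f (s • (x : Space3)) * angularLaplacian f (s • (x : Space3))) sphereMeasure :=
      integrable_of_continuous_sphere (hc0.mul hca)
    rw [integral_sub i1 i2, integral_const_mul]
    linarith
  have hKmono : MonotoneOn K (Set.Ico 0 1) := by
    have hI : ∀ s ∈ Set.Ico (0 : ℝ) 1, s ∈ Set.Ioo (-1 : ℝ) 1 := fun s hs =>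
      ⟨by linarith [hs.1], hs.2⟩
    refine monotoneOn_of_deriv_nonneg (convex_Ico 0 1) (fun s hs => ?_) (fun s hs => ?_)
      fun s hs => ?_
    · obtain ⟨K', h, -⟩ := hKd s (hI s hs)
      exact h.continuousAt.continuousWithinAt
    · obtain ⟨K', h, -⟩ := hKd s (hI s (interior_subset hs))
      exact h.differentiableAt.differentiableWithinAt
    · obtain ⟨K', h, h'⟩ := hKd s (hI s (interior_subset hs))
      rw [h.deriv]
      refine le_trans ?_ h'
      exact mul_nonneg (sq_nonneg _) (integral_nonneg fun x => sq_nonneg _)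
  have hK0 : ∀ s ∈ Set.Ioo (0 : ℝ) 1, 0 ≤ K s := by
    intro s hs
    have h0 : K 0 = 0 := by simp [hK]
    rw [← h0]
    exact hKmono ⟨le_rfl, one_pos⟩ ⟨hs.1.le, hs.2⟩ hs.1.le
  have hMmono : MonotoneOn M (Set.Ioo 0 1) := by
    refine monotoneOn_of_deriv_nonneg (convex_Ioo 0 1)
      (fun s hs => (hMd s hs).continuousAt.continuousWithinAt)
      (fun s hs => (hMd s (interior_subset hs)).differentiableAt.differentiableWithinAt)
      fun s hs => ?_
    have hs' := interior_subset hs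
    rw [(hMd s hs').deriv]
    have := hK0 s hs'
    positivity
  have hM0 : ∀ s ∈ Set.Ioo (0 : ℝ) 1, M s = 0 := by
    intro s hs
    refine le_antisymm (ge_of_tendsto hlim ?_) (integral_nonneg fun x => sq_nonneg _)
    filter_upwards [Ioo_mem_nhdsLT hs.2] with r hr
    exact hMmono hs ⟨hs.1.trans hr.1, hr.2⟩ hr.1.le
  have hKz : ∀ s ∈ Set.Ioo (0 : ℝ) 1, K s = 0 := by
    intro s hs
    have h : M =ᶠ[𝓝 s] fun _ => 0 := by
      filter_upwards [isOpen_Ioo.mem_nhds hs] with r hr using hM0 r hr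
    have h2 := (hMd s hs).unique ((hasDerivAt_const s (0 : ℝ)).congr_of_eventuallyEq h)
    have : (s ^ 2)⁻¹ ≠ 0 := inv_ne_zero (pow_ne_zero 2 hs.1.ne')
    simpa [this, hs.1.ne'] using h2
  obtain ⟨K', h, h'⟩ := hKd s (hsub hs)
  have hK'0 : K' = 0 := by
    refine h.unique ((hasDerivAt_const s (0 : ℝ)).congr_of_eventuallyEq ?_)
    filter_upwards [isOpen_Ioo.mem_nhds hs] with r hr using hKz r hr
  rw [hK'0] at h'
  have hs2 : 0 < s ^ 2 := pow_pos hs.1 2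
  refine le_antisymm ?_ (integral_nonneg fun x => sq_nonneg _)
  by_contra hcon
  exact absurd (mul_pos hs2 (not_le.1 hcon)) (not_lt.2 h')

theorem ofReal_integral_sq_eq {f : Sphere2 → ℝ} (hf : Continuous f) :
    ENNReal.ofReal (∫ x, f x ^ 2 ∂sphereMeasure) = eLpNorm f 2 sphereMeasure ^ 2 := by
  have h := eLpNorm_nnreal_pow_eq_lintegral (f := f) (μ := sphereMeasure) (p := 2) two_ne_zero
  have hi : Integrable (fun x => f x ^ 2) sphereMeasure :=
    integrable_of_continuous_sphere (hf.pow 2)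
  rw [ofReal_integral_eq_lintegral_ofReal hi (ae_of_all _ fun x => sq_nonneg _)]
  norm_num at h
  rw [h]
  refine lintegral_congr fun x => ?_
  rw [← sq_abs, ENNReal.ofReal_pow (abs_nonneg _), Real.enorm_eq_ofReal_abs]

theorem continuous_radial {E : Type*} [TopologicalSpace E] {f : Space3 → E}
    (hf : ContinuousOn f (Metric.ball 0 1)) {s : ℝ} (hs : s ∈ Set.Ioo (-1 : ℝ) 1) :
    Continuous fun x : Sphere2 => f (s • (x : Space3)) :=
  hf.comp_continuous (by fun_prop) (smul_mem_ball hs)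

theorem deriv_radial {E : Type*} [NormedAddCommGroup E] [NormedSpace ℝ E] {f : Space3 → E}
    (hf : ContDiffOn ℝ 2 f (Metric.ball 0 1)) {s : ℝ} (hs : s ∈ Set.Ioo (-1 : ℝ) 1) (x : Sphere2) :
    deriv (fun r : ℝ => f (r • (x : Space3))) s = fderiv ℝ f (s • (x : Space3)) x :=
  (hasDerivAt_comp_radial ((hf.contDiffAt (Metric.isOpen_ball.mem_nhds
    (smul_mem_ball hs x))).differentiableAt (by norm_num))).deriv

theorem continuous_deriv_radial {E : Type*} [NormedAddCommGroup E] [NormedSpace ℝ E]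
    {f : Space3 → E} (hf : ContDiffOn ℝ 2 f (Metric.ball 0 1)) {s : ℝ}
    (hs : s ∈ Set.Ioo (-1 : ℝ) 1) :
    Continuous fun x : Sphere2 => deriv (fun r : ℝ => f (r • (x : Space3))) s := by
  simp only [deriv_radial hf hs]
  exact (continuous_radial (hf.continuousOn_fderiv_of_isOpen Metric.isOpen_ball (by norm_num))
    hs).clm_apply continuous_subtype_val

/-- The scalar energy argument applies to each Cartesian component, whose L² norm on every sphere is
dominated by that of the field. -/
theorem deriv_radial_ae_eq_zero {f : Space3 → Space3}
    (hf : InnerProductSpace.HarmonicOnNhd f (Metric.ball 0 1))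
    (hlim : Tendsto (fun s : ℝ => eLpNorm (fun x : Sphere2 => f (s • (x : Space3))) 2 sphereMeasure)
      (𝓝[<] 1) (𝓝 0)) {s : ℝ} (hs : s ∈ Set.Ioo (0 : ℝ) 1) :
    ∀ᵐ x : Sphere2 ∂sphereMeasure, deriv (fun r : ℝ => f (r • (x : Space3))) s = 0 := by
  have hsub : Set.Ioo (0 : ℝ) 1 ⊆ Set.Ioo (-1 : ℝ) 1 := Set.Ioo_subset_Ioo_left (by norm_num)
  have key : ∀ i : Fin 3, ∀ᵐ x : Sphere2 ∂sphereMeasure,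
      fderiv ℝ f (s • (x : Space3)) x i = 0 := by
    intro i
    set g : Space3 → ℝ := coordCLM i ∘ f with hg
    have hgh : InnerProductSpace.HarmonicOnNhd g (Metric.ball 0 1) := hf.comp_CLM (coordCLM i)
    have hglim : Tendsto (fun s : ℝ => ∫ x : Sphere2, g (s • (x : Space3)) ^ 2 ∂sphereMeasure)
        (𝓝[<] 1) (𝓝 0) := by
      have h2 : Tendsto (fun s : ℝ =>
          (eLpNorm (fun x : Sphere2 => f (s • (x : Space3))) 2 sphereMeasure ^ 2).toReal)
          (𝓝[<] 1) (𝓝 0) := by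
        have := (ENNReal.tendsto_toReal (by simp)).comp (ENNReal.Tendsto.pow (n := 2) hlim)
        simpa [Function.comp_def] using this
      refine squeeze_zero' (Eventually.of_forall fun s => integral_nonneg fun x => sq_nonneg _) ?_ h2
      have hfin : ∀ᶠ s : ℝ in 𝓝[<] 1,
          eLpNorm (fun x : Sphere2 => f (s • (x : Space3))) 2 sphereMeasure < 1 :=
        hlim.eventually (gt_mem_nhds (by norm_num))
      filter_upwards [hfin, Ioo_mem_nhdsLT (zero_lt_one' ℝ)] with r hr hr1
      have hc : Continuous fun x : Sphere2 => g (r • (x : Space3)) :=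
        continuous_radial hgh.continuousOn (hsub hr1)
      rw [← ENNReal.ofReal_le_iff_le_toReal (ENNReal.pow_ne_top (hr.trans ENNReal.one_lt_top).ne),
        ofReal_integral_sq_eq hc]
      gcongr
      refine eLpNorm_mono fun x => ?_
      simpa [hg] using abs_coord_le_norm (f (r • (x : Space3))) i
    have h0 := integral_sq_fderiv_radial_eq_zero hgh hglim hs
    have hc : Continuous fun x : Sphere2 => fderiv ℝ g (s • (x : Space3)) x :=
      (continuous_radial (hgh.contDiffOn.continuousOn_fderiv_of_isOpen Metric.isOpen_ball
        (by norm_num)) (hsub hs)).clm_apply continuous_subtype_val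
    rw [integral_eq_zero_iff_of_nonneg (fun x => sq_nonneg _)
      (integrable_of_continuous_sphere (hc.pow 2))] at h0
    filter_upwards [h0] with x hx
    have hd : DifferentiableAt ℝ f (s • (x : Space3)) :=
      (hf.contDiffOn.contDiffAt (Metric.isOpen_ball.mem_nhds
        (smul_mem_ball (hsub hs) x))).differentiableAt (by norm_num)
    have hgd : HasFDerivAt g _ (s • (x : Space3)) :=
      (coordCLM i).hasFDerivAt.comp (s • (x : Space3)) hd.hasFDerivAt
    have hx' : fderiv ℝ g (s • (x : Space3)) x = 0 := by simpa using hx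
    rw [hgd.fderiv] at hx'
    simpa using hx'
  filter_upwards [ae_all_iff.2 key] with x hx
  rw [deriv_radial hf.contDiffOn (hsub hs)]
  ext i
  simpa using hx i

/-- The Dirichlet-to-Neumann operator is single-valued. -/
theorem IsDirichletToNeumann.ae_eq {g w₁ w₂ : Sphere2 → Space3} (h₁ : IsDirichletToNeumann g w₁)
    (h₂ : IsDirichletToNeumann g w₂) : w₁ =ᵐ[sphereMeasure] w₂ := by
  obtain ⟨hg, hw₁, f₁, hf₁, hb₁, hd₁⟩ := h₁
  obtain ⟨-, hw₂, f₂, hf₂, hb₂, hd₂⟩ := h₂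
  have hsub : Set.Ioo (0 : ℝ) 1 ⊆ Set.Ioo (-1 : ℝ) 1 := Set.Ioo_subset_Ioo_left (by norm_num)
  have hev : ∀ᶠ s : ℝ in 𝓝[<] 1, s ∈ Set.Ioo (0 : ℝ) 1 := Ioo_mem_nhdsLT (zero_lt_one' ℝ)
  have hlim : Tendsto (fun s : ℝ =>
      eLpNorm (fun x : Sphere2 => (f₁ - f₂) (s • (x : Space3))) 2 sphereMeasure)
      (𝓝[<] 1) (𝓝 0) := by
    refine tendsto_of_tendsto_of_tendsto_of_le_of_le' tendsto_const_nhds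
      (by simpa using hb₁.add hb₂) (Eventually.of_forall fun s => bot_le) ?_
    filter_upwards [hev] with s hs
    refine le_trans (le_of_eq ?_) (eLpNorm_sub_le
      ((continuous_radial hf₁.continuousOn (hsub hs)).aestronglyMeasurable.sub hg.1)
      ((continuous_radial hf₂.continuousOn (hsub hs)).aestronglyMeasurable.sub hg.1) one_le_two)
    congr 1
    funext x
    simp
  have hz := fun s hs => deriv_radial_ae_eq_zero (hf₁.sub hf₂) hlim (s := s) hs
  -- The radial derivatives of the two extensions agree, so w₂ - w₁ = (∂_s f₁ - w₁) - (∂_s f₂ - w₂)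
  -- for every s in (0,1). Its norm is independent of s yet bounded by a quantity tending to 0.
  have hlim2 : Tendsto (fun _ : ℝ => eLpNorm (w₂ - w₁) 2 sphereMeasure) (𝓝[<] 1) (𝓝 0) := by
    refine tendsto_of_tendsto_of_tendsto_of_le_of_le' tendsto_const_nhds
      (by simpa using hd₁.add hd₂) (Eventually.of_forall fun s => bot_le) ?_
    filter_upwards [hev] with s hs
    refine le_trans (le_of_eq ?_) (eLpNorm_sub_le
      ((continuous_deriv_radial hf₁.contDiffOn (hsub hs)).aestronglyMeasurable.sub hw₁.1)
      ((continuous_deriv_radial hf₂.contDiffOn (hsub hs)).aestronglyMeasurable.sub hw₂.1)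
      one_le_two)
    refine eLpNorm_congr_ae ?_
    filter_upwards [hz s hs] with x hx
    have hd : ∀ {f : Space3 → Space3}, ContDiffOn ℝ 2 f (Metric.ball 0 1) →
        DifferentiableAt ℝ (fun r : ℝ => f (r • (x : Space3))) s := fun hf =>
      (hasDerivAt_comp_radial ((hf.contDiffAt (Metric.isOpen_ball.mem_nhds
        (smul_mem_ball (hsub hs) x))).differentiableAt (by norm_num))).differentiableAt
    have h3 : deriv (fun r : ℝ => f₁ (r • (x : Space3))) s -
        deriv (fun r : ℝ => f₂ (r • (x : Space3))) s = 0 := by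
      exact (deriv_fun_sub (hd hf₁.contDiffOn) (hd hf₂.contDiffOn)).symm.trans hx
    simp only [Pi.sub_apply]
    rw [sub_eq_zero.1 h3]
    abel
  have h0 := tendsto_nhds_unique hlim2 tendsto_const_nhds
  rw [eq_comm, eLpNorm_eq_zero_iff (hw₂.1.sub hw₁.1) two_ne_zero] at h0
  filter_upwards [h0] with x hx
  exact (sub_eq_zero.1 (by simpa using hx)).symm

end DirichletToNeumannUniqueness

/-! ### The weak Laplace-Beltrami operator and Legendre orthogonality. -/

section LaplaceBeltrami

theorem memLp_of_continuous_sphere {E : Type*} [NormedAddCommGroup E] {f : Sphere2 → E}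
    (hf : Continuous f) (p : ENNReal) : MemLp f p sphereMeasure :=
  hf.memLp_of_hasCompactSupport (HasCompactSupport.of_compactSpace _)

/-- An integrable function on the sphere that is orthogonal to all smooth functions vanishes. -/
theorem ae_eq_zero_of_integral_mul_smooth_eq_zero {w : Sphere2 → ℝ}
    (hw : Integrable w sphereMeasure)
    (h : ∀ f : Space3 → ℝ, ContDiff ℝ ∞ f → ∫ x : Sphere2, w x * f x ∂sphereMeasure = 0) :
    w =ᵐ[sphereMeasure] 0 := by
  have hemb : MeasurableEmbedding (Subtype.val : Sphere2 → Space3) :=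
    MeasurableEmbedding.subtype_coe Metric.isClosed_sphere.measurableSet
  -- Extending by zero and pushing the measure forward to three-space makes the density of ambient
  -- test functions applicable.
  set W : Space3 → ℝ := Function.extend Subtype.val w 0 with hW
  have hWv : ∀ x : Sphere2, W x = w x := fun x => Subtype.val_injective.extend_apply _ _ _
  have hWi : Integrable W (Measure.map Subtype.val sphereMeasure) := by
    rw [hemb.integrable_map_iff]
    exact hw.congr (ae_of_all _ fun x => (hWv x).symm)
  have h0 := ae_eq_zero_of_integral_contDiff_smul_eq_zero hWi.locallyIntegrable fun g hg _ => by
    rw [hemb.integral_map, ← h g hg]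
    exact integral_congr_ae (ae_of_all _ fun x => by simp only [hWv, smul_eq_mul, mul_comm])
  rw [hemb.ae_map_iff] at h0
  filter_upwards [h0] with x hx
  rw [← hWv, hx, Pi.zero_apply]

theorem IsLaplaceBeltrami.ae_eq {u w₁ w₂ : Sphere2 → ℝ} (h₁ : IsLaplaceBeltrami u w₁)
    (h₂ : IsLaplaceBeltrami u w₂) : w₁ =ᵐ[sphereMeasure] w₂ := by
  obtain ⟨-, hw₁, h₁⟩ := h₁
  obtain ⟨-, hw₂, h₂⟩ := h₂
  have hmul : ∀ {w : Sphere2 → ℝ} {f : Space3 → ℝ}, MemLp w 2 sphereMeasure → ContDiff ℝ ∞ f →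
      Integrable (fun x : Sphere2 => w x * f x) sphereMeasure := fun hw hf =>
    hw.integrable_mul (memLp_of_continuous_sphere (hf.continuous.comp continuous_subtype_val) 2)
  have h := ae_eq_zero_of_integral_mul_smooth_eq_zero (w := fun x => w₁ x - w₂ x)
    ((hw₁.sub hw₂).integrable one_le_two) fun f hf => by
      simp only [sub_mul]
      rw [integral_sub (hmul hw₁ hf) (hmul hw₂ hf), ← h₁ f hf, ← h₂ f hf, sub_self]
  filter_upwards [h] with x hx
  exact sub_eq_zero.1 (by simpa using hx)

theorem contDiffAt_radialExtension {f : Space3 → ℝ} (hf : ContDiff ℝ ∞ f) {y : Space3}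
    (hy : y ≠ 0) : ContDiffAt ℝ ∞ (fun y : Space3 => f (‖y‖⁻¹ • y)) y :=
  hf.contDiffAt.comp y (((contDiffAt_norm ℝ hy).inv (norm_ne_zero_iff.2 hy)).smul contDiffAt_id)

theorem fderiv_radialExtension {f : Space3 → ℝ} (hf : ContDiff ℝ ∞ f) {y : Space3} (hy : y ≠ 0) :
    fderiv ℝ (fun y : Space3 => f (‖y‖⁻¹ • y)) y y = 0 := by
  have hd : DifferentiableAt ℝ (fun y : Space3 => f (‖y‖⁻¹ • y)) ((1 : ℝ) • y) := by
    rw [one_smul]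
    exact (contDiffAt_radialExtension hf hy).differentiableAt (by simp)
  have h1 := hasDerivAt_comp_radial hd
  rw [one_smul] at h1
  refine h1.unique ((hasDerivAt_const (1 : ℝ) (f (‖y‖⁻¹ • y))).congr_of_eventuallyEq ?_)
  filter_upwards [lt_mem_nhds (zero_lt_one' ℝ)] with r hr
  have : r ≠ 0 := hr.ne'
  simp only [norm_smul, Real.norm_of_nonneg hr.le, smul_smul]
  congr 2
  field_simp

theorem sphere_ne_zero (x : Sphere2) : (x : Space3) ≠ 0 :=
  ne_zero_of_mem_unit_sphere x

/-- The extension is homogeneous of degree zero, so both radial terms in `angularLaplacian_eq`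
vanish, and |x| = 1. -/
theorem sphereLaplacian_eq_angularLaplacian {f : Space3 → ℝ} (hf : ContDiff ℝ ∞ f) (x : Sphere2) :
    sphereLaplacian f x = angularLaplacian (fun y : Space3 => f (‖y‖⁻¹ • y)) x := by
  set g : Space3 → ℝ := fun y : Space3 => f (‖y‖⁻¹ • y) with hg
  have hx := sphere_ne_zero x
  have hcd : ContDiffAt ℝ 2 g x := (contDiffAt_radialExtension hf hx).of_le (by norm_cast)
  have h1 : fderiv ℝ g x x = 0 := fderiv_radialExtension hf hx
  -- Differentiating Euler's relation Dg(y)y = 0 in the direction x gives D²g(x,x) + Dg(x)x = 0.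
  have h2 : fderiv ℝ (fderiv ℝ g) x x x = 0 := by
    have hd1 : DifferentiableAt ℝ (fderiv ℝ g) x :=
      (hcd.fderiv_right (m := 1) (by norm_num)).differentiableAt (by norm_num)
    have h3 := hd1.hasFDerivAt.clm_apply (hasFDerivAt_id (x : Space3))
    have h4 : (fun y : Space3 => fderiv ℝ g y (id y)) =ᶠ[𝓝 (x : Space3)] fun _ => 0 := by
      filter_upwards [isOpen_ne.mem_nhds hx] with y hy using fderiv_radialExtension hf hy
    have h5 := congrArg (fun L : Space3 →L[ℝ] ℝ => L x)
      (h3.unique ((hasFDerivAt_const (0 : ℝ) (x : Space3)).congr_of_eventuallyEq h4))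
    simpa [h1] using h5
  rw [angularLaplacian_eq hcd, h1, h2, norm_eq_of_mem_sphere]
  simp [sphereLaplacian, hg]

theorem contDiffAt_radialExtension_sphere {f : Space3 → ℝ} (hf : ContDiff ℝ ∞ f) (n : ℕ)
    (x : Sphere2) : ContDiffAt ℝ n (fun y : Space3 => f (‖y‖⁻¹ • y)) x :=
  (contDiffAt_radialExtension hf (sphere_ne_zero x)).of_le (by norm_cast; simp)

theorem continuous_sphereLaplacian {f : Space3 → ℝ} (hf : ContDiff ℝ ∞ f) :
    Continuous (sphereLaplacian f) := by
  have h : ∀ i j : Fin 3, Continuous fun x : Sphere2 =>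
      rotDeriv i j (rotDeriv i j (fun y : Space3 => f (‖y‖⁻¹ • y))) x := fun i j =>
    continuous_rotDeriv_sphere i j fun x => contDiffAt_rotDeriv i j
      (by norm_num; exact contDiffAt_radialExtension_sphere hf 2 x)
  have e : sphereLaplacian f = fun x : Sphere2 =>
      angularLaplacian (fun y : Space3 => f (‖y‖⁻¹ • y)) x :=
    funext (sphereLaplacian_eq_angularLaplacian hf)
  rw [e]
  exact ((h 1 2).add (h 2 0)).add (h 0 1)

/-- Two integrations by parts for each of the three rotations. -/
theorem integral_mul_angularLaplacian_comm {f g : Space3 → ℝ}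
    (hf : ∀ x : Sphere2, ContDiffAt ℝ 2 f x) (hg : ∀ x : Sphere2, ContDiffAt ℝ 2 g x) :
    ∫ x : Sphere2, f x * angularLaplacian g x ∂sphereMeasure =
      ∫ x : Sphere2, angularLaplacian f x * g x ∂sphereMeasure := by
  have hone : ∀ {f : Space3 → ℝ}, (∀ x : Sphere2, ContDiffAt ℝ 2 f x) →
      ∀ x : Sphere2, ContDiffAt ℝ 1 f x := fun hf x => (hf x).of_le (by norm_num)
  have hrot : ∀ {f : Space3 → ℝ} (i j : Fin 3), (∀ x : Sphere2, ContDiffAt ℝ 2 f x) →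
      ∀ x : Sphere2, ContDiffAt ℝ 1 (rotDeriv i j f) x := fun i j hf x =>
    contDiffAt_rotDeriv i j (by norm_num; exact hf x)
  have hint : ∀ {f g : Space3 → ℝ} (i j : Fin 3), (∀ x : Sphere2, ContDiffAt ℝ 2 f x) →
      (∀ x : Sphere2, ContDiffAt ℝ 2 g x) →
      Integrable (fun x : Sphere2 => f x * rotDeriv i j (rotDeriv i j g) x) sphereMeasure :=
    fun i j hf hg => integrable_of_continuous_sphere ((continuous_comp_sphere fun x =>
      (hf x).of_le (by norm_num)).mul (continuous_rotDeriv_sphere i j (hrot i j hg)))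
  have key : ∀ i j : Fin 3, i ≠ j →
      ∫ x : Sphere2, f x * rotDeriv i j (rotDeriv i j g) x ∂sphereMeasure =
        ∫ x : Sphere2, g x * rotDeriv i j (rotDeriv i j f) x ∂sphereMeasure := fun i j hij => by
    rw [integral_mul_rotDeriv hij (hone hf) (hrot i j hg),
      integral_mul_rotDeriv hij (hone hg) (hrot i j hf)]
    simp only [mul_comm]
  have hsum : ∀ {f g : Space3 → ℝ}, (∀ x : Sphere2, ContDiffAt ℝ 2 f x) →
      (∀ x : Sphere2, ContDiffAt ℝ 2 g x) →
      ∫ x : Sphere2, f x * angularLaplacian g x ∂sphereMeasure =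
        ∫ x : Sphere2, f x * rotDeriv 1 2 (rotDeriv 1 2 g) x ∂sphereMeasure +
        ∫ x : Sphere2, f x * rotDeriv 2 0 (rotDeriv 2 0 g) x ∂sphereMeasure +
        ∫ x : Sphere2, f x * rotDeriv 0 1 (rotDeriv 0 1 g) x ∂sphereMeasure := by
    intro f g hf hg
    have i12 : Integrable (fun x : Sphere2 => f x * rotDeriv 1 2 (rotDeriv 1 2 g) x +
      f x * rotDeriv 2 0 (rotDeriv 2 0 g) x) sphereMeasure := (hint 1 2 hf hg).add (hint 2 0 hf hg)
    rw [← integral_add (hint 1 2 hf hg) (hint 2 0 hf hg), ← integral_add i12 (hint 0 1 hf hg)]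
    simp only [angularLaplacian, mul_add]
  simp only [mul_comm (angularLaplacian f _)]
  rw [hsum hf hg, hsum hg hf, key 1 2 (by decide), key 2 0 (by decide), key 0 1 (by decide)]

open Polynomial

theorem angularLaplacian_zonalPoly (q : ℝ[X]) (x : Sphere2) :
    angularLaplacian (fun y => q.eval (y 2)) x =
      (derivative ((1 - X ^ 2) * derivative q)).eval ((x : Space3) 2) := by
  have e12 : rotDeriv 1 2 (fun y => q.eval (y 2)) = fun y => y 1 * (derivative q).eval (y 2) := by
    funext y
    rw [rotDeriv_zonalPoly, rotGen_apply]
    simp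
    ring
  have e20 : rotDeriv 2 0 (fun y => q.eval (y 2)) =
      fun y => y 0 * (-derivative q).eval (y 2) := by
    funext y
    rw [rotDeriv_zonalPoly, rotGen_apply]
    simp
    ring
  have e01 : rotDeriv 0 1 (fun y => q.eval (y 2)) = fun y => y 0 * (0 : ℝ[X]).eval (y 2) := by
    funext y
    rw [rotDeriv_zonalPoly, rotGen_apply]
    simp
  rw [angularLaplacian, e12, e20, e01, rotDeriv_coord_mul_zonalPoly, rotDeriv_coord_mul_zonalPoly,
    rotDeriv_coord_mul_zonalPoly]
  have hx := sphere_sq_add x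
  simp [rotGen_apply]
  linear_combination (derivative (derivative q)).eval ((x : Space3) 2) * hx

/-- By symmetry the angular Laplacian moves onto the Legendre polynomial, where it acts as d/dt
(1-t²) d/dt and the Legendre equation applies. -/
theorem integral_legendrePoly_mul_sphereLaplacian (l : ℕ) {f : Space3 → ℝ} (hf : ContDiff ℝ ∞ f) :
    ∫ x : Sphere2, (legendrePoly l).eval ((x : Space3) 2) * sphereLaplacian f x ∂sphereMeasure =
      ∫ x : Sphere2, -((l : ℝ) * (l + 1)) * (legendrePoly l).eval ((x : Space3) 2) * f x
        ∂sphereMeasure := by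
  simp only [sphereLaplacian_eq_angularLaplacian hf]
  rw [integral_mul_angularLaplacian_comm (f := fun y : Space3 => (legendrePoly l).eval (y 2))
    (fun x => (contDiff_zonalPoly _).contDiffAt) (fun x => contDiffAt_radialExtension_sphere hf 2 x)]
  refine integral_congr_ae (ae_of_all _ fun x => ?_)
  simp only [angularLaplacian_zonalPoly, derivative_one_sub_X_sq_mul_derivative_legendrePoly,
    norm_eq_of_mem_sphere, inv_one, one_smul]
  simp

/-! ### Integrals of zonal polynomials -/

/-- Integration of zonal polynomials over the sphere. -/
noncomputable def zonalIntegral : ℝ[X] →ₗ[ℝ] ℝ where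
  toFun q := ∫ x : Sphere2, q.eval ((x : Space3) 2) ∂sphereMeasure
  map_add' p q := by
    simp only [eval_add]
    exact integral_add (integrable_of_continuous_sphere (continuous_zonalPoly p))
      (integrable_of_continuous_sphere (continuous_zonalPoly q))
  map_smul' c q := by
    simp only [eval_smul, smul_eq_mul, RingHom.id_apply]
    exact integral_const_mul _ _

theorem zonalIntegral_apply (q : ℝ[X]) :
    zonalIntegral q = ∫ x : Sphere2, q.eval ((x : Space3) 2) ∂sphereMeasure := rfl

theorem zonalIntegral_C_mul (c : ℝ) (q : ℝ[X]) : zonalIntegral (C c * q) = c * zonalIntegral q := by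
  rw [C_mul', map_smul, smul_eq_mul]

theorem zonalIntegral_derivative_one_sub_sq_mul (q : ℝ[X]) :
    zonalIntegral (derivative ((1 - X ^ 2) * q)) = 0 :=
  integral_derivative_one_sub_sq_mul q

theorem zonalIntegral_derivative_mul_derivative (l m : ℕ) :
    zonalIntegral ((1 - X ^ 2) * derivative (legendrePoly l) * derivative (legendrePoly m)) =
      (l : ℝ) * (l + 1) * zonalIntegral (legendrePoly l * legendrePoly m) := by
  have h := zonalIntegral_derivative_one_sub_sq_mul (derivative (legendrePoly l) * legendrePoly m)
  rw [← mul_assoc, derivative_mul, derivative_one_sub_X_sq_mul_derivative_legendrePoly, map_add,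
    neg_mul, map_neg, mul_assoc, zonalIntegral_C_mul] at h
  linarith

/-- The Dirichlet form of P_l and P_m is symmetric and equals both l(l+1) and m(m+1) times their
inner product. The difference factors as (l-m)(l+m+1). -/
theorem zonalIntegral_legendrePoly_mul_of_ne {l m : ℕ} (hlm : l ≠ m) :
    zonalIntegral (legendrePoly l * legendrePoly m) = 0 := by
  have h1 := zonalIntegral_derivative_mul_derivative l m
  have h2 := zonalIntegral_derivative_mul_derivative m l
  rw [mul_right_comm, h1, mul_comm (legendrePoly m)] at h2
  have h3 : ((l : ℝ) - m) * ((l : ℝ) + m + 1) * zonalIntegral (legendrePoly l * legendrePoly m) = 0 := by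
    linear_combination h2
  have h4 : (l : ℝ) - m ≠ 0 := sub_ne_zero.2 (by exact_mod_cast hlm)
  have h5 : (l : ℝ) + m + 1 ≠ 0 := by positivity
  simpa [h4, h5] using h3

/-- The three-term recurrence, tested against two neighbouring Legendre polynomials, evaluates the
integral of t P_l P_{l+1} in two ways. The norms stay relative to the total mass, whose value is not
needed. -/
theorem zonalIntegral_legendrePoly_sq (l : ℕ) :
    (2 * (l : ℝ) + 1) * zonalIntegral (legendrePoly l * legendrePoly l) = zonalIntegral 1 := by
  induction l with
  | zero => simp [legendrePoly_zero]
  | succ l ih =>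
    rw [← ih]
    have a1 := congrArg (fun q => zonalIntegral (q * legendrePoly l)) (legendrePoly_add_two l)
    simp only [sub_mul, mul_assoc, zonalIntegral_C_mul, map_sub] at a1
    rw [zonalIntegral_legendrePoly_mul_of_ne (by omega)] at a1
    have a2 : ((l : ℝ) + 1) * zonalIntegral (legendrePoly (l + 1) * legendrePoly (l + 1)) =
        (2 * (l : ℝ) + 1) * zonalIntegral (X * (legendrePoly (l + 1) * legendrePoly l)) := by
      cases l with
      | zero =>
        simp [legendrePoly_zero, legendrePoly_one]
      | succ l =>
        have a3 := congrArg (fun q => zonalIntegral (q * legendrePoly (l + 2)))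
          (legendrePoly_add_two l)
        simp only [sub_mul, mul_assoc, zonalIntegral_C_mul, map_sub] at a3
        rw [zonalIntegral_legendrePoly_mul_of_ne (l := l) (m := l + 2) (by omega)] at a3
        rw [mul_comm (legendrePoly (l + 1 + 1)) (legendrePoly (l + 1))]
        push_cast
        linear_combination a3
    have hl : (l : ℝ) + 1 ≠ 0 := by positivity
    apply mul_left_cancel₀ hl
    push_cast
    linear_combination (2 * (l : ℝ) + 3) * a2 - (2 * (l : ℝ) + 1) * a1

end LaplaceBeltrami

/-! ### Azimuthal harmonics in L² and Λ on their series. -/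

section ZonalFields

open Polynomial

/-- Square integrable vector fields on the sphere. -/
abbrev L2Field : Type := Lp Space3 2 sphereMeasure

/-- The restriction of `sinAzimuth` to the sphere. -/
noncomputable def azimuthMap : C(Sphere2, Space3) where
  toFun x := sinAzimuth x
  continuous_toFun := by
    have h : (fun x : Sphere2 => sinAzimuth x) = fun x : Sphere2 => rotGen 0 1 (x : Space3) := by
      funext x
      ext i
      fin_cases i <;> simp [sinAzimuth, rotGen_apply]
    rw [h]
    fun_prop

theorem inner_sinAzimuth_self (x : Sphere2) :
    inner ℝ (sinAzimuth x) (sinAzimuth x) = 1 - (x : Space3) 2 ^ 2 := by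
  have hx := sphere_sq_add x
  rw [PiLp.inner_apply, Fin.sum_univ_three]
  simp [sinAzimuth]
  linear_combination hx

theorem norm_sinAzimuth_le (x : Sphere2) : ‖sinAzimuth x‖ ≤ 1 := by
  have h := inner_sinAzimuth_self x
  rw [real_inner_self_eq_norm_sq] at h
  have h2 := sq_nonneg ((x : Space3) 2)
  nlinarith [norm_nonneg (sinAzimuth x)]

/-- The zonal polynomial `q(cos θ)` as a continuous function on the sphere. -/
noncomputable def zonalMap (q : ℝ[X]) : C(Sphere2, ℝ) where
  toFun x := q.eval ((x : Space3) 2)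
  continuous_toFun := continuous_zonalPoly q

theorem zonalMap_apply (q : ℝ[X]) (x : Sphere2) : zonalMap q x = q.eval ((x : Space3) 2) := rfl

/-- The zonal polynomial `q(cos θ)` in `L²`. -/
noncomputable def zonalLp (q : ℝ[X]) : L2Sphere := ContinuousMap.toLp 2 sphereMeasure ℝ (zonalMap q)

/-- The azimuthal field `q(cos θ) sin θ e_φ` as a continuous map. -/
noncomputable def azimuthalMap (q : ℝ[X]) : C(Sphere2, Space3) where
  toFun x := zonalMap q x • azimuthMap x
  continuous_toFun := (zonalMap q).continuous.smul azimuthMap.continuous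

/-- The azimuthal field `q(cos θ) sin θ e_φ` in `L²`. -/
noncomputable def azimuthalLp (q : ℝ[X]) : L2Field :=
  ContinuousMap.toLp 2 sphereMeasure ℝ (azimuthalMap q)

theorem zonalLp_coe (q : ℝ[X]) :
    zonalLp q =ᵐ[sphereMeasure] fun x => q.eval ((x : Space3) 2) :=
  ContinuousMap.coeFn_toLp _ _

theorem azimuthalLp_coe (q : ℝ[X]) :
    azimuthalLp q =ᵐ[sphereMeasure] fun x => q.eval ((x : Space3) 2) • sinAzimuth x :=
  ContinuousMap.coeFn_toLp _ _

theorem zonalLp_smul (c : ℝ) (q : ℝ[X]) : zonalLp (C c * q) = c • zonalLp q := by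
  rw [zonalLp, zonalLp, ← map_smul]
  congr 1
  ext x
  simp [zonalMap_apply]

theorem zonalLp_sub (p q : ℝ[X]) : zonalLp (p - q) = zonalLp p - zonalLp q := by
  rw [zonalLp, zonalLp, zonalLp, ← map_sub]
  congr 1
  ext x
  simp [zonalMap_apply]

theorem azimuthalLp_smul (c : ℝ) (q : ℝ[X]) : azimuthalLp (C c * q) = c • azimuthalLp q := by
  rw [azimuthalLp, azimuthalLp, ← map_smul]
  congr 1
  ext1 x
  simp [azimuthalMap, zonalMap_apply, mul_smul]

theorem azimuthalLp_sub (p q : ℝ[X]) : azimuthalLp (p - q) = azimuthalLp p - azimuthalLp q := by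
  rw [azimuthalLp, azimuthalLp, azimuthalLp, ← map_sub]
  congr 1
  ext1 x
  simp [azimuthalMap, zonalMap_apply, sub_smul]

theorem inner_zonalLp (p q : ℝ[X]) : inner ℝ (zonalLp p) (zonalLp q) = zonalIntegral (p * q) := by
  rw [L2.inner_def, zonalIntegral_apply]
  refine integral_congr_ae ?_
  filter_upwards [zonalLp_coe p, zonalLp_coe q] with x hp hq
  simp [hp, hq, mul_comm]

theorem norm_sq_azimuthalLp (q : ℝ[X]) :
    ‖azimuthalLp q‖ ^ 2 = zonalIntegral ((1 - X ^ 2) * q * q) := by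
  rw [← real_inner_self_eq_norm_sq, L2.inner_def, zonalIntegral_apply]
  refine integral_congr_ae ?_
  filter_upwards [azimuthalLp_coe q] with x hq
  rw [hq, inner_smul_left, inner_smul_right, inner_sinAzimuth_self]
  simp
  ring

/-- Multiplication by the field `sin θ e_φ`. -/
noncomputable def azimuthMul : L2Sphere →L[ℝ] L2Field :=
  ((ContinuousLinearMap.lsmul ℝ ℝ : ℝ →L[ℝ] Space3 →L[ℝ] Space3).holderL
    sphereMeasure 2 ⊤ 2).flip (ContinuousMap.toLp ⊤ sphereMeasure ℝ azimuthMap)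

theorem azimuthMul_coe (u : L2Sphere) :
    azimuthMul u =ᵐ[sphereMeasure] fun x => u x • sinAzimuth x := by
  have h := (ContinuousLinearMap.lsmul ℝ ℝ : ℝ →L[ℝ] Space3 →L[ℝ] Space3).coeFn_holder (r := 2) u
    (ContinuousMap.toLp ⊤ sphereMeasure ℝ azimuthMap)
  filter_upwards [h, ContinuousMap.coeFn_toLp (p := ⊤) (𝕜 := ℝ) sphereMeasure azimuthMap]
    with x h1 h2
  rw [h2] at h1
  exact h1

/-- The inner product with the field `sin θ e_φ`. -/
noncomputable def azimuthInner : L2Field →L[ℝ] L2Sphere :=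
  (innerSL ℝ : Space3 →L[ℝ] Space3 →L[ℝ] ℝ).holderL sphereMeasure ⊤ 2 2
    (ContinuousMap.toLp ⊤ sphereMeasure ℝ azimuthMap)

theorem azimuthInner_coe (G : L2Field) :
    azimuthInner G =ᵐ[sphereMeasure] fun x => inner ℝ (sinAzimuth x) (G x) := by
  have h := (innerSL ℝ : Space3 →L[ℝ] Space3 →L[ℝ] ℝ).coeFn_holder (r := 2)
    (ContinuousMap.toLp ⊤ sphereMeasure ℝ azimuthMap) G
  filter_upwards [h, ContinuousMap.coeFn_toLp (p := ⊤) (𝕜 := ℝ) sphereMeasure azimuthMap]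
    with x h1 h2
  rw [h2] at h1
  exact h1

theorem azimuthMul_zonalLp (q : ℝ[X]) : azimuthMul (zonalLp q) = azimuthalLp q := by
  refine Lp.ext ?_
  filter_upwards [azimuthMul_coe (zonalLp q), zonalLp_coe q, azimuthalLp_coe q] with x h1 h2 h3
  rw [h1, h2, h3]

theorem azimuthInner_azimuthalLp (q : ℝ[X]) :
    azimuthInner (azimuthalLp q) = zonalLp ((1 - X ^ 2) * q) := by
  refine Lp.ext ?_
  filter_upwards [azimuthInner_coe (azimuthalLp q), azimuthalLp_coe q,
    zonalLp_coe ((1 - X ^ 2) * q)] with x h1 h2 h3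
  rw [h1, h2, h3, inner_smul_right, inner_sinAzimuth_self]
  simp
  ring

/-! ### Series of azimuthal harmonics -/

/-- The azimuthal harmonic `P_{n+1}'(cos θ) sin θ e_φ`. -/
noncomputable def azimuthalHarmonic (n : ℕ) : L2Field :=
  azimuthalLp (derivative (legendrePoly (n + 1)))

theorem norm_sq_azimuthalHarmonic (n : ℕ) :
    (2 * (n : ℝ) + 3) * ‖azimuthalHarmonic n‖ ^ 2 =
      ((n : ℝ) + 1) * ((n : ℝ) + 2) * zonalIntegral 1 := by
  rw [azimuthalHarmonic, norm_sq_azimuthalLp, zonalIntegral_derivative_mul_derivative,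
    ← zonalIntegral_legendrePoly_sq (n + 1)]
  push_cast
  ring

theorem norm_azimuthalMap_le (n : ℕ) :
    ‖azimuthalMap (derivative (legendrePoly (n + 1)))‖ ≤ ((n : ℝ) + 1) ^ 2 := by
  rw [ContinuousMap.norm_le _ (by positivity)]
  intro x
  have h1 := abs_solidGegenbauer_le 1 n (x : Space3)
  rw [solidGegenbauer_one_eq_derivative_legendre n (norm_eq_of_mem_sphere x),
    norm_eq_of_mem_sphere] at h1
  have h2 := norm_sinAzimuth_le x
  change ‖(derivative (legendrePoly (n + 1))).eval ((x : Space3) 2) • sinAzimuth x‖ ≤ _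
  rw [norm_smul, Real.norm_eq_abs]
  simp only [gegenbauerConst, Nat.cast_zero, mul_zero, zero_add, mul_one, one_pow, one_mul] at h1
  exact (mul_le_of_le_one_right (abs_nonneg _) h2).trans h1

/-- The weight (n+1)² dominates the sup norms, so the series converges uniformly and its pointwise
sum represents the L² sum. It is applied at radius s < 1, where the powers of s provide the
summability. -/
theorem azimuthal_series_coe {a : ℕ → ℝ}
    (ha : Summable fun n => |a n| * ((n : ℝ) + 1) ^ 2) :
    (∑' n, a n • azimuthalHarmonic n : L2Field) =ᵐ[sphereMeasure]
      fun x => (∑' n, a n * solidGegenbauer 1 n (x : Space3)) • sinAzimuth x := by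
  have hs : Summable fun n => a n • azimuthalMap (derivative (legendrePoly (n + 1))) := by
    refine Summable.of_norm_bounded ha fun n => ?_
    rw [norm_smul, Real.norm_eq_abs]
    exact mul_le_mul_of_nonneg_left (norm_azimuthalMap_le n) (abs_nonneg _)
  have e : (∑' n, a n • azimuthalHarmonic n : L2Field) = ContinuousMap.toLp 2 sphereMeasure ℝ
      (∑' n, a n • azimuthalMap (derivative (legendrePoly (n + 1)))) := by
    rw [ContinuousLinearMap.map_tsum _ hs]
    simp only [map_smul]
    rfl
  rw [e]
  filter_upwards [ContinuousMap.coeFn_toLp (p := 2) (𝕜 := ℝ) sphereMeasure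
    (∑' n, a n • azimuthalMap (derivative (legendrePoly (n + 1))))] with x hx
  rw [hx]
  have h1 := (ContinuousMap.evalCLM ℝ x).map_tsum hs
  have h2 : ∀ n, ContinuousMap.evalCLM ℝ x (a n • azimuthalMap (derivative (legendrePoly (n + 1)))) =
      (a n * solidGegenbauer 1 n (x : Space3)) • sinAzimuth x := fun n => by
    rw [solidGegenbauer_one_eq_derivative_legendre n (norm_eq_of_mem_sphere x), mul_smul]
    rfl
  simp only [h2] at h1
  refine h1.trans (Summable.tsum_smul_const ?_ _)
  refine Summable.of_norm_bounded ha fun n => ?_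
  rw [Real.norm_eq_abs, abs_mul]
  refine mul_le_mul_of_nonneg_left ?_ (abs_nonneg _)
  simpa [gegenbauerConst, norm_eq_of_mem_sphere] using abs_solidGegenbauer_le 1 n (x : Space3)

/-- Abel summation of a series of azimuthal harmonics. -/
theorem tendsto_eLpNorm_azimuthal_series {a : ℕ → ℝ} (hgrowth : PolyGrowth a)
    (ha : Summable fun n => |a n| * ‖azimuthalHarmonic n‖) (e : ℕ) {g : Sphere2 → Space3}
    (hg : g =ᵐ[sphereMeasure] (∑' n, a n • azimuthalHarmonic n : L2Field)) :
    Tendsto (fun s : ℝ => eLpNorm (fun x : Sphere2 =>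
      (∑' n, a n * (s ^ (n + e) * solidGegenbauer 1 n (x : Space3))) • sinAzimuth x - g x)
        2 sphereMeasure) (𝓝[<] 1) (𝓝 0) := by
  have hev : ∀ᶠ s : ℝ in 𝓝[<] 1, s ∈ Set.Ioo (0 : ℝ) 1 := Ioo_mem_nhdsLT (zero_lt_one' ℝ)
  -- Dominated convergence for series, since 0 < s^(n+e) ≤ 1. The offset e is 1 for boundary values,
  -- the field having degree n+1, and 0 for radial derivatives.
  have hlim : Tendsto (fun s : ℝ => (∑' n, (s ^ (n + e) * a n) • azimuthalHarmonic n : L2Field))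
      (𝓝[<] 1) (𝓝 (∑' n, a n • azimuthalHarmonic n)) := by
    refine tendsto_tsum_of_dominated_convergence ha (fun n => ?_) ?_
    · have h : Tendsto (fun s : ℝ => (s ^ (n + e) * a n) • azimuthalHarmonic n) (𝓝 1)
          (𝓝 (((1 : ℝ) ^ (n + e) * a n) • azimuthalHarmonic n)) :=
        Continuous.tendsto (by fun_prop) 1
      rw [one_pow, one_mul] at h
      exact h.mono_left nhdsWithin_le_nhds
    · filter_upwards [hev] with s hs n
      rw [norm_smul, norm_mul, norm_pow, Real.norm_of_nonneg hs.1.le, Real.norm_eq_abs]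
      gcongr
      exact mul_le_of_le_one_left (abs_nonneg _) (pow_le_one₀ hs.1.le hs.2.le)
  have hdist := tendsto_iff_edist_tendsto_0.1 hlim
  refine hdist.congr' ?_
  filter_upwards [hev] with s hs
  rw [Lp.edist_def]
  refine eLpNorm_congr_ae ?_
  have hsum : Summable fun n => |s ^ (n + e) * a n| * ((n : ℝ) + 1) ^ 2 := by
    refine Summable.of_nonneg_of_le (fun n => by positivity) (fun n => ?_)
      (hgrowth.summable 2 hs.1.le hs.2)
    rw [abs_mul, abs_pow, abs_of_pos hs.1]
    calc s ^ (n + e) * |a n| * ((n : ℝ) + 1) ^ 2 ≤ s ^ n * |a n| * ((n : ℝ) + 1) ^ 2 := by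
          have := pow_le_pow_of_le_one hs.1.le hs.2.le (Nat.le_add_right n e)
          gcongr
      _ = _ := by ring
  filter_upwards [azimuthal_series_coe hsum, hg] with x h1 h2
  simp only [Pi.sub_apply]
  rw [h1, h2]
  congr 3
  funext n
  ring

/-- The Dirichlet-to-Neumann operator on series of azimuthal harmonics. -/
theorem isDirichletToNeumann_of_series {a : ℕ → ℝ} (hgrowth : PolyGrowth a)
    (ha : Summable fun n : ℕ => |((n : ℝ) + 1) * a n| * ‖azimuthalHarmonic n‖) {g : Sphere2 → Space3}
    (hg : g =ᵐ[sphereMeasure] (∑' n, a n • azimuthalHarmonic n : L2Field)) :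
    IsDirichletToNeumann g (∑' n : ℕ, (((n : ℝ) + 1) * a n) • azimuthalHarmonic n : L2Field) := by
  have ha0 : Summable fun n => |a n| * ‖azimuthalHarmonic n‖ := by
    refine Summable.of_nonneg_of_le (fun n => by positivity) (fun n => ?_) ha
    rw [abs_mul]
    gcongr
    refine le_mul_of_one_le_left (abs_nonneg _) ?_
    rw [abs_of_nonneg (by positivity)]
    linarith [(Nat.cast_nonneg n : (0 : ℝ) ≤ n)]
  have hgrowth' : PolyGrowth fun n => ((n : ℝ) + 1) * a n := by
    obtain ⟨c, p, h⟩ := hgrowth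
    refine ⟨c, p + 1, fun n => ?_⟩
    rw [abs_mul, abs_of_nonneg (by positivity : (0 : ℝ) ≤ (n : ℝ) + 1), pow_succ]
    have := h n
    calc ((n : ℝ) + 1) * |a n| ≤ ((n : ℝ) + 1) * (c * ((n : ℝ) + 1) ^ p) := by gcongr
      _ = _ := by ring
  have hev : ∀ᶠ s : ℝ in 𝓝[<] 1, s ∈ Set.Ioo (0 : ℝ) 1 := Ioo_mem_nhdsLT (zero_lt_one' ℝ)
  refine ⟨(Lp.memLp _).ae_eq hg.symm, Lp.memLp _, fun y => solidSeries 1 a y • sinAzimuth y,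
    harmonicOnNhd_solidSeries_smul_sinAzimuth hgrowth, ?_, ?_⟩
  · refine (tendsto_eLpNorm_azimuthal_series hgrowth ha0 1 hg).congr fun s => ?_
    congr 1
    funext x
    beta_reduce
    rw [sinAzimuth_smul, smul_smul, mul_comm, mul_solidSeries_smul]
  · refine (tendsto_eLpNorm_azimuthal_series hgrowth' ha 0 (EventuallyEq.refl _ _)).congr' ?_
    filter_upwards [hev] with s hs
    congr 1
    funext x
    have hd := (hasDerivAt_mul_solidSeries_smul hgrowth hs.1.le hs.2
      (norm_eq_of_mem_sphere x)).smul_const (sinAzimuth x)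
    have e : (fun r : ℝ => solidSeries 1 a (r • (x : Space3)) • sinAzimuth (r • (x : Space3))) =
        fun r : ℝ => (r * solidSeries 1 a (r • (x : Space3))) • sinAzimuth x := by
      funext r
      rw [sinAzimuth_smul, smul_smul, mul_comm]
    rw [e, hd.deriv]
    rfl

end ZonalFields

/-! ### The linearized operator on L² series of zonal harmonics. -/

section ZonalSeries

open Polynomial

/-- The normalization constant of the zonal spherical harmonic. -/
noncomputable def zonalConst (l : ℕ) : ℝ := Real.sqrt ((2 * (l : ℝ) + 1) / (4 * Real.pi))

theorem zonalL2_eq (l : ℕ) : zonalL2 l = zonalConst l • zonalLp (legendrePoly l) := by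
  rw [zonalL2, zonalLp, ← map_smul]
  rfl

theorem zonalConst_sq (l : ℕ) : zonalConst l ^ 2 = (2 * (l : ℝ) + 1) / (4 * Real.pi) :=
  Real.sq_sqrt (by positivity)

theorem zonalConst_pos (l : ℕ) : 0 < zonalConst l := Real.sqrt_pos.2 (by positivity)

theorem zonalIntegral_one_nonneg : 0 ≤ zonalIntegral 1 := by
  rw [zonalIntegral_apply]
  exact integral_nonneg fun x => by simp

theorem inner_zonalL2_of_ne {l m : ℕ} (h : l ≠ m) : inner ℝ (zonalL2 l) (zonalL2 m) = 0 := by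
  rw [zonalL2_eq, zonalL2_eq, inner_smul_left, inner_smul_right, inner_zonalLp,
    zonalIntegral_legendrePoly_mul_of_ne h]
  simp

theorem norm_sq_zonalL2 (l : ℕ) : ‖zonalL2 l‖ ^ 2 = zonalIntegral 1 / (4 * Real.pi) := by
  rw [← real_inner_self_eq_norm_sq, zonalL2_eq, inner_smul_left, inner_smul_right, inner_zonalLp,
    ← zonalIntegral_legendrePoly_sq l]
  have h := zonalConst_sq l
  simp only [conj_trivial]
  rw [← mul_assoc, ← sq, h]
  ring

/-- The zonal harmonics are orthogonal with a common norm, so square summability of the coefficients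
suffices. The injection `e` serves for restriction to even degrees. -/
theorem summable_smul_zonalL2_comp {e : ℕ → ℕ} (he : Function.Injective e) {c : ℕ → ℝ}
    (hc : Summable fun l => c l ^ 2) : Summable fun l => c l • zonalL2 (e l) := by
  have hV : OrthogonalFamily ℝ (fun l : ℕ => Submodule.span ℝ {zonalL2 (e l)})
      fun l => (Submodule.span ℝ {zonalL2 (e l)}).subtypeₗᵢ := by
    intro l m hlm x y
    obtain ⟨a, ha⟩ := Submodule.mem_span_singleton.1 x.2
    obtain ⟨b, hb⟩ := Submodule.mem_span_singleton.1 y.2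
    change inner ℝ (x : L2Sphere) (y : L2Sphere) = 0
    rw [← ha, ← hb, inner_smul_left, inner_smul_right, inner_zonalL2_of_ne (he.ne hlm)]
    simp
  refine (hV.summable_iff_norm_sq_summable fun l =>
    ⟨c l • zonalL2 (e l), Submodule.smul_mem _ _ (Submodule.mem_span_singleton_self _)⟩).2 ?_
  refine (hc.mul_right (zonalIntegral 1 / (4 * Real.pi))).congr fun l => ?_
  rw [Submodule.coe_norm, norm_smul, mul_pow, norm_sq_zonalL2, Real.norm_eq_abs, sq_abs]

theorem summable_smul_zonalL2 {c : ℕ → ℝ} (hc : Summable fun l => c l ^ 2) :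
    Summable fun l => c l • zonalL2 l :=
  summable_smul_zonalL2_comp Function.injective_id hc

/-- For a fixed test function both sides of the weak equation are continuous linear functionals on
L², so the equation reduces to single Legendre polynomials. -/
theorem isLaplaceBeltrami_of_series {v : ℕ → ℝ} {u L : L2Sphere}
    (hu : HasSum (fun l => v l • zonalL2 l) u)
    (hL : HasSum (fun l : ℕ => (-((l : ℝ) * (l + 1)) * v l) • zonalL2 l) L) :
    IsLaplaceBeltrami u L := by
  refine ⟨Lp.memLp u, Lp.memLp L, fun f hf => ?_⟩
  set φ : L2Sphere := ContinuousMap.toLp 2 sphereMeasure ℝ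
    ⟨sphereLaplacian f, continuous_sphereLaplacian hf⟩
  set ψ : L2Sphere := ContinuousMap.toLp 2 sphereMeasure ℝ
    ⟨fun x : Sphere2 => f x, hf.continuous.comp continuous_subtype_val⟩
  have hφ : φ =ᵐ[sphereMeasure] sphereLaplacian f := ContinuousMap.coeFn_toLp _ _
  have hψ : ψ =ᵐ[sphereMeasure] fun x : Sphere2 => f x := ContinuousMap.coeFn_toLp _ _
  have e1 : ∀ u : L2Sphere, ∫ x, u x * sphereLaplacian f x ∂sphereMeasure = inner ℝ φ u := by
    intro u
    rw [L2.inner_def]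
    refine integral_congr_ae ?_
    filter_upwards [hφ] with x hx
    simp [hx]
  have e2 : ∀ u : L2Sphere, ∫ x : Sphere2, u x * f x ∂sphereMeasure = inner ℝ ψ u := by
    intro u
    rw [L2.inner_def]
    refine integral_congr_ae ?_
    filter_upwards [hψ] with x hx
    simp [hx]
  have key : ∀ l : ℕ, inner ℝ φ (zonalL2 l) = -((l : ℝ) * (l + 1)) * inner ℝ ψ (zonalL2 l) := by
    intro l
    rw [zonalL2_eq, inner_smul_right, inner_smul_right, ← e1, ← e2, mul_left_comm]
    congr 1
    rw [← integral_const_mul]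
    have h1 : ∫ x, zonalLp (legendrePoly l) x * sphereLaplacian f x ∂sphereMeasure =
        ∫ x : Sphere2, (legendrePoly l).eval ((x : Space3) 2) * sphereLaplacian f x
          ∂sphereMeasure := by
      refine integral_congr_ae ?_
      filter_upwards [zonalLp_coe (legendrePoly l)] with x hx
      rw [hx]
    rw [h1, integral_legendrePoly_mul_sphereLaplacian l hf]
    refine integral_congr_ae ?_
    filter_upwards [zonalLp_coe (legendrePoly l)] with x hx
    rw [hx]
    ring
  rw [e1, e2]
  have s1 := (innerSL ℝ φ).hasSum hu
  have s2 := (innerSL ℝ ψ).hasSum hL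
  refine s1.unique (s2.congr_fun ?_)
  intro l
  simp only [innerSL_apply_apply, inner_smul_right, key]
  ring

/-- The azimuthal harmonics with index shifted by two. -/
noncomputable def azimuthalHarmonicShift : ℕ → L2Field
  | 0 => 0
  | 1 => 0
  | l + 2 => azimuthalHarmonic l

/-- This is (2l+1) P_l = P_{l+1}' - P_{l-1}'. The shifted harmonic stands for P_{l-1}', hence its
value zero for l = 0 and l = 1. -/
theorem smul_azimuthMul_zonalLp_legendrePoly (l : ℕ) :
    (2 * (l : ℝ) + 1) • azimuthMul (zonalLp (legendrePoly l)) =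
      azimuthalHarmonic l - azimuthalHarmonicShift l := by
  rw [azimuthMul_zonalLp, ← azimuthalLp_smul]
  match l with
  | 0 => simp [azimuthalHarmonicShift, azimuthalHarmonic, legendrePoly_zero, legendrePoly_one]
  | 1 =>
    have h := derivative_legendrePoly_add_two 0
    simp only [legendrePoly_zero, derivative_one, zero_add, Nat.cast_zero, mul_zero] at h
    rw [azimuthalHarmonicShift, sub_zero, azimuthalHarmonic, h]
    norm_num
  | l + 2 =>
    have h := derivative_legendrePoly_add_two (l + 1)
    rw [azimuthalHarmonicShift, azimuthalHarmonic, azimuthalHarmonic, ← azimuthalLp_sub, h]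
    congr 1
    push_cast
    ring_nf

theorem azimuthMul_zonalL2 (l : ℕ) :
    azimuthMul (zonalL2 l) = (zonalConst l / (2 * (l : ℝ) + 1)) •
      (azimuthalHarmonic l - azimuthalHarmonicShift l) := by
  rw [zonalL2_eq, map_smul, ← smul_azimuthMul_zonalLp_legendrePoly, smul_smul]
  congr 1
  have : 2 * (l : ℝ) + 1 ≠ 0 := by positivity
  field_simp

/-- Regroups a zonal series by azimuthal harmonics: q = 1 yields the field itself, q n = n+1 its
image under Λ. The truncated l - 2 is harmless since the shifted harmonic vanishes for l < 2. -/
theorem hasSum_azimuthal_sub_shift {b q : ℕ → ℝ}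
    (h1 : Summable fun n => |q n * b n| * ‖azimuthalHarmonic n‖)
    (h2 : Summable fun n => |q n * b (n + 2)| * ‖azimuthalHarmonic n‖) :
    HasSum (fun l => b l • (q l • azimuthalHarmonic l - q (l - 2) • azimuthalHarmonicShift l))
      (∑' n, (q n * (b n - b (n + 2))) • azimuthalHarmonic n) := by
  have s1 : Summable fun n => (q n * b n) • azimuthalHarmonic n :=
    Summable.of_norm_bounded h1 fun n => by rw [norm_smul, Real.norm_eq_abs]
  have s2 : Summable fun n => (q n * b (n + 2)) • azimuthalHarmonic n :=
    Summable.of_norm_bounded h2 fun n => by rw [norm_smul, Real.norm_eq_abs]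
  have s3 : HasSum (fun l => (q (l - 2) * b l) • azimuthalHarmonicShift l)
      (∑' n, (q n * b (n + 2)) • azimuthalHarmonic n) := by
    have h := (hasSum_nat_add_iff (f := fun l => (q (l - 2) * b l) • azimuthalHarmonicShift l)
      2).1 s2.hasSum
    simpa [Finset.sum_range_succ, azimuthalHarmonicShift] using h
  have s4 := s1.hasSum.sub s3
  rw [← s1.tsum_sub s2] at s4
  have e : (fun n => (q n * b n) • azimuthalHarmonic n - (q n * b (n + 2)) • azimuthalHarmonic n) =
      fun n => (q n * (b n - b (n + 2))) • azimuthalHarmonic n := by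
    funext n
    rw [mul_sub, sub_smul]
  rw [e] at s4
  refine s4.congr_fun fun l => ?_
  module

theorem zonalConst_div_sq (l : ℕ) :
    (zonalConst l / (2 * (l : ℝ) + 1)) ^ 2 = 1 / (4 * Real.pi * (2 * (l : ℝ) + 1)) := by
  rw [div_pow, zonalConst_sq]
  have := Real.pi_pos
  field_simp

theorem zonalConst_div_pos (l : ℕ) : 0 < zonalConst l / (2 * (l : ℝ) + 1) :=
  div_pos (zonalConst_pos l) (by positivity)

theorem zonalConst_div_le_one (l : ℕ) : zonalConst l / (2 * (l : ℝ) + 1) ≤ 1 := by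
  have h := zonalConst_div_sq l
  have h1 : 1 / (4 * Real.pi * (2 * (l : ℝ) + 1)) ≤ 1 := by
    rw [div_le_one (by positivity)]
    have := Real.pi_gt_three
    nlinarith [(Nat.cast_nonneg l : (0 : ℝ) ≤ l)]
  rw [← h] at h1
  exact (sq_le_one_iff₀ (zonalConst_div_pos l).le).1 h1

theorem zonalConst_div_add_two_le (l : ℕ) :
    zonalConst (l + 2) / (2 * ((l + 2 : ℕ) : ℝ) + 1) ≤ zonalConst l / (2 * (l : ℝ) + 1) := by
  rw [← sq_le_sq₀ (zonalConst_div_pos _).le (zonalConst_div_pos l).le, zonalConst_div_sq,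
    zonalConst_div_sq]
  push_cast
  gcongr
  linarith

/-- The norm of the azimuthal harmonic grows like √n while the prefactor decays like 1/√n. Thus
summability of (n+1)|v_n| makes all the azimuthal series absolutely convergent. -/
theorem zonalConst_div_mul_norm_azimuthalHarmonic_le (n : ℕ) :
    zonalConst n / (2 * (n : ℝ) + 1) * ‖azimuthalHarmonic n‖ ≤
      Real.sqrt (zonalIntegral 1 / (4 * Real.pi)) := by
  apply Real.le_sqrt_of_sq_le
  rw [mul_pow, zonalConst_div_sq]
  have h := norm_sq_azimuthalHarmonic n
  have h3 : (0 : ℝ) < 2 * (n : ℝ) + 3 := by positivity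
  have h4 : ‖azimuthalHarmonic n‖ ^ 2 = ((n : ℝ) + 1) * ((n : ℝ) + 2) * zonalIntegral 1 /
      (2 * (n : ℝ) + 3) := by
    rw [eq_div_iff h3.ne', mul_comm, h]
  rw [h4]
  have h5 := zonalIntegral_one_nonneg
  have h6 := Real.pi_pos
  have h7 : 1 / (4 * Real.pi * (2 * (n : ℝ) + 1)) * (((n : ℝ) + 1) * ((n : ℝ) + 2) *
      zonalIntegral 1 / (2 * (n : ℝ) + 3)) = zonalIntegral 1 / (4 * Real.pi) *
      ((((n : ℝ) + 1) * ((n : ℝ) + 2)) / ((2 * (n : ℝ) + 1) * (2 * (n : ℝ) + 3))) := by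
    field_simp
  rw [h7]
  refine mul_le_of_le_one_right (by positivity) ?_
  rw [div_le_one (by positivity)]
  nlinarith [(Nat.cast_nonneg n : (0 : ℝ) ≤ n)]

/-- The inequality 2ab ≤ a² + b² with a = (l+1)²|v_l| and b = 1/(l+1). -/
theorem summable_succ_mul_abs {v : ℕ → ℝ} (hv : Summable fun l : ℕ => ((l : ℝ) + 1) ^ 4 * v l ^ 2) :
    Summable fun l : ℕ => ((l : ℝ) + 1) * |v l| := by
  have h2 : Summable fun l : ℕ => 1 / ((l : ℝ) + 1) ^ 2 := by
    have := (summable_nat_add_iff 1).2 (Real.summable_one_div_nat_pow.2 one_lt_two)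
    simpa using this
  refine Summable.of_nonneg_of_le (fun l => by positivity) (fun l => ?_) (hv.add h2)
  have hl : (0 : ℝ) < (l : ℝ) + 1 := by positivity
  have h3 := two_mul_le_add_sq (((l : ℝ) + 1) ^ 2 * |v l|) (1 / ((l : ℝ) + 1))
  have h4 : 2 * (((l : ℝ) + 1) ^ 2 * |v l|) * (1 / ((l : ℝ) + 1)) = 2 * (((l : ℝ) + 1) * |v l|) := by
    field_simp
  rw [h4, mul_pow, sq_abs, ← pow_mul, div_pow, one_pow] at h3
  have h5 : 0 ≤ ((l : ℝ) + 1) * |v l| := by positivity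
  linarith

/-- The action of the linearized operator on `Y_l^0`. -/
noncomputable def linearizedZonal (μ : ℝ) (l : ℕ) : L2Sphere :=
  (2 : ℝ) • azimuthInner (azimuthMul (zonalL2 l)) -
    (zonalConst l / (2 * (l : ℝ) + 1)) • azimuthInner
      (((l : ℝ) + 1) • azimuthalHarmonic l - (((l - 2 : ℕ) : ℝ) + 1) • azimuthalHarmonicShift l) -
    μ • ((2 - (l : ℝ) * (l + 1)) • zonalL2 l)

/-- With b_l = v_l γ_l and a_n = b_n - b_{n+2}, the field u sin θ e_φ is the series with
coefficients a_n and its image under Λ the one with (n+1) a_n. Both regroup into sums over l, and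
bounded operators pass through them, which gives the action term by term. -/
theorem isLinearizedOperator_of_series (μ : ℝ) {v : ℕ → ℝ}
    (hv : Summable fun l : ℕ => ((l : ℝ) + 1) ^ 4 * v l ^ 2) :
    ∃ u w : L2Sphere, HasSum (fun l => v l • zonalL2 l) u ∧ IsLinearizedOperator μ u w ∧
      HasSum (fun l => v l • linearizedZonal μ l) w := by
  have hv1 := summable_succ_mul_abs hv
  have hu : Summable fun l => v l • zonalL2 l := by
    refine summable_smul_zonalL2 (Summable.of_nonneg_of_le (fun l => sq_nonneg _) (fun l => ?_) hv)
    refine le_mul_of_one_le_left (sq_nonneg _) (one_le_pow₀ ?_)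
    linarith [(Nat.cast_nonneg l : (0 : ℝ) ≤ l)]
  have hL : Summable fun l : ℕ => (-((l : ℝ) * (l + 1)) * v l) • zonalL2 l := by
    refine summable_smul_zonalL2 (Summable.of_nonneg_of_le (fun l => sq_nonneg _) (fun l => ?_) hv)
    rw [mul_pow]
    gcongr
    rw [neg_sq, show ((l : ℝ) + 1) ^ 4 = (((l : ℝ) + 1) * ((l : ℝ) + 1)) ^ 2 by ring]
    gcongr
    linarith
  obtain ⟨u, hu⟩ := hu
  obtain ⟨L, hL⟩ := hL
  set γ : ℕ → ℝ := fun l => zonalConst l / (2 * (l : ℝ) + 1) with hγ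
  have hγ0 : ∀ l, 0 ≤ γ l := fun l => (zonalConst_div_pos l).le
  set κ := Real.sqrt (zonalIntegral 1 / (4 * Real.pi)) with hκ
  have hb1 : ∀ n, γ n * ‖azimuthalHarmonic n‖ ≤ κ := zonalConst_div_mul_norm_azimuthalHarmonic_le
  have hb2 : ∀ n, γ (n + 2) * ‖azimuthalHarmonic n‖ ≤ κ := fun n =>
    (mul_le_mul_of_nonneg_right (zonalConst_div_add_two_le n) (norm_nonneg _)).trans (hb1 n)
  set b : ℕ → ℝ := fun l => v l * γ l with hb
  have hs1 : Summable fun n : ℕ => |((n : ℝ) + 1) * b n| * ‖azimuthalHarmonic n‖ := by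
    refine Summable.of_nonneg_of_le (fun n => by positivity) (fun n => ?_) (hv1.mul_right κ)
    rw [abs_mul, abs_of_nonneg (by positivity : (0 : ℝ) ≤ (n : ℝ) + 1), hb, abs_mul,
      abs_of_nonneg (hγ0 n)]
    calc ((n : ℝ) + 1) * (|v n| * γ n) * ‖azimuthalHarmonic n‖ =
        ((n : ℝ) + 1) * |v n| * (γ n * ‖azimuthalHarmonic n‖) := by ring
      _ ≤ _ := by gcongr; exact hb1 n
  have hs2 : Summable fun n : ℕ => |((n : ℝ) + 1) * b (n + 2)| * ‖azimuthalHarmonic n‖ := by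
    refine Summable.of_nonneg_of_le (fun n => by positivity) (fun n => ?_)
      (((summable_nat_add_iff 2).2 hv1).mul_right κ)
    rw [abs_mul, abs_of_nonneg (by positivity : (0 : ℝ) ≤ (n : ℝ) + 1), hb, abs_mul,
      abs_of_nonneg (hγ0 (n + 2))]
    calc ((n : ℝ) + 1) * (|v (n + 2)| * γ (n + 2)) * ‖azimuthalHarmonic n‖ =
        ((n : ℝ) + 1) * |v (n + 2)| * (γ (n + 2) * ‖azimuthalHarmonic n‖) := by ring
      _ ≤ _ := by
        refine mul_le_mul (mul_le_mul_of_nonneg_right ?_ (abs_nonneg _)) (hb2 n)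
          (mul_nonneg (hγ0 _) (norm_nonneg _)) (by positivity)
        push_cast
        linarith
  have hdrop : ∀ (c : ℕ → ℝ), Summable (fun n : ℕ => |((n : ℝ) + 1) * c n| * ‖azimuthalHarmonic n‖) →
      Summable fun n : ℕ => |1 * c n| * ‖azimuthalHarmonic n‖ := by
    intro c hc
    refine Summable.of_nonneg_of_le (fun n => by positivity) (fun n => ?_) hc
    rw [one_mul, abs_mul]
    gcongr
    refine le_mul_of_one_le_left (abs_nonneg _) ?_
    rw [abs_of_nonneg (by positivity)]
    linarith [(Nat.cast_nonneg n : (0 : ℝ) ≤ n)]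
  set a : ℕ → ℝ := fun n => b n - b (n + 2) with ha
  have hS := hasSum_azimuthal_sub_shift (b := b) (q := fun _ => 1) (hdrop _ hs1) (hdrop _ hs2)
  have hG := hasSum_azimuthal_sub_shift (b := b) (q := fun n => (n : ℝ) + 1) hs1 hs2
  set G : L2Field := ∑' n : ℕ, (((n : ℝ) + 1) * a n) • azimuthalHarmonic n with hGdef
  have hMu : azimuthMul u = ∑' n, a n • azimuthalHarmonic n := by
    have h1 := azimuthMul.hasSum hu
    have h2 : (fun l => azimuthMul (v l • zonalL2 l)) = fun l =>
        b l • ((1 : ℝ) • azimuthalHarmonic l - (1 : ℝ) • azimuthalHarmonicShift l) := by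
      funext l
      rw [map_smul, azimuthMul_zonalL2, smul_smul, one_smul, one_smul]
    rw [h2] at h1
    simp only [one_mul] at hS
    exact h1.unique hS
  have hgrowth : PolyGrowth a := by
    refine ⟨2 * ∑' l : ℕ, ((l : ℝ) + 1) * |v l|, 0, fun n => ?_⟩
    have hbn : ∀ n, |b n| ≤ ∑' l : ℕ, ((l : ℝ) + 1) * |v l| := by
      intro n
      refine le_trans ?_ (hv1.le_tsum n fun j _ => by positivity)
      rw [hb, abs_mul, abs_of_nonneg (hγ0 n), mul_comm]
      refine mul_le_mul_of_nonneg_right ((zonalConst_div_le_one n).trans ?_) (abs_nonneg _)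
      linarith [(Nat.cast_nonneg n : (0 : ℝ) ≤ n)]
    rw [pow_zero, mul_one, two_mul]
    exact (abs_sub _ _).trans (add_le_add (hbn n) (hbn (n + 2)))
  have hsum : Summable fun n : ℕ => |((n : ℝ) + 1) * a n| * ‖azimuthalHarmonic n‖ := by
    refine Summable.of_nonneg_of_le (fun n => by positivity) (fun n => ?_) (hs1.add hs2)
    rw [← add_mul]
    gcongr
    rw [ha, mul_sub]
    exact abs_sub _ _
  have hDN : IsDirichletToNeumann (fun x => u x • sinAzimuth x) G := by
    refine isDirichletToNeumann_of_series hgrowth hsum ?_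
    rw [← hMu]
    exact (azimuthMul_coe u).symm
  refine ⟨u, (2 : ℝ) • azimuthInner (azimuthMul u) - azimuthInner G - μ • (L + (2 : ℝ) • u), hu,
    ⟨G, L, hDN, isLaplaceBeltrami_of_series hu hL, ?_⟩, ?_⟩
  · filter_upwards [Lp.coeFn_sub ((2 : ℝ) • azimuthInner (azimuthMul u) - azimuthInner G)
        (μ • (L + (2 : ℝ) • u)), Lp.coeFn_sub ((2 : ℝ) • azimuthInner (azimuthMul u))
        (azimuthInner G), Lp.coeFn_smul (2 : ℝ) (azimuthInner (azimuthMul u)),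
      Lp.coeFn_smul μ (L + (2 : ℝ) • u), Lp.coeFn_add L ((2 : ℝ) • u), Lp.coeFn_smul (2 : ℝ) u,
      azimuthInner_coe (azimuthMul u), azimuthInner_coe G, azimuthMul_coe u]
      with x h1 h2 h3 h4 h5 h6 h7 h8 h9
    rw [h1, Pi.sub_apply, h2, Pi.sub_apply, h3, Pi.smul_apply, h4, Pi.smul_apply, h5, Pi.add_apply,
      h6, Pi.smul_apply, h7, h8, h9, inner_sub_right, inner_smul_right (r := 2)]
    simp only [smul_eq_mul]
  · have t1 := ((azimuthInner.comp azimuthMul).hasSum hu).const_smul (2 : ℝ)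
    have t2 := azimuthInner.hasSum hG
    have t3 := (hL.add (hu.const_smul (2 : ℝ))).const_smul μ
    refine ((t1.sub t2).sub t3).congr_fun fun l => ?_
    simp only [linearizedZonal, ContinuousLinearMap.comp_apply, map_smul, hb]
    module

theorem IsLinearizedOperator.unique {μ : ℝ} {u w₁ w₂ : L2Sphere} (h₁ : IsLinearizedOperator μ u w₁)
    (h₂ : IsLinearizedOperator μ u w₂) : w₁ = w₂ := by
  obtain ⟨G₁, L₁, hG₁, hL₁, hw₁⟩ := h₁
  obtain ⟨G₂, L₂, hG₂, hL₂, hw₂⟩ := h₂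
  refine Lp.ext ?_
  filter_upwards [hw₁, hw₂, hG₁.ae_eq hG₂, hL₁.ae_eq hL₂] with x h1 h2 h3 h4
  rw [h1, h2, h3, h4]

end ZonalSeries

/-! ### Matrix entries, weighted bounds and symmetry. -/

section Tridiagonal

open Polynomial

theorem zonalLp_legendrePoly (n : ℕ) :
    zonalLp (legendrePoly n) = (zonalConst n)⁻¹ • zonalL2 n := by
  rw [zonalL2_eq, inv_smul_smul₀ (zonalConst_pos n).ne']

theorem azimuthInner_azimuthalHarmonic (n : ℕ) :
    azimuthInner (azimuthalHarmonic n) = (((n : ℝ) + 1) * (n + 2) / (2 * n + 3)) •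
      ((zonalConst n)⁻¹ • zonalL2 n - (zonalConst (n + 2))⁻¹ • zonalL2 (n + 2)) := by
  have h := congrArg zonalLp (one_sub_X_sq_mul_derivative_legendrePoly_eq_sub n)
  have h3 : (2 * (n : ℝ) + 3) ≠ 0 := by positivity
  rw [zonalLp_smul, zonalLp_smul, zonalLp_sub, zonalLp_legendrePoly, zonalLp_legendrePoly] at h
  rw [azimuthalHarmonic, azimuthInner_azimuthalLp, ← inv_smul_smul₀ h3 (zonalLp _), h, smul_smul]
  congr 1
  field_simp

theorem zonalConst_mul_inv (l m : ℕ) :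
    zonalConst l * (zonalConst m)⁻¹ = Real.sqrt ((2 * (l : ℝ) + 1) / (2 * m + 1)) := by
  rw [← div_eq_mul_inv, zonalConst, zonalConst, ← Real.sqrt_div (by positivity)]
  congr 1
  have := Real.pi_pos
  field_simp

theorem coeffB_succ_eq_coeffC {k : ℕ} (hk : 1 ≤ k) : coeffB (k + 1) = coeffC k := by
  have hk' : (1 : ℝ) ≤ k := by exact_mod_cast hk
  have h1 : (0 : ℝ) < 4 * k + 1 := by linarith
  have h5 : (0 : ℝ) < 4 * k + 5 := by linarith
  have h3 : (0 : ℝ) < 4 * k + 3 := by linarith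
  simp only [coeffB, coeffC, Nat.cast_add, Nat.cast_one]
  have e1 : (4 * ((k : ℝ) + 1) - 3) / (4 * ((k : ℝ) + 1) + 1) = (4 * k + 1) / (4 * k + 5) := by
    ring_nf
  have e2 : Real.sqrt ((4 * (k : ℝ) + 5) / (4 * k + 1)) =
      ((4 * k + 5) / (4 * k + 1)) * Real.sqrt ((4 * (k : ℝ) + 1) / (4 * k + 5)) := by
    rw [Real.sqrt_eq_iff_mul_self_eq (by positivity) (by positivity), mul_mul_mul_comm,
      Real.mul_self_sqrt (by positivity)]
    field_simp
  rw [e1, e2, show 4 * ((k : ℝ) + 1) - 3 = 4 * k + 1 by ring,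
    show 4 * ((k : ℝ) + 1) - 1 = 4 * k + 3 by ring]
  field_simp
  ring

/-- In row zero of `tridiagonal` the truncated index 0 - 1 = 0 meets this vanishing coefficient. -/
theorem coeffB_zero : coeffB 0 = 0 := by simp [coeffB]

/-- This is column j+1 of the matrix: its entries lie in rows j, j+1 and j+2. For j = 0 the lowest
row is the constant mode, with entry C_0. -/
theorem linearizedZonal_even (μ : ℝ) (j : ℕ) :
    linearizedZonal μ (2 * (j + 1)) = coeffA μ (j + 1) • zonalL2 (2 * (j + 1)) +
      coeffB (j + 1 + 1) • zonalL2 (2 * (j + 1 + 1)) + coeffC j • zonalL2 (2 * j) := by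
  have hj : (0 : ℝ) ≤ j := Nat.cast_nonneg j
  have hz := (zonalConst_pos (2 * j + 2)).ne'
  have h1 : 4 * (j : ℝ) + 1 ≠ 0 := by positivity
  have h3 : 4 * (j : ℝ) + 3 ≠ 0 := by positivity
  have h5 : 4 * (j : ℝ) + 5 ≠ 0 := by positivity
  have h7 : 4 * (j : ℝ) + 7 ≠ 0 := by positivity
  have h9 : 4 * (j : ℝ) + 9 ≠ 0 := by positivity
  -- `r n` is the factor from the inner product with sin θ e_φ. For l = 2j+2 the operator 2 - Λ
  -- contributes 2 - (l+1) = -(2j+1) on Z_l, and -(2 - (l-1)) = 2j-1 on Z_{l-2}, the latter entering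
  -- with a minus sign.
  set r : ℕ → ℝ := fun n => ((n : ℝ) + 1) * (n + 2) / (2 * n + 3) with hr
  set z : ℕ → ℝ := zonalConst with hzdef
  have eA : coeffA μ (j + 1) = z (2 * j + 2) * (z (2 * j + 2))⁻¹ * ((4 * (j : ℝ) + 5)⁻¹ *
      (-(2 * j + 1) * r (2 * j + 2) + (2 * j - 1) * -r (2 * j)))
      - μ * (2 - (2 * j + 2) * (2 * j + 3)) := by
    rw [mul_inv_cancel₀ hz]
    simp only [coeffA, hr]
    push_cast
    rw [show 4 * ((j : ℝ) + 1) + 1 = 4 * j + 5 by ring, show 4 * ((j : ℝ) + 1) - 1 = 4 * j + 3 by ring,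
      show 4 * ((j : ℝ) + 1) + 3 = 4 * j + 7 by ring,
      show 2 * (2 * (j : ℝ) + 2) + 3 = 4 * j + 7 by ring,
      show 2 * (2 * (j : ℝ)) + 3 = 4 * j + 3 by ring]
    field_simp
    ring
  have eB : coeffB (j + 1 + 1) = z (2 * j + 2) * (z (2 * j + 4))⁻¹ * ((4 * (j : ℝ) + 5)⁻¹ *
      (-(2 * j + 1) * -r (2 * j + 2))) := by
    rw [hzdef, zonalConst_mul_inv]
    simp only [coeffB, hr]
    push_cast
    rw [show 4 * ((j : ℝ) + 1 + 1) - 3 = 4 * j + 5 by ring,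
      show 4 * ((j : ℝ) + 1 + 1) + 1 = 4 * j + 9 by ring,
      show 4 * ((j : ℝ) + 1 + 1) - 1 = 4 * j + 7 by ring,
      show 2 * (2 * (j : ℝ) + 2) + 1 = 4 * j + 5 by ring,
      show 2 * (2 * (j : ℝ) + 2) + 3 = 4 * j + 7 by ring,
      show 2 * (2 * (j : ℝ) + 4) + 1 = 4 * j + 9 by ring]
    field_simp
    ring
  have eC : coeffC j = z (2 * j + 2) * (z (2 * j))⁻¹ * ((4 * (j : ℝ) + 5)⁻¹ *
      ((2 * j - 1) * r (2 * j))) := by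
    rw [hzdef, zonalConst_mul_inv]
    simp only [coeffC, hr]
    push_cast
    rw [show 2 * (2 * (j : ℝ) + 2) + 1 = 4 * j + 5 by ring,
      show 2 * (2 * (j : ℝ)) + 3 = 4 * j + 3 by ring,
      show 2 * (2 * (j : ℝ)) + 1 = 4 * j + 1 by ring]
    field_simp
  have hX := azimuthInner_azimuthalHarmonic (2 * j + 2)
  have hX' := azimuthInner_azimuthalHarmonic (2 * j)
  rw [show 2 * (j + 1 + 1) = 2 * j + 2 + 2 by ring, show 2 * (j + 1) = 2 * j + 2 by ring,
    linearizedZonal, azimuthMul_zonalL2]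
  simp only [azimuthalHarmonicShift, map_smul, map_sub, hX, hX', Nat.add_sub_cancel]
  rw [eA, eB, eC]
  simp only [hr, hzdef]
  push_cast
  rw [show 2 * (2 * (j : ℝ) + 2) + 1 = 4 * j + 5 by ring, div_eq_mul_inv (zonalConst (2 * j + 2))]
  module

/-- The extension of a sequence by zero at the index zero. -/
noncomputable def seqExtend (v : ℕ+ → ℝ) (n : ℕ) : ℝ := if h : 0 < n then v (n.toPNat h) else 0

theorem seqExtend_zero (v : ℕ+ → ℝ) : seqExtend v 0 = 0 := by simp [seqExtend]

theorem seqExtend_coe (v : ℕ+ → ℝ) (k : ℕ+) : seqExtend v k = v k := by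
  rw [seqExtend, dif_pos k.pos]
  rfl

theorem seqExtend_add (v w : ℕ+ → ℝ) (n : ℕ) :
    seqExtend (v + w) n = seqExtend v n + seqExtend w n := by
  unfold seqExtend
  split_ifs <;> simp

theorem seqExtend_smul (c : ℝ) (v : ℕ+ → ℝ) (n : ℕ) :
    seqExtend (c • v) n = c * seqExtend v n := by
  unfold seqExtend
  split_ifs <;> simp

theorem hasSum_comp_pnat_iff {E : Type*} [AddCommMonoid E] [TopologicalSpace E] {f : ℕ → E}
    (hf : f 0 = 0) {s : E} : HasSum (fun k : ℕ+ => f k) s ↔ HasSum f s := by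
  refine PNat.coe_injective.hasSum_iff (f := f) fun n hn => ?_
  rcases Nat.eq_zero_or_pos n with rfl | h
  · exact hf
  · exact absurd ⟨⟨n, h⟩, rfl⟩ hn

/-- The tridiagonal matrix acting on sequences indexed by the natural numbers. -/
noncomputable def tridiagonal (μ : ℝ) (x : ℕ → ℝ) (k : ℕ) : ℝ :=
  coeffA μ k * x k + coeffB k * x (k - 1) + coeffC k * x (k + 1)

theorem abs_coeffA_le (μ : ℝ) {k : ℕ} (hk : 1 ≤ k) :
    |coeffA μ k| ≤ (6 * |μ| + 8) * (k : ℝ) ^ 2 := by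
  have h : (1 : ℝ) ≤ k := by exact_mod_cast hk
  simp only [coeffA]
  set t : ℝ := (k : ℝ)
  have hμ := abs_nonneg μ
  have h1 : |μ * (2 * t - 1) * (2 * t + 2)| ≤ 6 * |μ| * t ^ 2 := by
    have h2 : 0 ≤ (2 * t - 1) * (2 * t + 2) := mul_nonneg (by linarith) (by linarith)
    rw [mul_assoc, abs_mul, abs_of_nonneg h2]
    have h3 : (2 * t - 1) * (2 * t + 2) ≤ 6 * t ^ 2 := by nlinarith
    linarith [mul_le_mul_of_nonneg_left h3 hμ]
  have h2 : |2 * t * (2 * t - 3) * (2 * t - 1) / ((4 * t + 1) * (4 * t - 1))| ≤ 2 * t ^ 2 := by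
    have hp : 0 < (4 * t + 1) * (4 * t - 1) := mul_pos (by linarith) (by linarith)
    rw [abs_div, abs_of_pos hp, div_le_iff₀ hp, abs_mul, abs_mul, abs_of_nonneg (by linarith),
      abs_of_nonneg (by linarith : 0 ≤ 2 * t - 1)]
    have h3 : |2 * t - 3| ≤ 4 * t + 1 := abs_le.2 ⟨by linarith, by linarith⟩
    calc 2 * t * |2 * t - 3| * (2 * t - 1) ≤ 2 * t ^ 2 * (4 * t + 1) * (4 * t - 1) := by
          gcongr <;> nlinarith
      _ = _ := by ring
  have h3 : |(2 * t - 1) * (2 * t + 1) * (2 * t + 2) / ((4 * t + 1) * (4 * t + 3))| ≤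
      4 * t ^ 2 := by
    have hp : 0 < (4 * t + 1) * (4 * t + 3) := mul_pos (by linarith) (by linarith)
    have hq : 0 ≤ 2 * t - 1 := by linarith
    rw [abs_of_nonneg (by positivity), div_le_iff₀ hp]
    calc (2 * t - 1) * (2 * t + 1) * (2 * t + 2) ≤ (4 * t + 1) * (4 * t + 3) * (4 * t ^ 2) := by
          gcongr <;> nlinarith
      _ = _ := by ring
  have h4 := abs_sub (μ * (2 * t - 1) * (2 * t + 2)
    - 2 * t * (2 * t - 3) * (2 * t - 1) / ((4 * t + 1) * (4 * t - 1)))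
    ((2 * t - 1) * (2 * t + 1) * (2 * t + 2) / ((4 * t + 1) * (4 * t + 3)))
  have h5 := abs_sub (μ * (2 * t - 1) * (2 * t + 2))
    (2 * t * (2 * t - 3) * (2 * t - 1) / ((4 * t + 1) * (4 * t - 1)))
  nlinarith [sq_nonneg t]

theorem abs_coeffC_le {k : ℕ} (hk : 1 ≤ k) : |coeffC k| ≤ 8 * (k : ℝ) ^ 2 := by
  have h : (1 : ℝ) ≤ k := by exact_mod_cast hk
  simp only [coeffC]
  set t : ℝ := (k : ℝ)
  have hq : 0 ≤ 2 * t - 1 := by linarith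
  have hp : 0 < (4 * t + 3) * (4 * t + 5) := by positivity
  have h1 : (2 * t - 1) * (2 * t + 1) * (2 * t + 2) / ((4 * t + 3) * (4 * t + 5)) ≤ 4 * t ^ 2 := by
    rw [div_le_iff₀ hp]
    calc (2 * t - 1) * (2 * t + 1) * (2 * t + 2) ≤ (4 * t + 3) * (4 * t + 5) * (4 * t ^ 2) := by
          gcongr <;> nlinarith
      _ = _ := by ring
  have h2 : Real.sqrt ((4 * t + 5) / (4 * t + 1)) ≤ 2 := by
    rw [Real.sqrt_le_left (by norm_num), div_le_iff₀ (by linarith)]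
    linarith
  rw [abs_of_nonneg (by positivity)]
  calc _ ≤ 4 * t ^ 2 * 2 := mul_le_mul h1 h2 (Real.sqrt_nonneg _) (by positivity)
    _ = _ := by ring

theorem abs_coeffB_le {k : ℕ} (hk : 1 ≤ k) : |coeffB k| ≤ 8 * (k : ℝ) ^ 2 := by
  have h : (1 : ℝ) ≤ k := by exact_mod_cast hk
  simp only [coeffB]
  set t : ℝ := (k : ℝ)
  have hp : 0 < (4 * t - 3) * (4 * t - 1) := mul_pos (by linarith) (by linarith)
  have h1 : |2 * t * (2 * t - 3) * (2 * t - 1) / ((4 * t - 3) * (4 * t - 1))| ≤ 2 * t ^ 2 := by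
    rw [abs_div, abs_of_pos hp, div_le_iff₀ hp, abs_mul, abs_mul, abs_of_nonneg (by linarith),
      abs_of_nonneg (by linarith : 0 ≤ 2 * t - 1)]
    have h3 : |2 * t - 3| ≤ 4 * t - 3 := abs_le.2 ⟨by linarith, by linarith⟩
    have h4 : 0 ≤ 4 * t - 3 := by linarith
    calc 2 * t * |2 * t - 3| * (2 * t - 1) ≤ 2 * t ^ 2 * (4 * t - 3) * (4 * t - 1) := by
          gcongr <;> nlinarith
      _ = _ := by ring
  have h2 : Real.sqrt ((4 * t - 3) / (4 * t + 1)) ≤ 2 := by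
    rw [Real.sqrt_le_left (by norm_num), div_le_iff₀ (by linarith)]
    linarith
  rw [abs_mul, abs_of_nonneg (Real.sqrt_nonneg _)]
  have := mul_le_mul h1 h2 (Real.sqrt_nonneg _) (by positivity)
  nlinarith [sq_nonneg t]

/-- A coefficient of size k² costs two orders of weight, and k ≤ 2i allows the weight to be moved to
a neighbouring index i ∈ {k-1, k, k+1}. The exception k = 1, i = 0 is covered by y = 0. -/
theorem weighted_mul_sq_le {α : ℝ} (hα : 0 ≤ α) {k i : ℕ} (hk : 1 ≤ k) (hki : i = 0 ∨ k ≤ 2 * i)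
    {c M y : ℝ} (hc : |c| ≤ M * (k : ℝ) ^ 2) (hy : i = 0 → y = 0) :
    (k : ℝ) ^ (2 * α) * (c * y) ^ 2 ≤
      M ^ 2 * (2 : ℝ) ^ (2 * (α + 2)) * ((i : ℝ) ^ (2 * (α + 2)) * y ^ 2) := by
  by_cases hi : i = 0
  · rw [hy hi]
    simp
  have hki := hki.resolve_left hi
  have hk0 : (0 : ℝ) < k := by exact_mod_cast hk
  have h1 : c ^ 2 ≤ M ^ 2 * (k : ℝ) ^ 4 := by
    rw [← sq_abs c, show M ^ 2 * (k : ℝ) ^ 4 = (M * (k : ℝ) ^ 2) ^ 2 by ring]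
    gcongr
  have h2 : (k : ℝ) ^ (2 * α) * (k : ℝ) ^ 4 = (k : ℝ) ^ (2 * (α + 2)) := by
    rw [← Real.rpow_natCast (k : ℝ) 4, ← Real.rpow_add hk0]
    congr 1
    push_cast
    ring
  have h3 : (k : ℝ) ^ (2 * (α + 2)) ≤ (2 : ℝ) ^ (2 * (α + 2)) * (i : ℝ) ^ (2 * (α + 2)) := by
    rw [← Real.mul_rpow (by norm_num) (Nat.cast_nonneg i)]
    exact Real.rpow_le_rpow hk0.le (by exact_mod_cast hki) (by linarith)
  calc (k : ℝ) ^ (2 * α) * (c * y) ^ 2 = (k : ℝ) ^ (2 * α) * c ^ 2 * y ^ 2 := by ring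
    _ ≤ (k : ℝ) ^ (2 * α) * (M ^ 2 * (k : ℝ) ^ 4) * y ^ 2 := by gcongr
    _ = M ^ 2 * (k : ℝ) ^ (2 * (α + 2)) * y ^ 2 := by rw [← h2]; ring
    _ ≤ M ^ 2 * ((2 : ℝ) ^ (2 * (α + 2)) * (i : ℝ) ^ (2 * (α + 2))) * y ^ 2 := by gcongr
    _ = _ := by ring

theorem one_le_natCast_rpow {α : ℝ} (hα : 0 ≤ α) {k : ℕ} (hk : 1 ≤ k) :
    1 ≤ (k : ℝ) ^ (2 * α) :=
  Real.one_le_rpow (by exact_mod_cast hk) (by linarith)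

theorem mul_sq_le {α : ℝ} (hα : 0 ≤ α) {k i : ℕ} (hk : 1 ≤ k) (hki : i = 0 ∨ k ≤ 2 * i)
    {c M y : ℝ} (hc : |c| ≤ M * (k : ℝ) ^ 2) (hy : i = 0 → y = 0) :
    (c * y) ^ 2 ≤ M ^ 2 * (2 : ℝ) ^ (2 * (α + 2)) * ((i : ℝ) ^ (2 * (α + 2)) * y ^ 2) :=
  (le_mul_of_one_le_left (sq_nonneg _) (one_le_natCast_rpow hα hk)).trans
    (weighted_mul_sq_le hα hk hki hc hy)

section Weighted

variable {α : ℝ} {x : ℕ → ℝ}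

theorem summable_coeffA_mul_sq (hα : 0 ≤ α) (μ : ℝ)
    (hx : Summable fun n : ℕ => (n : ℝ) ^ (2 * (α + 2)) * x n ^ 2) :
    Summable fun k => (coeffA μ k * x k) ^ 2 := by
  refine (summable_nat_add_iff 1).1 ?_
  refine Summable.of_nonneg_of_le (fun k => sq_nonneg _) (fun k => ?_)
    (((summable_nat_add_iff 1).2 hx).mul_left ((6 * |μ| + 8) ^ 2 * (2 : ℝ) ^ (2 * (α + 2))))
  exact mul_sq_le hα (by omega) (by omega) (abs_coeffA_le μ (by omega)) (by omega)

theorem summable_coeffB_mul_sq (hα : 0 ≤ α) (hx0 : x 0 = 0)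
    (hx : Summable fun n : ℕ => (n : ℝ) ^ (2 * (α + 2)) * x n ^ 2) :
    Summable fun k => (coeffB k * x (k - 1)) ^ 2 := by
  refine (summable_nat_add_iff 1).1 ?_
  refine Summable.of_nonneg_of_le (fun k => sq_nonneg _) (fun k => ?_)
    (hx.mul_left (8 ^ 2 * (2 : ℝ) ^ (2 * (α + 2))))
  rw [Nat.add_sub_cancel]
  exact mul_sq_le hα (by omega) (by omega) (abs_coeffB_le (by omega)) fun h => h ▸ hx0

theorem summable_coeffC_mul_sq (hα : 0 ≤ α)
    (hx : Summable fun n : ℕ => (n : ℝ) ^ (2 * (α + 2)) * x n ^ 2) :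
    Summable fun k => (coeffC k * x (k + 1)) ^ 2 := by
  refine (summable_nat_add_iff 1).1 ?_
  refine Summable.of_nonneg_of_le (fun k => sq_nonneg _) (fun k => ?_)
    (((summable_nat_add_iff 2).2 hx).mul_left (8 ^ 2 * (2 : ℝ) ^ (2 * (α + 2))))
  exact mul_sq_le hα (by omega) (by omega) (abs_coeffC_le (by omega)) (by omega)

theorem summable_sq_of_weighted (hα : 0 ≤ α) (hx0 : x 0 = 0)
    (hx : Summable fun n : ℕ => (n : ℝ) ^ (2 * (α + 2)) * x n ^ 2) :
    Summable fun k => x k ^ 2 := by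
  refine Summable.of_nonneg_of_le (fun k => sq_nonneg _) (fun k => ?_) hx
  rcases Nat.eq_zero_or_pos k with rfl | h
  · rw [hx0]
    simp
  · exact le_mul_of_one_le_left (sq_nonneg _) (one_le_natCast_rpow (by linarith) h)

/-- The sequence is placed on the even degrees and the series of columns is regrouped into rows. Row
zero is included and carries the constant mode. -/
theorem exists_isLinearizedOperator_hasSum_tridiagonal (hα : 0 ≤ α) (μ : ℝ) (hx0 : x 0 = 0)
    (hx : Summable fun n : ℕ => (n : ℝ) ^ (2 * (α + 2)) * x n ^ 2) :
    ∃ u w : L2Sphere, HasSum (fun k => x k • zonalL2 (2 * k)) u ∧ IsLinearizedOperator μ u w ∧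
      HasSum (fun k => tridiagonal μ x k • zonalL2 (2 * k)) w := by
  have hinj : Function.Injective fun k : ℕ => 2 * k := fun a b h => by
    simp only at h
    omega
  set y : ℕ → ℝ := Function.extend (fun k : ℕ => 2 * k) x (0 : ℕ → ℝ)
  have hy1 : ∀ k, y (2 * k) = x k := fun k => hinj.extend_apply x (0 : ℕ → ℝ) k
  have hy2 : ∀ l, l ∉ Set.range (fun k : ℕ => 2 * k) → y l = 0 := fun l hl =>
    Function.extend_apply' x (0 : ℕ → ℝ) l hl
  have hys : Summable fun l : ℕ => ((l : ℝ) + 1) ^ 4 * y l ^ 2 := by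
    refine (hinj.summable_iff (f := fun l : ℕ => ((l : ℝ) + 1) ^ 4 * y l ^ 2)
      fun l hl => by simp [hy2 l hl]).1 ?_
    refine (summable_nat_add_iff 1).1 ?_
    refine Summable.of_nonneg_of_le (fun k => mul_nonneg (pow_nonneg (by positivity) 4) (sq_nonneg _))
      (fun k => ?_) (((summable_nat_add_iff 1).2 hx).mul_left (9 ^ 2 * (2 : ℝ) ^ (2 * (α + 2))))
    -- The weight (l+1)⁴ at l = 2m is the square of (2m+1)², and (2m+1)² ≤ 9m² for m ≥ 1.
    have h := mul_sq_le (k := k + 1) (i := k + 1) (c := (2 * ((k + 1 : ℕ) : ℝ) + 1) ^ 2) (M := 9)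
      (y := x (k + 1)) hα (by omega) (by omega) ?_ (by omega)
    · refine le_trans (le_of_eq ?_) h
      simp only [Function.comp_apply, hy1]
      push_cast
      ring
    · rw [abs_of_nonneg (by positivity)]
      push_cast
      nlinarith [(Nat.cast_nonneg k : (0 : ℝ) ≤ k)]
  obtain ⟨u, w, hu, hw, hs⟩ := isLinearizedOperator_of_series μ hys
  rw [← hinj.hasSum_iff fun l hl => by simp [hy2 l hl]] at hu hs
  simp only [Function.comp_def, hy1] at hu hs
  refine ⟨u, w, hu, hw, ?_⟩
  obtain ⟨a, ha⟩ := summable_smul_zonalL2_comp hinj (summable_coeffA_mul_sq hα μ hx)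
  obtain ⟨b, hb⟩ := summable_smul_zonalL2_comp hinj (summable_coeffB_mul_sq hα hx0 hx)
  obtain ⟨c, hc⟩ := summable_smul_zonalL2_comp hinj (summable_coeffC_mul_sq hα hx)
  -- Index shifts turn the row sums of B and C into column sums; the terms gained or lost at index
  -- zero vanish because B_0 = 0 and x_0 = 0.
  have hb' : HasSum (fun k => (coeffB (k + 1) * x k) • zonalL2 (2 * (k + 1))) b := by
    have h := (hasSum_nat_add_iff' 1).2 hb
    simpa [coeffB_zero] using h
  have hc' : HasSum (fun k => (coeffC (k - 1) * x k) • zonalL2 (2 * (k - 1))) c := by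
    have h := (hasSum_nat_add_iff
      (f := fun k => (coeffC (k - 1) * x k) • zonalL2 (2 * (k - 1))) 1).1 hc
    simpa [hx0] using h
  have h1 : HasSum (fun k => x k • linearizedZonal μ (2 * k)) (a + b + c) := by
    refine ((ha.add hb').add hc').congr_fun fun k => ?_
    rcases k with _ | j
    · simp [hx0]
    · rw [linearizedZonal_even, Nat.add_sub_cancel]
      module
  rw [hs.unique h1]
  refine ((ha.add hb).add hc).congr_fun fun k => ?_
  rw [tridiagonal]
  module

theorem weighted_tridiagonal_sq_le (hα : 0 ≤ α) (μ : ℝ) (hx0 : x 0 = 0) (j : ℕ) :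
    ((j + 1 : ℕ) : ℝ) ^ (2 * α) * tridiagonal μ x (j + 1) ^ 2 ≤
      3 * ((6 * |μ| + 8) ^ 2 * (2 : ℝ) ^ (2 * (α + 2))) *
        (((j + 1 : ℕ) : ℝ) ^ (2 * (α + 2)) * x (j + 1) ^ 2 + (j : ℝ) ^ (2 * (α + 2)) * x j ^ 2 +
          ((j + 2 : ℕ) : ℝ) ^ (2 * (α + 2)) * x (j + 2) ^ 2) := by
  have hM : (8 : ℝ) ≤ 6 * |μ| + 8 := by linarith [abs_nonneg μ]
  have hk : 1 ≤ j + 1 := by omega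
  have hM' : 8 * ((j + 1 : ℕ) : ℝ) ^ 2 ≤ (6 * |μ| + 8) * ((j + 1 : ℕ) : ℝ) ^ 2 := by gcongr
  have h1 := weighted_mul_sq_le (i := j + 1) (y := x (j + 1)) hα hk (by omega)
    (abs_coeffA_le μ hk) (by omega)
  have h2 := weighted_mul_sq_le (i := j) (y := x j) hα hk (by omega)
    ((abs_coeffB_le hk).trans hM') fun h => h ▸ hx0
  have h3 := weighted_mul_sq_le (i := j + 2) (y := x (j + 2)) hα hk (by omega)
    ((abs_coeffC_le hk).trans hM') (by omega)
  have h4 : tridiagonal μ x (j + 1) ^ 2 ≤ 3 * ((coeffA μ (j + 1) * x (j + 1)) ^ 2 +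
      (coeffB (j + 1) * x j) ^ 2 + (coeffC (j + 1) * x (j + 2)) ^ 2) := by
    rw [tridiagonal, Nat.add_sub_cancel]
    nlinarith [sq_nonneg (coeffA μ (j + 1) * x (j + 1) - coeffB (j + 1) * x j),
      sq_nonneg (coeffA μ (j + 1) * x (j + 1) - coeffC (j + 1) * x (j + 2)),
      sq_nonneg (coeffB (j + 1) * x j - coeffC (j + 1) * x (j + 2))]
  have h5 := mul_le_mul_of_nonneg_left h4
    (by positivity : (0 : ℝ) ≤ ((j + 1 : ℕ) : ℝ) ^ (2 * α))
  linarith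

/-- In the constant 9, one factor 3 comes from (a+b+c)² ≤ 3(a²+b²+c²), the other from three shifted
copies of the series, each at most the full sum. -/
theorem weighted_tsum_tridiagonal_le (hα : 0 ≤ α) (μ : ℝ) (hx0 : x 0 = 0)
    (hx : Summable fun n : ℕ => (n : ℝ) ^ (2 * (α + 2)) * x n ^ 2) :
    (Summable fun j : ℕ => ((j + 1 : ℕ) : ℝ) ^ (2 * α) * tridiagonal μ x (j + 1) ^ 2) ∧
      ∑' j : ℕ, ((j + 1 : ℕ) : ℝ) ^ (2 * α) * tridiagonal μ x (j + 1) ^ 2 ≤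
        9 * ((6 * |μ| + 8) ^ 2 * (2 : ℝ) ^ (2 * (α + 2))) *
          ∑' n : ℕ, (n : ℝ) ^ (2 * (α + 2)) * x n ^ 2 := by
  have hS := hx.hasSum
  set S := ∑' n : ℕ, (n : ℝ) ^ (2 * (α + 2)) * x n ^ 2
  set D := (6 * |μ| + 8) ^ 2 * (2 : ℝ) ^ (2 * (α + 2)) with hD
  have hD0 : 0 ≤ D := by positivity
  have h1 := (hasSum_nat_add_iff' 1).2 hS
  have h2 := (hasSum_nat_add_iff' 2).2 hS
  have h3 := ((h1.add hS).add h2).mul_left (3 * D)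
  have hle := weighted_tridiagonal_sq_le hα μ hx0
  have hs := Summable.of_nonneg_of_le (fun j => by positivity) hle h3.summable
  refine ⟨hs, (hasSum_le hle hs.hasSum h3).trans ?_⟩
  have p : ∀ m, 0 ≤ ∑ i ∈ Finset.range m, (i : ℝ) ^ (2 * (α + 2)) * x i ^ 2 := fun m =>
    Finset.sum_nonneg fun i _ => by positivity
  nlinarith [p 1, p 2, mul_nonneg hD0 (p 1), mul_nonneg hD0 (p 2)]

end Weighted

theorem summable_mul_of_sq {ι : Type*} {f g : ι → ℝ} (hf : Summable fun i => f i ^ 2)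
    (hg : Summable fun i => g i ^ 2) : Summable fun i => f i * g i := by
  refine Summable.of_norm_bounded (hf.add hg) fun i => ?_
  rw [Real.norm_eq_abs, abs_mul, ← sq_abs (f i), ← sq_abs (g i)]
  nlinarith [sq_nonneg (|f i| - |g i|), sq_nonneg (|f i| + |g i|)]

/-- Shifting the index turns the B-sum into a C-sum. Exchanging x and y in the resulting value
merely swaps the last two sums, which is the symmetry of the operator. -/
theorem hasSum_tridiagonal_mul {α : ℝ} (hα : 0 ≤ α) (μ : ℝ) {x y : ℕ → ℝ} (hx0 : x 0 = 0)
    (hy0 : y 0 = 0) (hx : Summable fun n : ℕ => (n : ℝ) ^ (2 * (α + 2)) * x n ^ 2)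
    (hy : Summable fun n : ℕ => (n : ℝ) ^ (2 * (α + 2)) * y n ^ 2) :
    HasSum (fun k => tridiagonal μ x k * y k) (∑' k, coeffA μ k * (x k * y k) +
      (∑' k, coeffC k * (y (k + 1) * x k) + ∑' k, coeffC k * (x (k + 1) * y k))) := by
  have hsx := summable_sq_of_weighted hα hx0 hx
  have hsy := summable_sq_of_weighted hα hy0 hy
  have h1 : Summable fun k => coeffA μ k * (x k * y k) :=
    (summable_mul_of_sq (summable_coeffA_mul_sq hα μ hx) hsy).congr fun k => by ring
  have h2 : Summable fun k => coeffC k * (y (k + 1) * x k) :=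
    (summable_mul_of_sq (summable_coeffC_mul_sq hα hy) hsx).congr fun k => by ring
  have h3 : Summable fun k => coeffC k * (x (k + 1) * y k) :=
    (summable_mul_of_sq (summable_coeffC_mul_sq hα hx) hsy).congr fun k => by ring
  have h4 : HasSum (fun k => coeffB k * (x (k - 1) * y k))
      (∑' k, coeffC k * (y (k + 1) * x k)) := by
    refine (hasSum_nat_add_iff' 1).1 ?_
    simp only [Finset.sum_range_one, coeffB_zero, zero_mul, sub_zero]
    refine h2.hasSum.congr_fun fun k => ?_
    rcases Nat.eq_zero_or_pos k with rfl | hk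
    · simp [hx0]
    · rw [coeffB_succ_eq_coeffC hk, Nat.add_sub_cancel]
      ring
  refine (h1.hasSum.add (h4.add h3.hasSum)).congr_fun fun k => ?_
  rw [tridiagonal]
  ring

theorem summable_seqExtend {α : ℝ} (v : SeqSpace α) :
    Summable fun n : ℕ => (n : ℝ) ^ (2 * α) * seqExtend v.1 n ^ 2 := by
  obtain ⟨s, hs⟩ : Summable fun k : ℕ+ => (k : ℝ) ^ (2 * α) * v.1 k ^ 2 := v.2
  refine ⟨s, (hasSum_comp_pnat_iff (by simp [seqExtend_zero])).1 (hs.congr_fun fun k => ?_)⟩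
  rw [seqExtend_coe]

end Tridiagonal

/-! ### The bounded symmetric operator between the sequence spaces. -/

section LinearizedSequences

/-- The linearized operator on the sequence spaces. -/
noncomputable def linearizedSeq {α : ℝ} (hα : 0 ≤ α) (μ : ℝ) :
    SeqSpace (α + 2) →ₗ[ℝ] SeqSpace α where
  toFun v := ⟨fun k => tridiagonal μ (seqExtend v.1) k,
    summable_pnat_iff_summable_succ
      (f := fun k : ℕ => (k : ℝ) ^ (2 * α) * tridiagonal μ (seqExtend v.1) k ^ 2) |>.2
      (weighted_tsum_tridiagonal_le hα μ (seqExtend_zero _) (summable_seqExtend v)).1⟩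
  map_add' v w := by
    refine Subtype.ext (funext fun k => ?_)
    simp only [tridiagonal, Submodule.coe_add, seqExtend_add, Pi.add_apply]
    ring
  map_smul' c v := by
    refine Subtype.ext (funext fun k => ?_)
    simp only [tridiagonal, Submodule.coe_smul, seqExtend_smul, Pi.smul_apply, RingHom.id_apply,
      smul_eq_mul]
    ring

theorem linearizedSeq_apply {α : ℝ} (hα : 0 ≤ α) (μ : ℝ) (v : SeqSpace (α + 2)) (k : ℕ+) :
    (linearizedSeq hα μ v).1 k = tridiagonal μ (seqExtend v.1) k := rfl

theorem seqNorm_linearizedSeq_le {α : ℝ} (hα : 0 ≤ α) (μ : ℝ) (v : SeqSpace (α + 2)) :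
    seqNorm α (linearizedSeq hα μ v) ≤
      Real.sqrt (9 * ((6 * |μ| + 8) ^ 2 * (2 : ℝ) ^ (2 * (α + 2)))) * seqNorm (α + 2) v := by
  have h := (weighted_tsum_tridiagonal_le hα μ (seqExtend_zero v.1) (summable_seqExtend v)).2
  have e1 : ∑' k : ℕ+, (k : ℝ) ^ (2 * α) * (linearizedSeq hα μ v).1 k ^ 2 =
      ∑' j : ℕ, ((j + 1 : ℕ) : ℝ) ^ (2 * α) * tridiagonal μ (seqExtend v.1) (j + 1) ^ 2 :=
    tsum_pnat_eq_tsum_succ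
      (f := fun k : ℕ => (k : ℝ) ^ (2 * α) * tridiagonal μ (seqExtend v.1) k ^ 2)
  have e2 : ∑' k : ℕ+, (k : ℝ) ^ (2 * (α + 2)) * v.1 k ^ 2 =
      ∑' n : ℕ, (n : ℝ) ^ (2 * (α + 2)) * seqExtend v.1 n ^ 2 := by
    have h := (hasSum_comp_pnat_iff (by simp [seqExtend_zero])).2 (summable_seqExtend v).hasSum
    simp only [seqExtend_coe] at h
    exact h.tsum_eq
  rw [seqNorm, seqNorm, e1, e2, ← Real.sqrt_mul (by positivity)]
  exact Real.sqrt_le_sqrt h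

theorem hasSum_linearizedSeq_mul {α : ℝ} (hα : 0 ≤ α) (μ : ℝ) (v w : SeqSpace (α + 2)) :
    HasSum (fun k : ℕ+ => (linearizedSeq hα μ v).1 k * w.1 k)
      (∑' k, coeffA μ k * (seqExtend v.1 k * seqExtend w.1 k) +
        (∑' k, coeffC k * (seqExtend w.1 (k + 1) * seqExtend v.1 k) +
          ∑' k, coeffC k * (seqExtend v.1 (k + 1) * seqExtend w.1 k))) := by
  have h := (hasSum_comp_pnat_iff (by simp [seqExtend_zero])).2
    (hasSum_tridiagonal_mul hα μ (seqExtend_zero v.1) (seqExtend_zero w.1) (summable_seqExtend v)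
      (summable_seqExtend w))
  refine h.congr_fun fun k => ?_
  rw [linearizedSeq_apply, seqExtend_coe]

end LinearizedSequences

theorem mainTheorem5 (α : ℝ) (hα : 0 ≤ α) (μ : ℝ) :
    ∃ T : SeqSpace (α + 2) →ₗ[ℝ] SeqSpace α,
      -- `T` is the operator `𝒜(μ)` in the basis `Y_{2k}^0`
      (∀ v : SeqSpace (α + 2), ∃ u w : L2Sphere,
        HasSum (fun k : ℕ+ => v.1 k • zonalL2 (2 * (k : ℕ))) u ∧
        (∀ w' : L2Sphere, IsLinearizedOperator μ u w' ↔ w' = w) ∧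
        HasSum (fun k : ℕ+ => (T v).1 k • zonalL2 (2 * (k : ℕ)))
          (w - (coeffC 0 * v.1 1) • zonalL2 0)) ∧
      -- the matrix entries
      (∀ v : SeqSpace (α + 2),
        (T v).1 1 = coeffA μ 1 * v.1 1 + coeffC 1 * v.1 2) ∧
      (∀ (v : SeqSpace (α + 2)) (k : ℕ+),
        (T v).1 (k + 1) =
          coeffA μ ((k : ℕ) + 1) * v.1 (k + 1) + coeffB ((k : ℕ) + 1) * v.1 k
            + coeffC ((k : ℕ) + 1) * v.1 (k + 2)) ∧
      -- boundedness and symmetry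
      (∃ K : ℝ, ∀ v : SeqSpace (α + 2), seqNorm α (T v) ≤ K * seqNorm (α + 2) v) ∧
      (∀ k : ℕ, 1 ≤ k → coeffB (k + 1) = coeffC k) ∧
      (∀ v w : SeqSpace (α + 2),
        Summable (fun k : ℕ+ => (T v).1 k * w.1 k) ∧
        Summable (fun k : ℕ+ => v.1 k * (T w).1 k) ∧
        ∑' k : ℕ+, (T v).1 k * w.1 k = ∑' k : ℕ+, v.1 k * (T w).1 k) := by
  refine ⟨linearizedSeq hα μ, fun v => ?_, fun v => ?_, fun v k => ?_,
    ⟨_, seqNorm_linearizedSeq_le hα μ⟩, fun k hk => coeffB_succ_eq_coeffC hk, fun v w => ?_⟩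
  · obtain ⟨u, w, hu, hw, hs⟩ := exists_isLinearizedOperator_hasSum_tridiagonal hα μ
      (seqExtend_zero v.1) (summable_seqExtend v)
    refine ⟨u, w, ?_, fun w' => ⟨fun h => h.unique hw, fun h => h ▸ hw⟩, ?_⟩
    · have h := (hasSum_comp_pnat_iff (by simp [seqExtend_zero])).2 hu
      simpa only [seqExtend_coe] using h
    -- Dropping row zero subtracts exactly the constant mode C_0 v_1 Y_0^0; the remaining rows are
    -- reindexed by the positive integers.
    · have h := (hasSum_nat_add_iff' 1).2 hs
      have e : tridiagonal μ (seqExtend v.1) 0 = coeffC 0 * v.1 1 := by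
        rw [tridiagonal, seqExtend_zero, coeffB_zero, zero_mul, mul_zero, zero_add, zero_add,
          zero_add]
        exact congrArg _ (seqExtend_coe v.1 1)
      rw [Finset.sum_range_one, e] at h
      exact (Equiv.pnatEquivNat.symm.hasSum_iff (f := fun k : ℕ+ =>
        (linearizedSeq hα μ v).1 k • zonalL2 (2 * (k : ℕ)))).1 h
  · have h1 := seqExtend_coe v.1 1
    have h2 := seqExtend_coe v.1 2
    rw [PNat.one_coe] at h1
    rw [show ((2 : ℕ+) : ℕ) = 1 + 1 from rfl] at h2
    rw [linearizedSeq_apply, tridiagonal, PNat.one_coe, Nat.sub_self, seqExtend_zero, h1, h2]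
    ring
  · have h1 := seqExtend_coe v.1 (k + 1)
    have h2 := seqExtend_coe v.1 (k + 2)
    rw [PNat.add_coe, PNat.one_coe] at h1
    rw [PNat.add_coe, show ((2 : ℕ+) : ℕ) = 1 + 1 from rfl, ← add_assoc] at h2
    rw [linearizedSeq_apply, tridiagonal, PNat.add_coe, PNat.one_coe, Nat.add_sub_cancel, h1, h2,
      seqExtend_coe]
  · have h1 := hasSum_linearizedSeq_mul hα μ v w
    have h2 := hasSum_linearizedSeq_mul hα μ w v
    simp only [mul_comm ((linearizedSeq hα μ w).1 _)] at h2
    refine ⟨h1.summable, h2.summable, ?_⟩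
    rw [h1.tsum_eq, h2.tsum_eq]
    congr 1
    · exact tsum_congr fun k => by ring
    · exact add_comm _ _
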